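/- In \textsc{Weighted-B-Matching} we are given a bipartite graph with finite vertex classes $X$, $Y$ and edge set $E \subseteq X \times Y$, a weight function $w : E \to \mathbb{R}$, a capacity function $c : X \to \mathbb{Z}$ with $c(x) \ge 0$ for all $x$, and $K \in \mathbb{N}$. A set $M \subseteq E$ is feasible if every $x \in X$ lies on at most $c(x)$ edges of $M$, every $y \in Y$ lies on at most one edge of $M$, and at most $K$ vertices of $X$ lie on an edge of $M$. The goal is to maximize $w(M) = \sum_{e \in M} w(e)$ over feasible $M$. In Monroe winner determination with $k$-approval utilities we are given $n$ voters, $m$ candidates, a set of exactly $k$ approved candidates for each voter, and an integer $K$ with $1 \le K \le m$. A feasible solution is a set $W$ of exactly $K$ candidates together with an assignment $\Phi$ of the voters to members of $W$ such that every member of $W$ is assigned at least $\lfloor n/K \rfloor$ and at most $\lceil n/K \rceil$ voters. The goal is to maximize the number of voters $i$ that approve of $\Phi(i)$. An FPT approximation scheme for a maximization problem and a parameter $P$ is a collection of algorithms that contains, for each constant $0 < \alpha < 1$, an algorithm that on every instance $I$ returns a feasible solution of value at least $\alpha$ times the maximum value of a feasible solution, and that makes at most $f(P(I)) \cdot |I|^{d}$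 steps for some computable function $f$ and some constant $d$ (both may depend on $\alpha$). Algorithms are programs for a random access machine with integer and real memory cells and indirect addressing, in which reading or writing a cell and the addition, subtraction and comparison of two integers or of two reals take one step each; $|I|$ is $|X| + |Y| + |E| + 1$ for \textsc{Weighted-B-Matching} and $n + m + nk + 1$ for Monroe winner determination. \textbf{Corollary.} (i) There exists an FPT approximation scheme for the maximization variant of \textsc{Weighted-B-Matching} for the parameter $(K, p)$, where $p$ is a bound, given with the instance, on the degrees of the vertices in $Y$. (ii) There exists an FPT approximation scheme for winner determination under the Monroe system with $k$-approval utilities for the parameter $(k, K)$. -/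

import Mathlib

/-!
# Machine model

A random access machine whose memory consists of arrays of integers and arrays of reals, all with
indirect addressing. In unit time it adds, subtracts or compares two integers or two reals, or
reads or writes one cell. There is no multiplication, no rounding and no real constant except `0`.
Programs are finite structured programs, so a program names only finitely many arrays.
-/

/-- A memory state: `ints a i` and `reals a i` are the `i`-th cells of the `a`-th integer array and
of the `a`-th real array. -/
structure RAMState where
  ints : ℕ → ℤ → ℤ
  reals : ℕ → ℤ → ℝ

/-- Integer expressions; `get a i` reads cell `i` of the integer array `a`. -/
inductive IExpr where
  | const (z : ℤ)
  | get (a : ℕ) (i : IExpr)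
  | add (e₁ e₂ : IExpr)
  | sub (e₁ e₂ : IExpr)

/-- Real expressions; `get a i` reads cell `i` of the real array `a`. -/
inductive RExpr where
  | zero
  | get (a : ℕ) (i : IExpr)
  | add (e₁ e₂ : RExpr)
  | sub (e₁ e₂ : RExpr)

/-- Tests. -/
inductive BExpr where
  | ile (e₁ e₂ : IExpr)
  | rle (e₁ e₂ : RExpr)
  | not (b : BExpr)
  | and (b₁ b₂ : BExpr)

namespace IExpr

def eval (s : RAMState) : IExpr → ℤ
  | const z => z
  | get a i => s.ints a (i.eval s)
  | add e₁ e₂ => e₁.eval s + e₂.eval s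
  | sub e₁ e₂ => e₁.eval s - e₂.eval s

/-- Number of operations performed in evaluating the expression. -/
def cost : IExpr → ℕ
  | const _ => 1
  | get _ i => i.cost + 1
  | add e₁ e₂ => e₁.cost + e₂.cost + 1
  | sub e₁ e₂ => e₁.cost + e₂.cost + 1

end IExpr

namespace RExpr

noncomputable def eval (s : RAMState) : RExpr → ℝ
  | zero => 0
  | get a i => s.reals a (i.eval s)
  | add e₁ e₂ => e₁.eval s + e₂.eval s
  | sub e₁ e₂ => e₁.eval s - e₂.eval s

/-- Number of operations performed in evaluating the expression. -/
def cost : RExpr → ℕ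
  | zero => 1
  | get _ i => i.cost + 1
  | add e₁ e₂ => e₁.cost + e₂.cost + 1
  | sub e₁ e₂ => e₁.cost + e₂.cost + 1

end RExpr

namespace BExpr

def Holds (s : RAMState) : BExpr → Prop
  | ile e₁ e₂ => e₁.eval s ≤ e₂.eval s
  | rle e₁ e₂ => e₁.eval s ≤ e₂.eval s
  | not b => ¬ b.Holds s
  | and b₁ b₂ => b₁.Holds s ∧ b₂.Holds s

/-- Number of operations performed in evaluating the test. -/
def cost : BExpr → ℕ
  | ile e₁ e₂ => e₁.cost + e₂.cost + 1
  | rle e₁ e₂ => e₁.cost + e₂.cost + 1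
  | not b => b.cost + 1
  | and b₁ b₂ => b₁.cost + b₂.cost + 1

end BExpr

namespace RAMState

/-- Write the integer `z` into cell `i` of the integer array `a`. -/
def setInt (s : RAMState) (a : ℕ) (i z : ℤ) : RAMState where
  ints := Function.update s.ints a (Function.update (s.ints a) i z)
  reals := s.reals

/-- Write the real `r` into cell `i` of the real array `a`. -/
def setReal (s : RAMState) (a : ℕ) (i : ℤ) (r : ℝ) : RAMState where
  ints := s.ints
  reals := Function.update s.reals a (Function.update (s.reals a) i r)

end RAMState

/-- Programs. -/
inductive RAMProgram where
  | skip
  | setInt (a : ℕ) (i e : IExpr)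
  | setReal (a : ℕ) (i : IExpr) (e : RExpr)
  | seq (P Q : RAMProgram)
  | ite (b : BExpr) (P Q : RAMProgram)
  | loop (b : BExpr) (P : RAMProgram)

/-- `Exec P s t s'`: started in `s`, the program `P` halts in `s'` after exactly `t` steps.
`loop b P` repeats `P` as long as the test `b` holds. -/
inductive Exec : RAMProgram → RAMState → ℕ → RAMState → Prop where
  | skip (s : RAMState) : Exec .skip s 1 s
  | setInt (s : RAMState) (a : ℕ) (i e : IExpr) :
      Exec (.setInt a i e) s (i.cost + e.cost + 1) (s.setInt a (i.eval s) (e.eval s))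
  | setReal (s : RAMState) (a : ℕ) (i : IExpr) (e : RExpr) :
      Exec (.setReal a i e) s (i.cost + e.cost + 1) (s.setReal a (i.eval s) (e.eval s))
  | seq {P Q : RAMProgram} {s s₁ s₂ : RAMState} {t₁ t₂ : ℕ} :
      Exec P s t₁ s₁ → Exec Q s₁ t₂ s₂ → Exec (.seq P Q) s (t₁ + t₂) s₂
  | iteTrue {b : BExpr} {P Q : RAMProgram} {s s₁ : RAMState} {t : ℕ} :
      b.Holds s → Exec P s t s₁ → Exec (.ite b P Q) s (b.cost + 1 + t) s₁
  | iteFalse {b : BExpr} {P Q : RAMProgram} {s s₁ : RAMState} {t : ℕ} :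
      ¬ b.Holds s → Exec Q s t s₁ → Exec (.ite b P Q) s (b.cost + 1 + t) s₁
  | loopStop {b : BExpr} {P : RAMProgram} {s : RAMState} :
      ¬ b.Holds s → Exec (.loop b P) s (b.cost + 1) s
  | loopStep {b : BExpr} {P : RAMProgram} {s s₁ s₂ : RAMState} {t₁ t₂ : ℕ} :
      b.Holds s → Exec P s t₁ s₁ → Exec (.loop b P) s₁ t₂ s₂ →
      Exec (.loop b P) s (b.cost + 1 + t₁ + t₂) s₂

/-- Runs are deterministic: the number of steps and the final state are determined. -/
theorem Exec.deterministic {P : RAMProgram} {s s' s'' : RAMState} {t t' : ℕ}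
    (h : Exec P s t s') (h' : Exec P s t' s'') : t = t' ∧ s' = s'' := by
  induction h generalizing t' s'' with
  | skip => cases h'; exact ⟨rfl, rfl⟩
  | setInt => cases h'; exact ⟨rfl, rfl⟩
  | setReal => cases h'; exact ⟨rfl, rfl⟩
  | seq _ _ ih₁ ih₂ =>
    cases h' with
    | seq k₁ k₂ =>
      obtain ⟨rfl, rfl⟩ := ih₁ k₁
      obtain ⟨rfl, rfl⟩ := ih₂ k₂
      exact ⟨rfl, rfl⟩
  | iteTrue hb _ ih =>
    cases h' with
    | iteTrue _ k => obtain ⟨rfl, rfl⟩ := ih k; exact ⟨rfl, rfl⟩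
    | iteFalse hn _ => exact absurd hb hn
  | iteFalse hb _ ih =>
    cases h' with
    | iteTrue hn _ => exact absurd hn hb
    | iteFalse _ k => obtain ⟨rfl, rfl⟩ := ih k; exact ⟨rfl, rfl⟩
  | loopStop hb =>
    cases h' with
    | loopStop => exact ⟨rfl, rfl⟩
    | loopStep hn _ _ => exact absurd hn hb
  | loopStep hb _ _ ih₁ ih₂ =>
    cases h' with
    | loopStop hn => exact absurd hb hn
    | loopStep _ k₁ k₂ =>
      obtain ⟨rfl, rfl⟩ := ih₁ k₁
      obtain ⟨rfl, rfl⟩ := ih₂ k₂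
      exact ⟨rfl, rfl⟩

/-- The array that holds the given finite sequence in cells `0, …, n - 1`, and `0` elsewhere. -/
def arrayOf {R : Type} [Zero R] {n : ℕ} (f : Fin n → R) (i : ℤ) : R :=
  if h : 0 ≤ i ∧ i.toNat < n then f ⟨i.toNat, h.2⟩ else 0

/-! # Parameterized maximization problems and FPT approximation schemes -/

/-- A maximization problem together with its input and output format and a parameter that consists
of two natural numbers. `Outputs I s S` says that the solution `S` is what is written in the output
cells of the memory state `s`. -/
structure ParamMaxProblem where
  Inst : Type
  Sol : Inst → Type
  Feasible : ∀ I : Inst, Sol I → Prop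
  value : ∀ I : Inst, Sol I → ℝ
  param : Inst → ℕ × ℕ
  size : Inst → ℕ
  input : Inst → RAMState
  Outputs : ∀ I : Inst, RAMState → Sol I → Prop

/-- The program `P` is an `α`-approximation algorithm: on every instance it halts with a feasible
solution whose value is at least `α` times the value of every feasible solution. -/
def IsApproxAlgorithm (Q : ParamMaxProblem) (α : ℝ) (P : RAMProgram) : Prop :=
  ∀ I : Q.Inst, ∃ (t : ℕ) (s : RAMState) (S : Q.Sol I), Exec P (Q.input I) t s ∧
    Q.Outputs I s S ∧ Q.Feasible I S ∧ ∀ T : Q.Sol I, Q.Feasible I T → α * Q.value I T ≤ Q.value I S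

/-- The program `P` runs in FPT time: at most `f (parameter) * size ^ d` steps, with `f`
computable and `d` constant. -/
def RunsInFPTTime (Q : ParamMaxProblem) (P : RAMProgram) : Prop :=
  ∃ (f : ℕ × ℕ → ℕ) (d : ℕ), Computable f ∧
    ∀ I : Q.Inst, ∃ (t : ℕ) (s : RAMState), Exec P (Q.input I) t s ∧
      t ≤ f (Q.param I) * Q.size I ^ d

/-- For each constant `0 < α < 1` there is an `α`-approximation algorithm that runs in FPT time. -/
def HasFPTApproxScheme (Q : ParamMaxProblem) : Prop :=
  ∀ α : ℝ, 0 < α → α < 1 → ∃ P : RAMProgram, IsApproxAlgorithm Q α P ∧ RunsInFPTTime Q P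

/-! # Weighted B-matching -/

/-- An instance: a bipartite graph with vertex classes `X = Fin nX` and `Y = Fin nY` whose edges are
listed without repetition, with real weights on the edges, capacities on `X`, the bound `K`
on the number of vertices of `X` that may be used, and a bound `p` on the degrees in `Y`. -/
structure BMatchingInst where
  nX : ℕ
  nY : ℕ
  nE : ℕ
  edge : Fin nE → Fin nX × Fin nY
  edge_injective : Function.Injective edge
  w : Fin nE → ℝ
  c : Fin nX → ℤ
  c_nonneg : ∀ x, 0 ≤ c x
  K : ℕ
  p : ℕ
  degree_le : ∀ y : Fin nY, (Finset.univ.filter fun e => (edge e).2 = y).card ≤ p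

namespace BMatchingInst

/-- The sets of edges allowed as solutions. -/
def Feasible (I : BMatchingInst) (M : Finset (Fin I.nE)) : Prop :=
  (∀ x : Fin I.nX, ((M.filter fun e => (I.edge e).1 = x).card : ℤ) ≤ I.c x) ∧
  (∀ y : Fin I.nY, (M.filter fun e => (I.edge e).2 = y).card ≤ 1) ∧
  (M.image fun e => (I.edge e).1).card ≤ I.K

/-- Integer array `0` holds `|X|, |Y|, |E|, K, p`; integer arrays `1` and `2` hold the endpoints of
the edges in `X` and in `Y`; integer array `3` holds the capacities; real array `0` holds the
weights; everything else is `0`. -/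
def input (I : BMatchingInst) : RAMState where
  ints a := match a with
    | 0 => arrayOf ![(I.nX : ℤ), (I.nY : ℤ), (I.nE : ℤ), (I.K : ℤ), (I.p : ℤ)]
    | 1 => arrayOf fun e => (((I.edge e).1 : ℕ) : ℤ)
    | 2 => arrayOf fun e => (((I.edge e).2 : ℕ) : ℤ)
    | 3 => arrayOf I.c
    | _ => fun _ => 0
  reals a := match a with
    | 0 => arrayOf I.w
    | _ => fun _ => 0

end BMatchingInst

/-- Weighted B-matching, maximization variant, with parameter `(K, p)`. The output is the indicator
of the chosen set of edges, in integer array `4`. -/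
noncomputable def weightedBMatching : ParamMaxProblem where
  Inst := BMatchingInst
  Sol I := Finset (Fin I.nE)
  Feasible I M := I.Feasible M
  value I M := ∑ e ∈ M, I.w e
  param I := (I.K, I.p)
  size I := I.nX + I.nY + I.nE + 1
  input I := I.input
  Outputs I s M := ∀ e : Fin I.nE, s.ints 4 ((e : ℕ) : ℤ) = if e ∈ M then 1 else 0

/-! # Monroe winner determination with approval utilities -/

/-- An election with `n` voters and `m` candidates in which every voter approves of exactly `k`
candidates, listed without repetition by `ballot i`; `K` is the size of the committee. -/
structure MonroeInst where
  n : ℕ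
  m : ℕ
  k : ℕ
  K : ℕ
  one_le_K : 1 ≤ K
  K_le_m : K ≤ m
  ballot : Fin n → Fin k → Fin m
  ballot_injective : ∀ i, Function.Injective (ballot i)

namespace MonroeInst

/-- Utility of candidate `a` for voter `i`. -/
noncomputable def utility (I : MonroeInst) (i : Fin I.n) (a : Fin I.m) : ℝ :=
  open Classical in if ∃ j, I.ballot i j = a then 1 else 0

/-- A committee `W` of exactly `K` candidates and an assignment `Φ` of the voters to members of `W`
such that every member represents at least `⌊n / K⌋` and at most `⌈n / K⌉` voters. -/
def Feasible (I : MonroeInst) (W : Finset (Fin I.m)) (Φ : Fin I.n → Fin I.m) : Prop :=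
  W.card = I.K ∧ (∀ i, Φ i ∈ W) ∧
  ∀ a ∈ W, I.n / I.K ≤ (Finset.univ.filter fun i => Φ i = a).card ∧
    (Finset.univ.filter fun i => Φ i = a).card ≤ I.n ⌈/⌉ I.K

/-- Integer array `0` holds `n, m, k, K`; integer array `1` holds the ballots one after the other,
`k` cells for each voter; everything else is `0`. -/
def input (I : MonroeInst) : RAMState where
  ints a := match a with
    | 0 => arrayOf ![(I.n : ℤ), (I.m : ℤ), (I.k : ℤ), (I.K : ℤ)]
    | 1 => arrayOf fun q : Fin (I.n * I.k) => ((I.ballot q.divNat q.modNat : ℕ) : ℤ)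
    | _ => fun _ => 0
  reals _ _ := 0

end MonroeInst

/-- Winner determination under the (utilitarian) Monroe system with `k`-approval utilities, with
parameter `(k, K)`. The output is the indicator of the committee, in integer array `2`, and the
assignment of the voters, in integer array `3`. -/
noncomputable def monroeApproval : ParamMaxProblem where
  Inst := MonroeInst
  Sol I := Finset (Fin I.m) × (Fin I.n → Fin I.m)
  Feasible I S := I.Feasible S.1 S.2
  value I S := ∑ i, I.utility i (S.2 i)
  param I := (I.k, I.K)
  size I := I.n + I.m + I.n * I.k + 1
  input I := I.input
  Outputs I s S :=
    (∀ a : Fin I.m, s.ints 2 ((a : ℕ) : ℤ) = if a ∈ S.1 then 1 else 0) ∧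
    ∀ i : Fin I.n, s.ints 3 ((i : ℕ) : ℤ) = ((S.2 i : ℕ) : ℤ)

/-!
# A language of bounded loops

Programs over named integer and weight arrays whose only loops run a counter up to a bound that the
loop body does not change. They have a total denotational semantics, compile to the random access
machine, and have a running time that is bounded by a polynomial in the loop bounds.
The weights are integers or reals, according to the chosen backend.
-/

/-! Both problems are instances of one: given a bipartite graph with capacities `c₁ ≤ c₂` on `X`,
open at most `K₁` vertices with capacity `c₁` and at most `K₂` with capacity `c₂`, and find a
matching of large weight at the open vertices. B-matching has `c₁ = c₂ = c`, `K₁ = K` and `K₂ = 0`.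
Monroe has the quotas `⌊n/K⌋` and `⌈n/K⌉` with `K₂ = n mod K` and `K₁ = K - K₂`. Put `k = K₁ + K₂`,
let `p` bound the degrees in `Y`, and choose `q` with `α ≤ 1 - 1/q`.

Only few vertices of `X` matter. Rank them by the value of a best matching at that vertex alone, and
let `A` be the first `N = k + n₀` of them, with `n₀ = 1 + 2qkp`. If an optimal solution of value `V`
opens some `x` outside `A`, at least `n₀` vertices of `A` are still closed, and each has a matching
of its own that is as good as the part of the solution at `x`. Every `y` lies on at most `p` edges,
so these matchings conflict with the solution in edges of total weight at most `pV`, and one of them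
in weight at most `pV/n₀` (`exists_replace`). At most `k` such exchanges move the solution into `A`,
at a total loss below `V/(2q)` (`exists_supported`). It then suffices to try all `3 ^ N` ways to
give the vertices of `A` one of the types closed, `c₁`, `c₂`, and to solve one capacitated matching
problem for each.

These matching problems are solved by an auction with price increment `ε`. By weak duality its
result is optimal up to `nY * ε` (`AucInv.val_le`), and it ends after at most `nX * nY * L` bids if
no weight exceeds `L * ε` (`AucInv.stable_of_sum_le`). Since the machine cannot divide, `ε` is the
largest weight of a usable edge and all weights are multiplied by `L = 1 + 2q(k+1) * nY`. A single
edge then has value `L * ε`, so the `k + 1` additive errors of size `nY * ε` together cost at most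
another `V/(2q)`. Hence the result is at least `(1 - 1/q) V` (`approx_of_supported`,
`run_mainProg`).

For Monroe the matching still has to be completed. Once exactly `K₁` and `K₂` candidates have the
two types, the capacities add up to `n`, so that placing the remaining voters wherever there is room
fills every capacity exactly (`run_restProg`). Conversely, every feasible committee yields an
admissible choice of types (`MonroeInst.exists_adm`).

To run this on the machine, the algorithm is written in a language of bounded loops whose compiled
programs run in time polynomial in the loop bounds (`Backend.exec_compile`). All loop bounds are at
most a primitive recursive function of the parameters times the size of the instance. -/

/-- Names of integer arrays; scalars are stored in cell `0`. -/
inductive IName where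
  | dims | src | dst | cap | best | outW | outPhi | typ
  | nX | nY | nE | K | K1 | K2 | p | L | N | pow
  | cap1 | cap2 | base | kap | asg | busy | rank | dig | bestD | rem
  | vx | vj | ve | vs | vt | va | vb | vc | vy
  | be | bs | r | c1 | c2 | quo | sel
  deriving DecidableEq

/-- Names of weight arrays; scalars are stored in cell `0`. -/
inductive WName where
  | w | u | eps | price | net | val | F | bestVal
  deriving DecidableEq

/-- Memory states over named arrays; `unit` is the only weight constant besides `0`. -/
structure St (R : Type) where
  i : IName → ℤ → ℤ
  w : WName → ℤ → R
  unit : R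

namespace St

variable {R : Type}

def setI (s : St R) (a : IName) (i z : ℤ) : St R :=
  { s with i := Function.update s.i a (Function.update (s.i a) i z) }

def setW (s : St R) (b : WName) (i : ℤ) (z : R) : St R :=
  { s with w := Function.update s.w b (Function.update (s.w b) i z) }

@[simp] theorem setI_i_self (s : St R) (a : IName) (i z : ℤ) :
    (s.setI a i z).i a = Function.update (s.i a) i z := by simp [setI]

@[simp] theorem setI_i_of_ne (s : St R) {a b : IName} (h : b ≠ a) (i z : ℤ) :
    (s.setI a i z).i b = s.i b := by simp [setI, h]

@[simp] theorem setI_w (s : St R) (a : IName) (i z : ℤ) : (s.setI a i z).w = s.w := rfl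

@[simp] theorem setI_unit (s : St R) (a : IName) (i z : ℤ) : (s.setI a i z).unit = s.unit := rfl

@[simp] theorem setW_w_self (s : St R) (a : WName) (i : ℤ) (z : R) :
    (s.setW a i z).w a = Function.update (s.w a) i z := by simp [setW]

@[simp] theorem setW_w_of_ne (s : St R) {a b : WName} (h : b ≠ a) (i : ℤ) (z : R) :
    (s.setW a i z).w b = s.w b := by simp [setW, h]

@[simp] theorem setW_i (s : St R) (a : WName) (i : ℤ) (z : R) : (s.setW a i z).i = s.i := rfl

end St

/-- Integer expressions. -/
inductive IX where
  | const (z : ℤ)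
  | get (a : IName) (i : IX)
  | add (e f : IX)
  | sub (e f : IX)

/-- Weight expressions. -/
inductive WX where
  | zero
  | unit
  | get (b : WName) (i : IX)
  | add (e f : WX)
  | sub (e f : WX)

/-- Tests. -/
inductive BX where
  | ile (e f : IX)
  | wle (e f : WX)
  | not (b : BX)
  | and (b c : BX)

/-- Programs; `forTo v n P` runs `P` for `v = 0, …, n - 1`. -/
inductive FProg where
  | skip
  | setI (a : IName) (i e : IX)
  | setW (b : WName) (i : IX) (e : WX)
  | seq (P Q : FProg)
  | ite (b : BX) (P Q : FProg)
  | forTo (v n : IName) (P : FProg)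

/-- The integer scalar `a`. -/
abbrev IX.sc (a : IName) : IX := .get a (.const 0)

/-- The weight scalar `b`. -/
abbrev WX.sc (b : WName) : WX := .get b (.const 0)

/-- Assignment to an integer scalar. -/
abbrev FProg.assign (a : IName) (e : IX) : FProg := .setI a (.const 0) e

/-- Assignment to a weight scalar. -/
abbrev FProg.assignW (b : WName) (e : WX) : FProg := .setW b (.const 0) e

/-- Sequential composition of a list of programs. -/
def FProg.block : List FProg → FProg
  | [] => .skip
  | [P] => P
  | P :: Q :: l => .seq P (FProg.block (Q :: l))

/-! ### Denotational semantics and the frame rule -/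

section Semantics

variable {R : Type} [CommRing R] [LinearOrder R]

def IX.eval (s : St R) : IX → ℤ
  | const z => z
  | get a i => s.i a (i.eval s)
  | add e f => e.eval s + f.eval s
  | sub e f => e.eval s - f.eval s

def WX.eval (s : St R) : WX → R
  | zero => 0
  | unit => s.unit
  | get b i => s.w b (i.eval s)
  | add e f => e.eval s + f.eval s
  | sub e f => e.eval s - f.eval s

def BX.Holds (s : St R) : BX → Prop
  | ile e f => e.eval s ≤ f.eval s
  | wle e f => e.eval s ≤ f.eval s
  | not b => ¬ b.Holds s
  | and b c => b.Holds s ∧ c.Holds s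

/-- The state after `k` rounds of a counting loop. -/
def forRun (f : St R → St R) (v : IName) (s : St R) : ℕ → St R
  | 0 => s.setI v 0 0
  | k + 1 => (f (forRun f v s k)).setI v 0 (k + 1)

namespace FProg

-- The bound of a loop is read once, on entry, so every program terminates; a negative bound counts
-- as zero.
open Classical in
noncomputable def run : FProg → St R → St R
  | skip, s => s
  | setI a i e, s => s.setI a (i.eval s) (e.eval s)
  | setW b i e, s => s.setW b (i.eval s) (e.eval s)
  | seq P Q, s => Q.run (P.run s)
  | ite b P Q, s => if b.Holds s then P.run s else Q.run s
  | forTo v n P, s => forRun P.run v s (s.i n 0).toNat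

/-- The integer arrays that a program may change. -/
def iw : FProg → List IName
  | skip => []
  | setI a _ _ => [a]
  | setW _ _ _ => []
  | seq P Q => P.iw ++ Q.iw
  | ite _ P Q => P.iw ++ Q.iw
  | forTo v _ P => v :: P.iw

/-- The weight arrays that a program may change. -/
def ww : FProg → List WName
  | skip => []
  | setI _ _ _ => []
  | setW b _ _ => [b]
  | seq P Q => P.ww ++ Q.ww
  | ite _ P Q => P.ww ++ Q.ww
  | forTo _ _ P => P.ww

/-- The loop bounds of a program. -/
def bnds : FProg → List IName
  | skip => []
  | setI _ _ _ => []
  | setW _ _ _ => []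
  | seq P Q => P.bnds ++ Q.bnds
  | ite _ P Q => P.bnds ++ Q.bnds
  | forTo _ n P => n :: P.bnds

/-- No loop body changes the counter of its loop. -/
def ok : FProg → Bool
  | skip => true
  | setI _ _ _ => true
  | setW _ _ _ => true
  | seq P Q => P.ok && Q.ok
  | ite _ P Q => P.ok && Q.ok
  | forTo v _ P => decide (v ∉ P.iw) && P.ok

/-- The nesting depth of the loops. -/
def depth : FProg → ℕ
  | skip => 0
  | setI _ _ _ => 0
  | setW _ _ _ => 0
  | seq P Q => max P.depth Q.depth
  | ite _ P Q => max P.depth Q.depth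
  | forTo _ _ P => P.depth + 1

end FProg

/-- `s'` agrees with `s` outside of the integer arrays in `A` and the weight arrays in `V`. -/
structure Agree (A : List IName) (V : List WName) (s s' : St R) : Prop where
  i : ∀ a, a ∉ A → s'.i a = s.i a
  w : ∀ b, b ∉ V → s'.w b = s.w b
  unit : s'.unit = s.unit

omit [CommRing R] [LinearOrder R] in
theorem Agree.trans {A : List IName} {V : List WName} {s s' s'' : St R} (h : Agree A V s s')
    (h' : Agree A V s' s'') : Agree A V s s'' :=
  ⟨fun a ha => (h'.i a ha).trans (h.i a ha), fun b hb => (h'.w b hb).trans (h.w b hb),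
    h'.unit.trans h.unit⟩

omit [CommRing R] [LinearOrder R] in
theorem Agree.mono {A A' : List IName} {V V' : List WName} {s s' : St R} (h : Agree A V s s')
    (hA : A ⊆ A') (hV : V ⊆ V') : Agree A' V' s s' :=
  ⟨fun a ha => h.i a fun h' => ha (hA h'), fun b hb => h.w b fun h' => hb (hV h'), h.unit⟩

omit [CommRing R] [LinearOrder R] in
theorem agree_setI (s : St R) (a : IName) (i z : ℤ) : Agree [a] [] s (s.setI a i z) :=
  ⟨fun b hb => by simp at hb; simp [hb], fun _ _ => rfl, rfl⟩

omit [CommRing R] [LinearOrder R] in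
theorem agree_setW (s : St R) (b : WName) (i : ℤ) (z : R) : Agree [] [b] s (s.setW b i z) :=
  ⟨fun _ _ => rfl, fun c hc => by simp at hc; simp [hc], rfl⟩

omit [CommRing R] [LinearOrder R] in
theorem Agree.refl (A : List IName) (V : List WName) (s : St R) : Agree A V s s :=
  ⟨fun _ _ => rfl, fun _ _ => rfl, rfl⟩

omit [CommRing R] [LinearOrder R] in
theorem agree_forRun {A : List IName} {V : List WName} {f : St R → St R}
    (hf : ∀ s, Agree A V s (f s)) (v : IName) (s : St R) (k : ℕ) :
    Agree (v :: A) V s (forRun f v s k) := by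
  induction k with
  | zero => exact (agree_setI s v 0 0).mono (by simp) (by simp)
  | succ k ih =>
    refine (ih.trans ((hf _).mono (by simp) (by simp))).trans ?_
    exact (agree_setI _ v 0 _).mono (by simp) (by simp)

/-- The frame rule. The sets of written arrays are syntactic, so the claim that an array survives a
concrete program is settled by evaluation. -/
theorem FProg.agree_run (P : FProg) (s : St R) : Agree P.iw P.ww s (P.run s) := by
  induction P generalizing s with
  | skip => exact .refl _ _ _
  | setI a i e => exact agree_setI _ _ _ _
  | setW a i e => exact agree_setW _ _ _ _
  | seq P Q ihP ihQ =>
    exact ((ihP s).mono (by simp [iw]) (by simp [ww])).trans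
      ((ihQ _).mono (by simp [iw]) (by simp [ww]))
  | ite b P Q ihP ihQ =>
    simp only [run]
    split_ifs
    · exact (ihP s).mono (by simp [iw]) (by simp [ww])
    · exact (ihQ s).mono (by simp [iw]) (by simp [ww])
  | forTo v n P ih => exact agree_forRun ih v s _

omit [CommRing R] [LinearOrder R] in
@[simp] theorem forRun_counter (f : St R → St R) (v : IName) (s : St R) (k : ℕ) :
    (forRun f v s k).i v 0 = k := by
  cases k <;> simp [forRun]

end Semantics

/-! # Compilation -/

def IX.compile (ι : IName → ℕ) : IX → IExpr
  | const z => .const z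
  | get a i => .get (ι a) (i.compile ι)
  | add e f => .add (e.compile ι) (f.compile ι)
  | sub e f => .sub (e.compile ι) (f.compile ι)

/-- A way to store the states over named arrays in the memory of the machine. -/
structure Backend (R : Type) [CommRing R] [LinearOrder R] where
  ι : IName → ℕ
  abs : RAMState → St R
  abs_i : ∀ r a, (abs r).i a = r.ints (ι a)
  abs_setInt : ∀ r a i z, abs (r.setInt (ι a) i z) = (abs r).setI a i z
  wle : WX → WX → BExpr
  wle_holds : ∀ r e f, (wle e f).Holds r ↔ e.eval (abs r) ≤ f.eval (abs r)
  wset : WName → IX → WX → RAMProgram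
  wsetCost : WName → IX → WX → ℕ
  exec_wset : ∀ r b i e, ∃ r', Exec (wset b i e) r (wsetCost b i e) r' ∧
    abs r' = (abs r).setW b (i.eval (abs r)) (e.eval (abs r))

namespace Backend

variable {R : Type} [CommRing R] [LinearOrder R] (β : Backend R)

theorem eval_compile (r : RAMState) (e : IX) :
    (e.compile β.ι).eval r = e.eval (β.abs r) := by
  induction e with
  | const z => rfl
  | get a i ih => simp [IX.compile, IExpr.eval, IX.eval, ih, β.abs_i]
  | add e f ihe ihf => simp [IX.compile, IExpr.eval, IX.eval, ihe, ihf]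
  | sub e f ihe ihf => simp [IX.compile, IExpr.eval, IX.eval, ihe, ihf]

def compileB : BX → BExpr
  | .ile e f => .ile (e.compile β.ι) (f.compile β.ι)
  | .wle e f => β.wle e f
  | .not b => .not (compileB b)
  | .and b c => .and (compileB b) (compileB c)

theorem holds_compileB (r : RAMState) (b : BX) :
    (β.compileB b).Holds r ↔ b.Holds (β.abs r) := by
  induction b with
  | ile e f => simp [compileB, BExpr.Holds, BX.Holds, eval_compile]
  | wle e f => simp [compileB, BX.Holds, β.wle_holds]
  | not b ih => simp [compileB, BExpr.Holds, BX.Holds, ih]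
  | and b c ihb ihc => simp [compileB, BExpr.Holds, BX.Holds, ihb, ihc]

/-- The test of a compiled counting loop. -/
def loopTest (v n : IName) : BExpr :=
  .not (.ile (.get (β.ι n) (.const 0)) (.get (β.ι v) (.const 0)))

/-- The increment of the counter of a loop. -/
def loopIncr (v : IName) : RAMProgram :=
  .setInt (β.ι v) (.const 0) (.add (.get (β.ι v) (.const 0)) (.const 1))

def compile : FProg → RAMProgram
  | .skip => .skip
  | .setI a i e => .setInt (β.ι a) (i.compile β.ι) (e.compile β.ι)
  | .setW b i e => β.wset b i e
  | .seq P Q => .seq (compile P) (compile Q)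
  | .ite b P Q => .ite (β.compileB b) (compile P) (compile Q)
  | .forTo v n P => .seq (.setInt (β.ι v) (.const 0) (.const 0))
      (.loop (β.loopTest v n) (.seq (compile P) (β.loopIncr v)))

/-- The coefficient in the bound on the running time. -/
def coef : FProg → ℕ
  | .skip => 1
  | .setI _ i e => (i.compile β.ι).cost + (e.compile β.ι).cost + 1
  | .setW b i e => β.wsetCost b i e
  | .seq P Q => coef P + coef Q
  | .ite b P Q => (β.compileB b).cost + 1 + coef P + coef Q
  | .forTo _ _ P => coef P + 23

/-- Induction on the number `m` of rounds still to run. The compiled loop rereads its bound and its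
counter in every round, whereas the denotation fixes the bound on entry; `hn` and `hv` make the two
agree. A test takes 7 steps and an increment 6, hence 13 extra steps for each round and 7 for the
last test. -/
theorem exec_loop {P : FProg} {v n : IName} {s : St R} {c : ℕ}
    (hv : v ∉ P.iw) (hn : n ∉ v :: P.iw)
    (hP : ∀ r k, β.abs r = forRun P.run v s k →
      ∃ t r', Exec (β.compile P) r t r' ∧ β.abs r' = P.run (β.abs r) ∧ t ≤ c)
    (m : ℕ) : ∀ (k : ℕ) (r : RAMState), k + m = (s.i n 0).toNat → β.abs r = forRun P.run v s k →
      ∃ t r', Exec (.loop (β.loopTest v n) (.seq (β.compile P) (β.loopIncr v))) r t r' ∧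
        β.abs r' = forRun P.run v s (s.i n 0).toNat ∧ t ≤ m * (c + 13) + 7 := by
  induction m with
  | zero =>
    intro k r hk hr
    refine ⟨_, r, .loopStop ?_, by rw [hr, ← hk]; simp, by simp [loopTest, BExpr.cost, IExpr.cost]⟩
    have h1 : r.ints (β.ι v) 0 = k := by rw [← β.abs_i, hr]; simp
    have h2 : r.ints (β.ι n) 0 = s.i n 0 := by
      rw [← β.abs_i, hr, (agree_forRun P.agree_run v s k).i n hn]
    simp only [loopTest, BExpr.Holds, IExpr.eval, h1, h2]
    omega
  | succ m ih =>
    intro k r hk hr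
    obtain ⟨t, r', h, hr', ht⟩ := hP r k hr
    have h1 : r.ints (β.ι v) 0 = k := by rw [← β.abs_i, hr]; simp
    have h2 : r.ints (β.ι n) 0 = s.i n 0 := by
      rw [← β.abs_i, hr, (agree_forRun P.agree_run v s k).i n hn]
    have h3 : r'.ints (β.ι v) 0 = k := by
      rw [← β.abs_i, hr', hr, (P.agree_run _).i v hv]; simp
    have hstep : Exec (β.loopIncr v) r' 6 (r'.setInt (β.ι v) 0 (k + 1)) := by
      have := Exec.setInt r' (β.ι v) (.const 0) (.add (.get (β.ι v) (.const 0)) (.const 1))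
      simpa [loopIncr, IExpr.eval, IExpr.cost, h3] using this
    obtain ⟨t', r'', h', hr'', ht'⟩ := ih (k + 1) (r'.setInt (β.ι v) 0 (k + 1)) (by omega)
      (by rw [β.abs_setInt, hr', hr, forRun])
    refine ⟨_, r'', .loopStep ?_ (.seq h hstep) h', hr'', ?_⟩
    · simp only [loopTest, BExpr.Holds, IExpr.eval, h1, h2]
      omega
    · simp only [loopTest, BExpr.cost, IExpr.cost]
      linarith

/-- A compiled program computes the denotation, in time polynomial in the loop bounds. -/
theorem exec_compile (B : ℕ) (P : FProg) (hok : P.ok = true) : ∀ r : RAMState,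
    (∀ b ∈ P.bnds, b ∉ P.iw ∧ (β.abs r).i b 0 ≤ B) →
    ∃ t r', Exec (β.compile P) r t r' ∧ β.abs r' = P.run (β.abs r) ∧
      t ≤ β.coef P * (B + 1) ^ P.depth := by
  induction P with
  | skip => exact fun r _ => ⟨1, r, .skip r, rfl, by simp [coef, FProg.depth]⟩
  | setI a i e =>
    intro r _
    refine ⟨_, _, .setInt r _ _ _, ?_, by simp [coef, FProg.depth]⟩
    rw [β.abs_setInt, eval_compile, eval_compile, FProg.run]
  | setW b i e =>
    intro r _
    obtain ⟨r', h, hr'⟩ := β.exec_wset r b i e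
    exact ⟨_, r', h, hr', by simp [coef, FProg.depth]⟩
  | seq P Q ihP ihQ =>
    intro r hb
    simp only [FProg.ok, Bool.and_eq_true] at hok
    simp only [FProg.bnds, FProg.iw, List.mem_append, not_or] at hb
    obtain ⟨t, r', h, hr', ht⟩ := ihP hok.1 r fun b h => ⟨(hb b (.inl h)).1.1, (hb b (.inl h)).2⟩
    obtain ⟨t', r'', h', hr'', ht'⟩ := ihQ hok.2 r' fun b h => by
      refine ⟨(hb b (.inr h)).1.2, ?_⟩
      rw [hr', (P.agree_run _).i b (hb b (.inr h)).1.1]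
      exact (hb b (.inr h)).2
    refine ⟨_, r'', .seq h h', by rw [hr'', hr', FProg.run], ?_⟩
    have h1 : (B + 1) ^ P.depth ≤ (B + 1) ^ max P.depth Q.depth :=
      Nat.pow_le_pow_right (by omega) (le_max_left _ _)
    have h2 : (B + 1) ^ Q.depth ≤ (B + 1) ^ max P.depth Q.depth :=
      Nat.pow_le_pow_right (by omega) (le_max_right _ _)
    simp only [coef, FProg.depth, add_mul]
    exact add_le_add (ht.trans (Nat.mul_le_mul_left _ h1)) (ht'.trans (Nat.mul_le_mul_left _ h2))
  | ite b P Q ihP ihQ =>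
    intro r hb
    simp only [FProg.ok, Bool.and_eq_true] at hok
    simp only [FProg.bnds, FProg.iw, List.mem_append, not_or] at hb
    have h0 : 1 ≤ (B + 1) ^ max P.depth Q.depth := Nat.one_le_pow _ _ (by omega)
    have h1 : (B + 1) ^ P.depth ≤ (B + 1) ^ max P.depth Q.depth :=
      Nat.pow_le_pow_right (by omega) (le_max_left _ _)
    have h2 : (B + 1) ^ Q.depth ≤ (B + 1) ^ max P.depth Q.depth :=
      Nat.pow_le_pow_right (by omega) (le_max_right _ _)
    have h3 := Nat.mul_le_mul_left ((β.compileB b).cost + 1) h0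
    by_cases hc : b.Holds (β.abs r)
    · obtain ⟨t, r', h, hr', ht⟩ := ihP hok.1 r fun b h => ⟨(hb b (.inl h)).1.1, (hb b (.inl h)).2⟩
      refine ⟨_, r', .iteTrue ((β.holds_compileB r b).2 hc) h, by rw [hr', FProg.run, if_pos hc], ?_⟩
      simp only [coef, FProg.depth, add_mul]
      have := ht.trans (Nat.mul_le_mul_left _ h1)
      linarith [Nat.zero_le (β.coef Q * (B + 1) ^ max P.depth Q.depth)]
    · obtain ⟨t, r', h, hr', ht⟩ := ihQ hok.2 r fun b h => ⟨(hb b (.inr h)).1.2, (hb b (.inr h)).2⟩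
      refine ⟨_, r', .iteFalse (mt (β.holds_compileB r b).1 hc) h,
        by rw [hr', FProg.run, if_neg hc], ?_⟩
      simp only [coef, FProg.depth, add_mul]
      have := ht.trans (Nat.mul_le_mul_left _ h2)
      linarith [Nat.zero_le (β.coef P * (B + 1) ^ max P.depth Q.depth)]
  | forTo v n P ih =>
    intro r hb
    simp only [FProg.ok, Bool.and_eq_true, decide_eq_true_eq] at hok
    simp only [FProg.bnds, FProg.iw, List.mem_cons] at hb
    have hn := hb n (.inl rfl)
    have h0 : Exec (.setInt (β.ι v) (.const 0) (.const 0)) r 3 (r.setInt (β.ι v) 0 0) :=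
      Exec.setInt r (β.ι v) (.const 0) (.const 0)
    obtain ⟨t, r', h, hr', ht⟩ := β.exec_loop (s := β.abs r) (n := n)
      (c := β.coef P * (B + 1) ^ P.depth) hok.1 (by simpa using hn.1)
      (fun r₁ k h₁ => ih hok.2 r₁ fun b hbP => by
        have := hb b (.inr hbP)
        refine ⟨fun h => this.1 (.inr h), ?_⟩
        rw [h₁, (agree_forRun P.agree_run v (β.abs r) k).i b (by simpa using this.1)]
        exact this.2)
      ((β.abs r).i n 0).toNat 0 (r.setInt (β.ι v) 0 0) (by simp) (by rw [β.abs_setInt, forRun])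
    refine ⟨_, r', .seq h0 h, hr', ?_⟩
    have hnB : ((β.abs r).i n 0).toNat ≤ B := by omega
    have h1 : 1 ≤ (B + 1) ^ P.depth := Nat.one_le_pow _ _ (by omega)
    simp only [coef, FProg.depth, pow_succ]
    generalize (B + 1) ^ P.depth = z at *
    -- There are 3 steps of initialization, 7 for the last test and at most `B` rounds of `coef P *
    -- z + 13` steps each; this fits into `(coef P + 23) * (z * (B + 1))`.
    have h2 := Nat.mul_le_mul_right (β.coef P * z + 13) hnB
    have h3 := Nat.mul_le_mul_left (23 * (B + 1)) h1
    nlinarith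

end Backend

/-! # The two backends -/

namespace RealBackend

/-- The machine has no real constant besides `0`, so `unit` degenerates to `0` here. It is needed
only to create the unit weights of an election, which are integers. -/
def compileW (ι : IName → ℕ) : WX → RExpr
  | .zero => .zero
  | .unit => .zero
  | .get b i => .get b.ctorIdx (i.compile ι)
  | .add e f => .add (compileW ι e) (compileW ι f)
  | .sub e f => .sub (compileW ι e) (compileW ι f)

def abs (ι : IName → ℕ) (r : RAMState) : St ℝ where
  i a := r.ints (ι a)
  w b := r.reals b.ctorIdx
  unit := 0

theorem eval_compileI (ι : IName → ℕ) (r : RAMState) (e : IX) :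
    (e.compile ι).eval r = e.eval (abs ι r) := by
  induction e with
  | const z => rfl
  | get a i ih => simp [IX.compile, IExpr.eval, IX.eval, ih, abs]
  | add e f ihe ihf => simp [IX.compile, IExpr.eval, IX.eval, ihe, ihf]
  | sub e f ihe ihf => simp [IX.compile, IExpr.eval, IX.eval, ihe, ihf]

theorem eval_compileW (ι : IName → ℕ) (r : RAMState) (e : WX) :
    (compileW ι e).eval r = e.eval (abs ι r) := by
  induction e with
  | zero => rfl
  | unit => rfl
  | get a i => simp [compileW, RExpr.eval, WX.eval, eval_compileI]; rfl
  | add e f ihe ihf => simp [compileW, RExpr.eval, WX.eval, ihe, ihf]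
  | sub e f ihe ihf => simp [compileW, RExpr.eval, WX.eval, ihe, ihf]

theorem ctorIdx_injective : Function.Injective WName.ctorIdx := by
  intro a b h
  cases a <;> cases b <;> first | rfl | cases h

end RealBackend

/-- Weights are stored in the real arrays. -/
noncomputable def realBackend (ι : IName → ℕ) (hι : Function.Injective ι) : Backend ℝ where
  ι := ι
  abs := RealBackend.abs ι
  abs_i _ _ := rfl
  abs_setInt r a i z := by
    simp only [RealBackend.abs, RAMState.setInt, St.setI, St.mk.injEq, and_true]
    funext b
    by_cases h : b = a
    · subst h; simp
    · simp [h, hι.ne h]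
  wle e f := .rle (RealBackend.compileW ι e) (RealBackend.compileW ι f)
  wle_holds r e f := by simp [BExpr.Holds, RealBackend.eval_compileW]
  wset b i e := .setReal b.ctorIdx (i.compile ι) (RealBackend.compileW ι e)
  wsetCost b i e := (i.compile ι).cost + (RealBackend.compileW ι e).cost + 1
  exec_wset r b i e := by
    refine ⟨_, .setReal r _ _ _, ?_⟩
    rw [RealBackend.eval_compileW, RealBackend.eval_compileI]
    simp only [RealBackend.abs, RAMState.setReal, St.setW, St.mk.injEq, and_true, true_and]
    funext c
    by_cases h : c = b
    · subst h; simp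
    · simp [h, RealBackend.ctorIdx_injective.ne h]

namespace IntBackend

def compileW (ι : IName → ℕ) (ω : WName → ℕ) : WX → IExpr
  | .zero => .const 0
  | .unit => .const 1
  | .get b i => .get (ω b) (i.compile ι)
  | .add e f => .add (compileW ι ω e) (compileW ι ω f)
  | .sub e f => .sub (compileW ι ω e) (compileW ι ω f)

def abs (ι : IName → ℕ) (ω : WName → ℕ) (r : RAMState) : St ℤ where
  i a := r.ints (ι a)
  w b := r.ints (ω b)
  unit := 1

theorem eval_compileI (ι : IName → ℕ) (ω : WName → ℕ) (r : RAMState) (e : IX) :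
    (e.compile ι).eval r = e.eval (abs ι ω r) := by
  induction e with
  | const z => rfl
  | get a i ih => simp [IX.compile, IExpr.eval, IX.eval, ih, abs]
  | add e f ihe ihf => simp [IX.compile, IExpr.eval, IX.eval, ihe, ihf]
  | sub e f ihe ihf => simp [IX.compile, IExpr.eval, IX.eval, ihe, ihf]

theorem eval_compileW (ι : IName → ℕ) (ω : WName → ℕ) (r : RAMState) (e : WX) :
    (compileW ι ω e).eval r = e.eval (abs ι ω r) := by
  induction e with
  | zero => rfl
  | unit => rfl
  | get a i => simp [compileW, IExpr.eval, WX.eval, eval_compileI ι ω]; rfl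
  | add e f ihe ihf => simp [compileW, IExpr.eval, WX.eval, ihe, ihf]
  | sub e f ihe ihf => simp [compileW, IExpr.eval, WX.eval, ihe, ihf]

end IntBackend

/-- Weights are integers and are stored in further integer arrays. -/
def intBackend (ι : IName → ℕ) (hι : Function.Injective ι) (ω : WName → ℕ)
    (hω : Function.Injective ω) (hd : ∀ a b, ι a ≠ ω b) : Backend ℤ where
  ι := ι
  abs := IntBackend.abs ι ω
  abs_i _ _ := rfl
  abs_setInt r a i z := by
    simp only [IntBackend.abs, RAMState.setInt, St.setI, St.mk.injEq, and_true]
    refine ⟨funext fun b => ?_, funext fun b => ?_⟩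
    · by_cases h : b = a
      · subst h; simp
      · simp [h, hι.ne h]
    · simp [(hd a b).symm]
  wle e f := .ile (IntBackend.compileW ι ω e) (IntBackend.compileW ι ω f)
  wle_holds r e f := by simp [BExpr.Holds, IntBackend.eval_compileW]
  wset b i e := .setInt (ω b) (i.compile ι) (IntBackend.compileW ι ω e)
  wsetCost b i e := (i.compile ι).cost + (IntBackend.compileW ι ω e).cost + 1
  exec_wset r b i e := by
    refine ⟨_, .setInt r _ _ _, ?_⟩
    rw [IntBackend.eval_compileW, IntBackend.eval_compileI ι ω]
    simp only [IntBackend.abs, RAMState.setInt, St.setW, St.mk.injEq, and_true]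
    refine ⟨funext fun c => ?_, funext fun c => ?_⟩
    · simp [hd c b]
    · by_cases h : c = b
      · subst h; simp
      · simp [h, hω.ne h]

/-! # Rules for loops -/

section LoopRules

variable {R : Type} [CommRing R] [LinearOrder R]

/-- The invariant rule. The counter is reset and advanced outside the body, so the invariant must
not depend on it (`hset`); its value is supplied to `hstep` instead, together with the frame
condition relative to the entry of the loop. -/
theorem FProg.run_forTo_inv {v n : IName} {P : FProg} {s : St R} {m : ℕ} (hm : s.i n 0 = m)
    (Inv : ℕ → St R → Prop) (hset : ∀ k s z, Inv k s → Inv k (s.setI v 0 z)) (h0 : Inv 0 s)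
    (hstep : ∀ k s', k < m → Agree (v :: P.iw) P.ww s s' → s'.i v 0 = k → Inv k s' →
      Inv (k + 1) (P.run s')) :
    Inv m ((FProg.forTo v n P).run s) := by
  have hm' : (s.i n 0).toNat = m := by simp [hm]
  simp only [FProg.run, hm']
  suffices ∀ k ≤ m, Inv k (forRun P.run v s k) from this m le_rfl
  intro k
  induction k with
  | zero => exact fun _ => hset _ _ _ h0
  | succ k ih =>
    intro hk
    exact hset _ _ _ (hstep k _ (by omega) (agree_forRun P.agree_run v s k) (by simp)
      (ih (by omega)))

/-- A loop whose body sends `Inv t` to `Inv (t + c)`. -/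
theorem FProg.run_forTo_iter {v n : IName} {P : FProg} {s : St R} {m : ℕ} (hm : s.i n 0 = m)
    (Inv : ℕ → St R → Prop) (hset : ∀ k s z, Inv k s → Inv k (s.setI v 0 z)) (t c : ℕ)
    (h0 : Inv t s)
    (hstep : ∀ t s', Agree (v :: P.iw) P.ww s s' → Inv t s' → Inv (t + c) (P.run s')) :
    Inv (t + m * c) ((FProg.forTo v n P).run s) := by
  refine FProg.run_forTo_inv hm (fun k s => Inv (t + k * c) s) (fun k s z h => hset _ s z h)
    (by simpa using h0) fun k s' _ ha _ h => ?_
  have := hstep _ s' ha h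
  rwa [add_assoc, ← Nat.succ_mul] at this

/-- A loop whose `k`-th round changes the integer array `a` at `k` only. -/
theorem FProg.run_forTo_map {v n : IName} {P : FProg} {s : St R} {m : ℕ} (hm : s.i n 0 = m)
    {a : IName} (hav : a ≠ v) (g : ℕ → ℤ)
    (hstep : ∀ k s', k < m → Agree (v :: P.iw) P.ww s s' → s'.i v 0 = k → s'.i a k = s.i a k →
      (P.run s').i a = Function.update (s'.i a) k (g k)) :
    (∀ k < m, ((FProg.forTo v n P).run s).i a (k : ℕ) = g k) ∧
      ∀ j : ℤ, (∀ k : ℕ, k < m → j ≠ k) → ((FProg.forTo v n P).run s).i a j = s.i a j := by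
  refine FProg.run_forTo_inv hm (fun k s' => (∀ l < k, s'.i a (l : ℕ) = g l) ∧
    ∀ j : ℤ, (∀ l : ℕ, l < k → j ≠ l) → s'.i a j = s.i a j) (fun k s' z h => by simpa [hav] using h)
    (by simp) fun k s' hk ha hv h => ?_
  rw [hstep k s' hk ha hv (h.2 k fun l hl => by omega)]
  refine ⟨fun l hl => ?_, fun j hj => ?_⟩
  · rcases Nat.lt_succ_iff_lt_or_eq.1 hl with hl | rfl
    · rw [Function.update_of_ne (by omega), h.1 l hl]
    · simp
  · rw [Function.update_of_ne (hj k (by omega)), h.2 j fun l hl => hj l (by omega)]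

/-- A loop whose `k`-th round changes the weight array `b` at `k` only. -/
theorem FProg.run_forTo_mapW {v n : IName} {P : FProg} {s : St R} {m : ℕ} (hm : s.i n 0 = m)
    {b : WName} (g : ℕ → R)
    (hstep : ∀ k s', k < m → Agree (v :: P.iw) P.ww s s' → s'.i v 0 = k →
      (P.run s').w b = Function.update (s'.w b) k (g k)) :
    ∀ k < m, ((FProg.forTo v n P).run s).w b (k : ℕ) = g k := by
  refine FProg.run_forTo_inv hm (fun k s' => ∀ l < k, s'.w b (l : ℕ) = g l)
    (fun k s' z h => by simpa using h) (by simp) fun k s' hk ha hv h l hl => ?_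
  rw [hstep k s' hk ha hv]
  rcases Nat.lt_succ_iff_lt_or_eq.1 hl with hl | rfl
  · rw [Function.update_of_ne (by omega), h l hl]
  · simp

/-- A loop whose `k`-th round adds `g k` to the integer scalar `a`. -/
theorem FProg.run_forTo_add {v n : IName} {P : FProg} {s : St R} {m : ℕ} (hm : s.i n 0 = m)
    {a : IName} (hav : a ≠ v) (g : ℕ → ℤ)
    (hstep : ∀ k s', k < m → Agree (v :: P.iw) P.ww s s' → s'.i v 0 = k →
      (P.run s').i a 0 = s'.i a 0 + g k) :
    ((FProg.forTo v n P).run s).i a 0 = s.i a 0 + ∑ k ∈ Finset.range m, g k := by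
  refine FProg.run_forTo_inv hm (fun k s' => s'.i a 0 = s.i a 0 + ∑ k ∈ Finset.range k, g k)
    (fun k s' z h => by simpa [hav] using h) (by simp) fun k s' hk ha hv h => ?_
  rw [hstep k s' hk ha hv, h, Finset.sum_range_succ, add_assoc]

/-- A loop whose `k`-th round adds `g k` to the cell `i` of the weight array `b`. -/
theorem FProg.run_forTo_addW {v n : IName} {P : FProg} {s : St R} {m : ℕ} (hm : s.i n 0 = m)
    {b : WName} (i : ℤ) (g : ℕ → R)
    (hstep : ∀ k s', k < m → Agree (v :: P.iw) P.ww s s' → s'.i v 0 = k →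
      (P.run s').w b i = s'.w b i + g k) :
    ((FProg.forTo v n P).run s).w b i = s.w b i + ∑ k ∈ Finset.range m, g k := by
  refine FProg.run_forTo_inv hm (fun k s' => s'.w b i = s.w b i + ∑ k ∈ Finset.range k, g k)
    (fun k s' z h => by simpa using h) (by simp) fun k s' hk ha hv h => ?_
  rw [hstep k s' hk ha hv, h, Finset.sum_range_succ, add_assoc]

end LoopRules

/-! # Capacitated matchings and the auction algorithm -/

open Finset

theorem sum_comp_le_sum {R : Type} [AddCommMonoid R] [PartialOrder R] [IsOrderedAddMonoid R]
    {α γ : Type} [DecidableEq γ] {M : Finset α} {T : Finset γ}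
    {φ : α → γ} (hφ : Set.InjOn φ M) (hT : ∀ e ∈ M, φ e ∈ T) {h : γ → R} (hh : ∀ y, 0 ≤ h y) :
    ∑ e ∈ M, h (φ e) ≤ ∑ y ∈ T, h y := by
  rw [← sum_image hφ]
  exact sum_le_sum_of_subset_of_nonneg (image_subset_iff.2 hT) fun y _ _ => hh y

/-- A bipartite multigraph with weighted edges `0, …, nE - 1`. -/
structure BGraph (R : Type) where
  nX : ℕ
  nY : ℕ
  nE : ℕ
  src : ℕ → ℕ
  dst : ℕ → ℕ
  u : ℕ → R
  src_lt : ∀ e < nE, src e < nX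
  dst_lt : ∀ e < nE, dst e < nY

namespace BGraph

variable {R : Type} (G : BGraph R)

/-- The matchings with capacities `κ` on the first vertex class. -/
structure Feas (κ : ℕ → ℤ) (M : Finset ℕ) : Prop where
  lt : ∀ e ∈ M, e < G.nE
  load : ∀ x < G.nX, ((M.filter fun e => G.src e = x).card : ℤ) ≤ κ x
  inj : ∀ e ∈ M, ∀ e' ∈ M, G.dst e = G.dst e' → e = e'

/-- The total weight of a set of edges. -/
def val [CommRing R] (M : Finset ℕ) : R := ∑ e ∈ M, G.u e

variable {G}

theorem Feas.subset {κ : ℕ → ℤ} {M M' : Finset ℕ} (h : G.Feas κ M) (hs : M' ⊆ M) :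
    G.Feas κ M' where
  lt e he := h.lt e (hs he)
  load x hx := le_trans (by exact_mod_cast card_le_card (filter_subset_filter _ hs)) (h.load x hx)
  inj e he e' he' := h.inj e (hs he) e' (hs he')

theorem Feas.mono {κ κ' : ℕ → ℤ} {M : Finset ℕ} (h : G.Feas κ M)
    (hs : ∀ x < G.nX, κ x ≤ κ' x) : G.Feas κ' M where
  lt := h.lt
  load x hx := (h.load x hx).trans (hs x hx)
  inj := h.inj

theorem feas_empty {κ : ℕ → ℤ} (h : ∀ x < G.nX, 0 ≤ κ x) : G.Feas κ ∅ where
  lt := by simp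
  load x hx := by simpa using h x hx
  inj := by simp

theorem Feas.card_le {κ : ℕ → ℤ} {M : Finset ℕ} (h : G.Feas κ M) : M.card ≤ G.nY := by
  rw [← card_range G.nY]
  exact card_le_card_of_injOn G.dst (fun e he => by simpa using G.dst_lt e (h.lt e he))
    fun e he e' he' => h.inj e he e' he'

/-! ### The auction and its dual certificate -/

section Auction

variable [CommRing R] [LinearOrder R]

/-- The edge `e` is assigned to slot `s` of its source if `asg e = s + 1`, and `k x s` counts how
often the price of slot `s` of `x` was raised by `ε`. The assignment is a matching that is
optimal for the prices, up to an error of `ε` for each edge. -/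
structure AucInv (G : BGraph R) (κ : ℕ → ℤ) (ε : R) (L : ℕ) (asg : ℕ → ℕ) (k : ℕ → ℕ → ℕ) :
    Prop where
  slot : ∀ e < G.nE, ∀ s, asg e = s + 1 → s < G.nY ∧ (s : ℤ) < κ (G.src e)
  slot_inj : ∀ e < G.nE, ∀ e' < G.nE, asg e ≠ 0 → G.src e = G.src e' → asg e = asg e' → e = e'
  dst_inj : ∀ e < G.nE, ∀ e' < G.nE, asg e ≠ 0 → asg e' ≠ 0 → G.dst e = G.dst e' → e = e'
  occ : ∀ x s, k x s ≠ 0 → ∃ e < G.nE, G.src e = x ∧ asg e = s + 1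
  cs : ∀ e < G.nE, ∀ s, asg e = s + 1 → ∀ e' < G.nE, G.dst e' = G.dst e → ∀ s' < G.nY,
    (s' : ℤ) < κ (G.src e') → G.u e' - k (G.src e') s' * ε ≤ G.u e - k (G.src e) s * ε + ε
  nonneg : ∀ e < G.nE, ∀ s, asg e = s + 1 → 0 ≤ G.u e - k (G.src e) s * ε + ε
  k_le : ∀ x s, k x s ≤ L

/-- No edge of the assignment ends in `y`. -/
def Free (G : BGraph R) (asg : ℕ → ℕ) (y : ℕ) : Prop :=
  ∀ e < G.nE, G.dst e = y → asg e = 0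

/-- No edge with a free end has a positive net value. -/
def Stable (G : BGraph R) (κ : ℕ → ℤ) (ε : R) (asg : ℕ → ℕ) (k : ℕ → ℕ → ℕ) : Prop :=
  ∀ e < G.nE, G.Free asg (G.dst e) → ∀ s < G.nY, (s : ℤ) < κ (G.src e) →
    G.u e ≤ k (G.src e) s * ε

/-- Assign `e` to slot `s` of its source, in place of the edge assigned to it before. -/
def bidAsg (G : BGraph R) (asg : ℕ → ℕ) (e s : ℕ) : ℕ → ℕ := fun e' =>
  if e' = e then s + 1 else if G.src e' = G.src e ∧ asg e' = s + 1 then 0 else asg e'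

/-- Raise the price of slot `s` of the source of `e`. -/
def bidPrice (G : BGraph R) (k : ℕ → ℕ → ℕ) (e s : ℕ) : ℕ → ℕ → ℕ := fun x s' =>
  if x = G.src e ∧ s' = s then k x s' + 1 else k x s'

theorem aucInv_zero (G : BGraph R) (κ : ℕ → ℤ) (ε : R) (L : ℕ) :
    G.AucInv κ ε L (fun _ => 0) (fun _ _ => 0) := by
  constructor <;> simp

variable [IsStrictOrderedRing R]

/-- Prices only rise, so the net values offered by the alternatives only fall, and the conditions on
the other assigned edges persist. The edge evicted from the slot becomes unassigned and is no longer
constrained. The new edge was a best choice before its price rose by `ε`, so it is within `ε` of the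
best afterwards. -/
theorem AucInv.bid {κ : ℕ → ℤ} {ε : R} {L : ℕ} {asg : ℕ → ℕ} {k : ℕ → ℕ → ℕ}
    (h : G.AucInv κ ε L asg k) (hε : 0 ≤ ε) {e s : ℕ} (he : e < G.nE)
    (hfree : G.Free asg (G.dst e)) (hs : s < G.nY) (hsκ : (s : ℤ) < κ (G.src e))
    (hmax : ∀ e' < G.nE, G.Free asg (G.dst e') → ∀ s' < G.nY, (s' : ℤ) < κ (G.src e') →
      G.u e' - k (G.src e') s' * ε ≤ G.u e - k (G.src e) s * ε)
    (hpos : 0 < G.u e - k (G.src e) s * ε) (hL : G.u e ≤ L * ε) :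
    G.AucInv κ ε L (G.bidAsg asg e s) (G.bidPrice k e s) := by
  have hk : ∀ x s', k x s' ≤ G.bidPrice k e s x s' := fun x s' => by
    unfold bidPrice; split_ifs <;> omega
  have hkR : ∀ x s', (k x s' : R) * ε ≤ (G.bidPrice k e s x s' : R) * ε := fun x s' =>
    mul_le_mul_of_nonneg_right (by exact_mod_cast hk x s') hε
  have hke : ((G.bidPrice k e s (G.src e) s : ℕ) : R) = k (G.src e) s + 1 := by
    simp [bidPrice]
  have hold : ∀ e' s', G.bidAsg asg e s e' = s' + 1 → e' ≠ e →
      asg e' = s' + 1 ∧ ¬ (G.src e' = G.src e ∧ s' = s) := by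
    intro e' s' h1 h2
    unfold bidAsg at h1
    rw [if_neg h2] at h1
    split_ifs at h1 with h3
    exact ⟨h1, fun h4 => h3 ⟨h4.1, by omega⟩⟩
  have hnew : G.bidAsg asg e s e = s + 1 := by simp [bidAsg]
  refine ⟨?_, ?_, ?_, ?_, ?_, ?_, ?_⟩
  · intro e' he' s' h1
    by_cases h2 : e' = e
    · subst h2
      obtain rfl : s = s' := by omega
      exact ⟨hs, hsκ⟩
    · exact h.slot e' he' s' (hold e' s' h1 h2).1
  · intro e₁ h₁ e₂ h₂ hne hsrc heq
    obtain ⟨s₁, hs₁⟩ := Nat.exists_eq_succ_of_ne_zero hne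
    by_cases c₁ : e₁ = e <;> by_cases c₂ : e₂ = e
    · rw [c₁, c₂]
    · have := (hold e₂ s₁ (heq ▸ hs₁) c₂).2
      subst c₁
      exact absurd ⟨hsrc.symm, by omega⟩ this
    · have := (hold e₁ s₁ hs₁ c₁).2
      subst c₂
      exact absurd ⟨hsrc, by omega⟩ this
    · have a₁ := (hold e₁ s₁ hs₁ c₁).1
      have a₂ := (hold e₂ s₁ (heq ▸ hs₁) c₂).1
      exact h.slot_inj e₁ h₁ e₂ h₂ (by omega) hsrc (by omega)
  · intro e₁ h₁ e₂ h₂ hne₁ hne₂ hdst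
    obtain ⟨s₁, hs₁⟩ := Nat.exists_eq_succ_of_ne_zero hne₁
    obtain ⟨s₂, hs₂⟩ := Nat.exists_eq_succ_of_ne_zero hne₂
    by_cases c₁ : e₁ = e <;> by_cases c₂ : e₂ = e
    · rw [c₁, c₂]
    · have := (hold e₂ s₂ hs₂ c₂).1
      rw [hfree e₂ h₂ (by rw [← hdst, c₁])] at this
      omega
    · have := (hold e₁ s₁ hs₁ c₁).1
      rw [hfree e₁ h₁ (by rw [hdst, c₂])] at this
      omega
    · have a₁ := (hold e₁ s₁ hs₁ c₁).1
      have a₂ := (hold e₂ s₂ hs₂ c₂).1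
      exact h.dst_inj e₁ h₁ e₂ h₂ (by omega) (by omega) hdst
  · intro x s' hne
    by_cases hx : x = G.src e ∧ s' = s
    · exact ⟨e, he, hx.1.symm, by rw [hnew, hx.2]⟩
    · simp only [bidPrice, if_neg hx] at hne
      obtain ⟨e', he', h1, h2⟩ := h.occ x s' hne
      refine ⟨e', he', h1, ?_⟩
      have h3 : e' ≠ e := by
        rintro rfl
        have := hfree e' he' rfl
        omega
      have h4 : ¬ (G.src e' = G.src e ∧ asg e' = s + 1) := fun h4 =>
        hx ⟨h1 ▸ h4.1, by omega⟩
      simp only [bidAsg, if_neg h3]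
      rw [if_neg h4, h2]
  · intro e₁ h₁ s₁ hs₁ e' he' hd s' hs' hs'κ
    have h2 := hkR (G.src e') s'
    by_cases c₁ : e₁ = e
    · subst c₁
      obtain rfl : s = s₁ := by omega
      rw [hke]
      have := hmax e' he' (by rwa [hd]) s' hs' hs'κ
      linarith
    · obtain ⟨a₁, a₂⟩ := hold e₁ s₁ hs₁ c₁
      have := h.cs e₁ h₁ s₁ a₁ e' he' hd s' hs' hs'κ
      simp only [bidPrice, if_neg a₂] at h2 ⊢
      linarith
  · intro e₁ h₁ s₁ hs₁
    by_cases c₁ : e₁ = e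
    · subst c₁
      obtain rfl : s = s₁ := by omega
      rw [hke]
      linarith
    · obtain ⟨a₁, a₂⟩ := hold e₁ s₁ hs₁ c₁
      have := h.nonneg e₁ h₁ s₁ a₁
      simp only [bidPrice, if_neg a₂]
      linarith
  · intro x s'
    by_cases hx : x = G.src e ∧ s' = s
    · simp only [bidPrice, if_pos hx]
      rw [hx.1, hx.2]
      -- A slot whose price already stood at `L * ε` would leave `e` a net value of at most `0` by
      -- `hL`, against `hpos`.
      by_contra hlt
      have h1 : L = k (G.src e) s := by
        have := h.k_le (G.src e) s
        omega
      rw [h1] at hL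
      linarith
    · simp only [bidPrice, if_neg hx]
      exact h.k_le x s'

-- The sum of the price counters is the measure of progress: every bid raises it by exactly one.
omit [CommRing R] [LinearOrder R] [IsStrictOrderedRing R] in
theorem sum_bidPrice (k : ℕ → ℕ → ℕ) {e s : ℕ} (he : e < G.nE) (hs : s < G.nY) :
    ∑ x ∈ range G.nX, ∑ s' ∈ range G.nY, G.bidPrice k e s x s' =
      ∑ x ∈ range G.nX, ∑ s' ∈ range G.nY, k x s' + 1 := by
  have h : ∀ x s', G.bidPrice k e s x s' =
      k x s' + if s' = s then (if x = G.src e then 1 else 0) else 0 := by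
    intro x s'
    unfold bidPrice
    split_ifs <;> simp_all
  simp [h, sum_add_distrib, hs, G.src_lt e he]

omit [IsStrictOrderedRing R] in
/-- After enough rounds all prices are so high that the assignment is stable. -/
theorem AucInv.stable_of_sum_le {κ : ℕ → ℤ} {ε : R} {L : ℕ} {asg : ℕ → ℕ} {k : ℕ → ℕ → ℕ}
    (h : G.AucInv κ ε L asg k)
    (hu : ∀ e < G.nE, 1 ≤ κ (G.src e) → G.u e ≤ L * ε)
    (hk : G.nX * G.nY * L ≤ ∑ x ∈ range G.nX, ∑ s ∈ range G.nY, k x s) :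
    G.Stable κ ε asg k := by
  intro e he _ s hs hsκ
  -- No counter exceeds `L`, so a sum of `nX * nY * L` forces every counter to equal `L`, and at
  -- price `L * ε` no usable edge has a positive net value.
  suffices L = k (G.src e) s by
    rw [← this]
    exact hu e he (by omega)
  by_contra hne
  have hlt : k (G.src e) s < L := lt_of_le_of_ne (h.k_le _ _) (Ne.symm hne)
  have h1 : ∑ x ∈ range G.nX, ∑ s ∈ range G.nY, k x s <
      ∑ x ∈ range G.nX, ∑ s ∈ range G.nY, L := by
    refine sum_lt_sum (fun x _ => sum_le_sum fun s _ => h.k_le x s)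
      ⟨G.src e, by simpa using G.src_lt e he, ?_⟩
    exact sum_lt_sum (fun s _ => h.k_le _ s) ⟨s, by simpa using hs, hlt⟩
  simp only [sum_const, card_range, smul_eq_mul] at h1
  rw [← mul_assoc] at h1
  omega

/-- The edges of an assignment. -/
def asgSet (G : BGraph R) (asg : ℕ → ℕ) : Finset ℕ := (range G.nE).filter fun e => asg e ≠ 0

-- The edges assigned at `x` occupy distinct slots numbered below `κ x`, so there are at most `κ x`
-- of them.
omit [IsStrictOrderedRing R] in
theorem AucInv.feas {κ : ℕ → ℤ} {ε : R} {L : ℕ} {asg : ℕ → ℕ} {k : ℕ → ℕ → ℕ}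
    (h : G.AucInv κ ε L asg k) (hκ : ∀ x < G.nX, 0 ≤ κ x) : G.Feas κ (G.asgSet asg) where
  lt e he := by simp [asgSet] at he; exact he.1
  load x hx := by
    have : ((G.asgSet asg).filter fun e => G.src e = x).card ≤ (κ x).toNat := by
      rw [← card_range (κ x).toNat]
      refine card_le_card_of_injOn (fun e => asg e - 1) (fun e he => ?_) fun e he e' he' heq => ?_
      · simp only [asgSet, coe_filter, mem_filter, mem_range, Set.mem_ofPred_eq] at he
        have := (h.slot e he.1.1 (asg e - 1) (by omega)).2
        rw [he.2] at this
        simp only [coe_range, Set.mem_Iio]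
        omega
      · simp only [asgSet, coe_filter, mem_filter, mem_range, Set.mem_ofPred_eq] at he he' heq
        exact h.slot_inj e he.1.1 e' he'.1.1 he.1.2 (by rw [he.2, he'.2]) (by omega)
    have := hκ x hx
    omega
  inj e he e' he' hd := by
    simp only [asgSet, mem_filter, mem_range] at he he'
    exact h.dst_inj e he.1 e' he'.1 he.2 he'.2 hd

/-- A stable assignment is optimal up to an error of `ε` for each vertex of the second class. -/
theorem AucInv.val_le {κ : ℕ → ℤ} {ε : R} {L : ℕ} {asg : ℕ → ℕ} {k : ℕ → ℕ → ℕ}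
    (h : G.AucInv κ ε L asg k) (hst : G.Stable κ ε asg k) (hε : 0 ≤ ε)
    (hκ : ∀ x < G.nX, 0 ≤ κ x) {M' : Finset ℕ} (hM' : G.Feas κ M') :
    G.val M' ≤ G.val (G.asgSet asg) + G.nY * ε := by
  -- Weak duality. The value of `M'` splits into net values and prices of the slots that `M'` would
  -- occupy, and both parts are compared with those of `M`; the net values of `M` enter with an
  -- extra `ε` for each edge.
  set M := G.asgSet asg with hM
  have hfeas : G.Feas κ M := h.feas hκ
  have memM : ∀ e, e ∈ M ↔ e < G.nE ∧ asg e ≠ 0 := fun e => by simp [hM, asgSet]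
  -- slots for the edges of `M'`
  set sl : ℕ → ℕ := fun e => (M'.filter fun e' => G.src e' = G.src e ∧ e' < e).card with hsl
  have hsl_lt : ∀ e ∈ M', sl e < (M'.filter fun e' => G.src e' = G.src e).card := by
    intro e he
    refine card_lt_card (Finset.ssubset_iff_subset_ne.2 ⟨?_, fun heq => ?_⟩)
    · exact fun e' he' => by
        simp only [mem_filter] at he' ⊢
        exact ⟨he'.1, he'.2.1⟩
    · have : e ∈ M'.filter fun e' => G.src e' = G.src e := by simp [he]
      rw [← heq] at this
      simp at this
  have hsl_mono : ∀ e ∈ M', ∀ e' ∈ M', G.src e = G.src e' → e < e' → sl e < sl e' := by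
    intro e he e' he' hs hlt
    refine card_lt_card (Finset.ssubset_iff_subset_ne.2 ⟨fun f hf => ?_, fun heq => ?_⟩)
    · simp only [mem_filter] at hf ⊢
      exact ⟨hf.1, hf.2.1.trans hs, hf.2.2.trans hlt⟩
    · have : e ∈ M'.filter fun f => G.src f = G.src e' ∧ f < e' := by simp [he, hs, hlt]
      rw [← heq] at this
      simp at this
  have hsl_inj : Set.InjOn (fun e => (G.src e, sl e)) M' := by
    intro e he e' he' heq
    simp only [Prod.mk.injEq] at heq
    rcases lt_trichotomy e e' with hlt | h' | hlt
    · have := hsl_mono e he e' he' heq.1 hlt; omega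
    · exact h'
    · have := hsl_mono e' he' e he heq.1.symm hlt; omega
  -- Prices exist only for slots below `nY`. This is no restriction, since a matching has at most
  -- `nY` edges.
  have hslY : ∀ e ∈ M', sl e < G.nY := fun e he =>
    (hsl_lt e he).trans_le ((card_le_card (filter_subset _ _)).trans hM'.card_le)
  have hslκ : ∀ e ∈ M', (sl e : ℤ) < κ (G.src e) := fun e he =>
    lt_of_lt_of_le (by exact_mod_cast hsl_lt e he) (hM'.load _ (G.src_lt e (hM'.lt e he)))
  -- net values
  set b : ℕ → R := fun e => G.u e - k (G.src e) (asg e - 1) * ε + ε with hb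
  have hb0 : ∀ e ∈ M, 0 ≤ b e := fun e he => by
    have := (memM e).1 he
    exact h.nonneg e this.1 (asg e - 1) (by omega)
  -- Each edge of `M'` is charged to its end `y`. If `y` is free, stability makes the net value
  -- nonpositive; otherwise `cs` bounds it by `b` of the edge of `M` at `y`. Distinct edges of `M'`
  -- have distinct ends.
  have hnet : ∑ e ∈ M', (G.u e - k (G.src e) (sl e) * ε) ≤ ∑ e ∈ M, b e := by
    set g : ℕ → R := fun y => ∑ e ∈ M.filter (fun e => G.dst e = y), b e with hg
    have hg0 : ∀ y, 0 ≤ g y := fun y => sum_nonneg fun e he => hb0 e (mem_filter.1 he).1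
    calc ∑ e ∈ M', (G.u e - k (G.src e) (sl e) * ε)
        ≤ ∑ e ∈ M', g (G.dst e) := by
          refine sum_le_sum fun e he => ?_
          have hlt := hM'.lt e he
          by_cases hf : G.Free asg (G.dst e)
          · have := hst e hlt hf (sl e) (hslY e he) (hslκ e he)
            linarith [hg0 (G.dst e)]
          · simp only [Free, not_forall] at hf
            obtain ⟨f, hf, hd, hne⟩ := hf
            have h1 := h.cs f hf (asg f - 1) (by omega) e hlt hd.symm (sl e) (hslY e he)
              (hslκ e he)
            refine h1.trans (single_le_sum (f := b) (fun e he => hb0 e (mem_filter.1 he).1) ?_)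
            simp [memM, hf, hne, hd]
      _ ≤ ∑ y ∈ range G.nY, g y :=
          sum_comp_le_sum (fun e he e' he' => hM'.inj e he e' he')
            (fun e he => by simpa using G.dst_lt e (hM'.lt e he)) hg0
      _ = ∑ e ∈ M, b e :=
          sum_fiberwise_of_maps_to (fun e he => by simpa using G.dst_lt e (hfeas.lt e he)) b
  -- A slot with a positive price was bid for and has been occupied ever since (`occ`). So the slots
  -- of `M'` that cost anything are distinct slots occupied by `M`.
  have hprice : ∑ e ∈ M', (k (G.src e) (sl e) * ε : R) ≤
      ∑ e ∈ M, (k (G.src e) (asg e - 1) * ε : R) := by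
    set g : ℕ × ℕ → R := fun z => k z.1 z.2 * ε with hg
    have hg0 : ∀ z, 0 ≤ g z := fun z => mul_nonneg (Nat.cast_nonneg _) hε
    set T : Finset (ℕ × ℕ) := M.image fun e => (G.src e, asg e - 1) with hT
    have h1 : ∑ e ∈ M, (k (G.src e) (asg e - 1) * ε : R) = ∑ z ∈ T, g z := by
      rw [hT, sum_image]
      intro e he e' he' heq
      simp only [Prod.mk.injEq] at heq
      have m1 := (memM e).1 he
      have m2 := (memM e').1 he'
      exact h.slot_inj e m1.1 e' m2.1 m1.2 heq.1 (by omega)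
    have h2 : ∑ e ∈ M', (k (G.src e) (sl e) * ε : R) =
        ∑ e ∈ M'.filter (fun e => k (G.src e) (sl e) ≠ 0), g (G.src e, sl e) := by
      rw [sum_filter]
      refine sum_congr rfl fun e _ => ?_
      split_ifs with h0
      · rfl
      · rw [not_not] at h0
        simp [h0]
    rw [h1, h2]
    refine sum_comp_le_sum (φ := fun e => (G.src e, sl e))
      (hsl_inj.mono (coe_subset.2 (filter_subset _ _))) (fun e he => ?_) hg0
    simp only [mem_filter] at he
    obtain ⟨f, hf, hs, ha⟩ := h.occ _ _ he.2
    exact mem_image.2 ⟨f, (memM f).2 ⟨hf, by omega⟩, by simp [hs, ha]⟩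
  have h1 : G.val M' = ∑ e ∈ M', (G.u e - k (G.src e) (sl e) * ε) +
      ∑ e ∈ M', (k (G.src e) (sl e) * ε : R) := by
    rw [← sum_add_distrib]
    simp [val]
  have h2 : ∑ e ∈ M, b e + ∑ e ∈ M, (k (G.src e) (asg e - 1) * ε : R) =
      G.val M + M.card * ε := by
    rw [← sum_add_distrib]
    simp only [hb, val]
    rw [← nsmul_eq_mul, ← sum_const, ← sum_add_distrib]
    exact sum_congr rfl fun e _ => by ring
  have h3 : (M.card : R) * ε ≤ G.nY * ε :=
    mul_le_mul_of_nonneg_right (by exact_mod_cast hfeas.card_le) hε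
  linarith

end Auction

end BGraph

/-! # Restricting the first vertex class to the vertices of largest value -/

/-- Capacity `z` at `x` and `0` elsewhere. -/
def single (x : ℕ) (z : ℤ) : ℕ → ℤ := fun x' => if x' = x then z else 0

/-- The capacities `0`, `c₁` or `c₂`, as chosen by `D`. -/
def capD (c₁ c₂ : ℕ → ℤ) (D : ℕ → ℕ) (x : ℕ) : ℤ :=
  if D x = 1 then c₁ x else if D x = 2 then c₂ x else 0

/-- At most `K₁` vertices have type `1` and at most `K₂` have type `2`. -/
structure Adm (nX K₁ K₂ : ℕ) (D : ℕ → ℕ) : Prop where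
  one : ((range nX).filter fun x => D x = 1).card ≤ K₁
  two : ((range nX).filter fun x => D x = 2).card ≤ K₂

/-- The vertices outside of `A` are not used. -/
def SuppIn (nX : ℕ) (A : Finset ℕ) (D : ℕ → ℕ) : Prop :=
  ∀ x < nX, x ∉ A → D x ≠ 1 ∧ D x ≠ 2

theorem Adm.card_le {nX K₁ K₂ : ℕ} {D : ℕ → ℕ} (h : Adm nX K₁ K₂ D) :
    ((range nX).filter fun x => D x = 1 ∨ D x = 2).card ≤ K₁ + K₂ := by
  rw [filter_or]
  exact (card_union_le _ _).trans (add_le_add h.one h.two)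

/-- The choice `D` with the type of `x` moved to `a`. -/
def moveD (D : ℕ → ℕ) (x a : ℕ) : ℕ → ℕ := fun z => if z = a then D x else if z = x then 0 else D z

/-- For each nonzero type `d`, the class of `d` gains at most `a`, and it does so only if it
contained `x`, which leaves it. -/
theorem Adm.moveD {nX K₁ K₂ : ℕ} {D : ℕ → ℕ} (h : Adm nX K₁ K₂ D) {x a : ℕ} (hx : x < nX) :
    Adm nX K₁ K₂ (moveD D x a) := by
  have key : ∀ d, d ≠ 0 → ((range nX).filter fun z => _root_.moveD D x a z = d).card ≤
      ((range nX).filter fun z => D z = d).card := by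
    intro d hd
    by_cases hxd : D x = d
    · have hxm : x ∈ (range nX).filter fun z => D z = d := by simp [hx, hxd]
      have hsub : ((range nX).filter fun z => _root_.moveD D x a z = d) ⊆
          insert a (((range nX).filter fun z => D z = d).erase x) := by
        intro z hz
        rw [mem_filter] at hz
        simp only [mem_filter, _root_.moveD, mem_range, mem_insert, mem_erase] at hz ⊢
        split_ifs at hz with h1 h2
        · exact .inl h1
        · exact absurd hz.2.symm hd
        · exact .inr ⟨h2, hz⟩
      have := (card_le_card hsub).trans (card_insert_le _ _)
      rw [card_erase_of_mem hxm] at this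
      have := card_pos.2 ⟨x, hxm⟩
      omega
    · refine card_le_card fun z hz => ?_
      rw [mem_filter] at hz
      simp only [mem_filter, _root_.moveD, mem_range] at hz ⊢
      split_ifs at hz with h1 h2
      · exact absurd hz.2 hxd
      · exact absurd hz.2.symm hd
      · exact hz
  exact ⟨(key 1 one_ne_zero).trans h.one, (key 2 two_ne_zero).trans h.two⟩

namespace BGraph

variable {R : Type} {G : BGraph R}

theorem Feas.src_eq_of_single {x : ℕ} {z : ℤ} {M : Finset ℕ} (h : G.Feas (single x z) M) :
    ∀ e ∈ M, G.src e = x := by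
  intro e he
  by_contra hne
  have h1 := h.load (G.src e) (G.src_lt e (h.lt e he))
  simp only [single, if_neg hne] at h1
  have : 0 < (M.filter fun f => G.src f = G.src e).card := card_pos.2 ⟨e, by simp [he]⟩
  omega

theorem Feas.pos_of_mem {κ : ℕ → ℤ} {M : Finset ℕ} (h : G.Feas κ M) {e : ℕ} (he : e ∈ M) :
    1 ≤ κ (G.src e) := by
  have h1 := h.load (G.src e) (G.src_lt e (h.lt e he))
  have : 0 < (M.filter fun f => G.src f = G.src e).card := card_pos.2 ⟨e, by simp [he]⟩
  omega

theorem Feas.filter_src {κ : ℕ → ℤ} {M : Finset ℕ} (h : G.Feas κ M) (x : ℕ) :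
    G.Feas (single x (κ x)) (M.filter fun e => G.src e = x) where
  lt e he := h.lt e (mem_filter.1 he).1
  load z hz := by
    by_cases hzx : z = x
    · subst hzx
      simpa [single, filter_filter] using h.load z hz
    · simp only [single, if_neg hzx, filter_filter]
      rw [filter_false_of_mem]
      · simp
      · rintro e _ ⟨h1, h2⟩
        exact hzx (h2 ▸ h1)
  inj e he e' he' := h.inj e (mem_filter.1 he).1 e' (mem_filter.1 he').1

variable [CommRing R] [LinearOrder R] [IsStrictOrderedRing R]

/-- Every matching at `x` can be replaced by one at `a` that is at most `δ` worse. -/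
def Exchange (G : BGraph R) (c : ℕ → ℤ) (δ : R) (x a : ℕ) : Prop :=
  ∀ M, G.Feas (single x (c x)) M → ∃ S, G.Feas (single a (c a)) S ∧ G.val M ≤ G.val S + δ

theorem val_le_val_filter_nonneg (G : BGraph R) (M : Finset ℕ) :
    G.val M ≤ G.val (M.filter fun e => 0 ≤ G.u e) := by
  rw [val, val, ← sum_filter_add_sum_filter_not M fun e => 0 ≤ G.u e]
  have : ∑ e ∈ M.filter (fun e => ¬ 0 ≤ G.u e), G.u e ≤ 0 :=
    sum_nonpos fun e he => (not_le.1 (mem_filter.1 he).2).le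
  linarith

-- `M'` arises from `M` by deleting the edges at `x` and those whose ends `S` needs, and adding `S`.
-- There is room for `S` at `a` because `D` leaves `a` closed. The last sum is the loss caused by
-- conflicts.
omit [LinearOrder R] [IsStrictOrderedRing R] in
theorem Feas.exists_move {c₁ c₂ : ℕ → ℤ} {D : ℕ → ℕ} {M S : Finset ℕ} {x a : ℕ}
    (hM : G.Feas (capD c₁ c₂ D) M) (hxa : a ≠ x) (hD : D x = 1 ∨ D x = 2)
    (ha : D a ≠ 1 ∧ D a ≠ 2)
    (hS : G.Feas (single a (if D x = 1 then c₁ a else c₂ a)) S) :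
    ∃ M', G.Feas (capD c₁ c₂ (moveD D x a)) M' ∧
      G.val M + G.val S = G.val M' + G.val (M.filter fun e => G.src e = x) +
        ∑ e ∈ (M.filter fun e => G.src e ≠ x).filter (fun e => G.dst e ∈ S.image G.dst),
          G.u e := by
  set M₀ := M.filter fun e => G.src e ≠ x with hM₀
  set M₁ := M₀.filter fun e => ¬ G.dst e ∈ S.image G.dst with hM₁
  have hM₁M : M₁ ⊆ M := (filter_subset _ _).trans (filter_subset _ _)
  have hsrcS := hS.src_eq_of_single
  have hdisj : Disjoint M₁ S := by
    rw [disjoint_left]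
    intro e he heS
    exact (mem_filter.1 he).2 (mem_image_of_mem _ heS)
  refine ⟨M₁ ∪ S, ⟨?_, ?_, ?_⟩, ?_⟩
  · intro e he
    rcases mem_union.1 he with he | he
    · exact hM.lt e (hM₁M he)
    · exact hS.lt e he
  · intro z hz
    rw [filter_union]
    have h0 : ((M₁.filter fun e => G.src e = z) ∪ (S.filter fun e => G.src e = z)).card ≤ _ :=
      card_union_le _ _
    have h1 : (M₁.filter fun e => G.src e = z).card ≤ (M.filter fun e => G.src e = z).card :=
      card_le_card (filter_subset_filter _ hM₁M)
    have h2 := hM.load z hz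
    have h3 := hS.load z hz
    by_cases hza : z = a
    · subst hza
      simp only [capD, moveD, single, if_pos, if_neg ha.1, if_neg ha.2] at h2 h3 ⊢
      have : (if D x = 1 then c₁ z else if D x = 2 then c₂ z else 0) =
          if D x = 1 then c₁ z else c₂ z := by
        rcases hD with h | h <;> simp [h]
      omega
    · simp only [single, if_neg hza] at h3
      by_cases hzx : z = x
      · subst hzx
        have : M₁.filter (fun e => G.src e = z) = ∅ := by
          refine filter_false_of_mem fun e he => ?_
          exact (mem_filter.1 (mem_filter.1 he).1).2
        rw [this] at h0 ⊢
        simp only [capD, moveD, if_neg hza, if_pos]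
        simp only [card_empty] at h0
        simp only [zero_ne_one, (by decide : (0 : ℕ) ≠ 2), if_false]
        omega
      · have : capD c₁ c₂ (moveD D x a) z = capD c₁ c₂ D z := by
          simp [capD, moveD, hza, hzx]
        omega
  · intro e he e' he' hd
    rcases mem_union.1 he with he | he <;> rcases mem_union.1 he' with he' | he'
    · exact hM.inj e (hM₁M he) e' (hM₁M he') hd
    · exact absurd (hd ▸ mem_image_of_mem _ he') (mem_filter.1 he).2
    · exact absurd (hd ▸ mem_image_of_mem _ he) (mem_filter.1 he').2
    · exact hS.inj e he e' he' hd
  · have h1 := sum_filter_add_sum_filter_not M (fun e => G.src e = x) G.u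
    have h2 := sum_filter_add_sum_filter_not M₀ (fun e => G.dst e ∈ S.image G.dst) G.u
    simp only [val]
    rw [sum_union hdisj, ← h1, ← h2]
    ring

/-- The matchings at the vertices of `T` meet a given matching in few places on average. -/
theorem sum_overlap_le {p : ℕ} (hdeg : ∀ y, ((range G.nE).filter fun e => G.dst e = y).card ≤ p)
    {c : ℕ → ℤ} {T : Finset ℕ} {S : ℕ → Finset ℕ} (hS : ∀ a ∈ T, G.Feas (single a (c a)) (S a))
    {M : Finset ℕ} (hpos : ∀ e ∈ M, 0 ≤ G.u e) :
    ∑ a ∈ T, ∑ e ∈ M.filter (fun e => G.dst e ∈ (S a).image G.dst), G.u e ≤ p * G.val M := by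
  have h1 : ∀ e ∈ M, ∑ a ∈ T, (if G.dst e ∈ (S a).image G.dst then G.u e else 0) ≤ p * G.u e := by
    intro e he
    rw [← sum_filter, sum_const, nsmul_eq_mul]
    refine mul_le_mul_of_nonneg_right ?_ (hpos e he)
    norm_cast
    -- If the matching `S a` covers the end of `e`, then `a` is the source of an edge at that end.
    -- There are at most `p` such edges, so at most `p` such `a`.
    refine le_trans (card_le_card (t := ((range G.nE).filter fun f => G.dst f = G.dst e).image
      G.src) fun a ha => ?_) (card_image_le.trans (hdeg _))
    simp only [mem_filter, mem_image] at ha ⊢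
    obtain ⟨haT, f, hf, hd⟩ := ha
    exact ⟨f, ⟨by simpa using (hS a haT).lt f hf, hd⟩, (hS a haT).src_eq_of_single f hf⟩
  simp only [sum_filter]
  rw [sum_comm, val, mul_sum]
  exact sum_le_sum h1

/-- An averaging argument: the conflicts of the candidate matchings `S a` with `M` add up to at most
`p * V` over at least `n₀` closed vertices `a` of `A`, so the best choice of `a` conflicts in weight
at most `p * V / n₀`. The conclusion is multiplied by `n₀` to avoid division. -/
theorem exists_replace {c₁ c₂ : ℕ → ℤ} {K₁ K₂ p n₀ : ℕ} {δ V : R} {A : Finset ℕ}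
    (hA : A ⊆ range G.nX) (hn₀ : 1 ≤ n₀) (hAc : K₁ + K₂ + n₀ ≤ A.card)
    (hdeg : ∀ y, ((range G.nE).filter fun e => G.dst e = y).card ≤ p)
    {D : ℕ → ℕ} {M : Finset ℕ} (hD : Adm G.nX K₁ K₂ D) (hM : G.Feas (capD c₁ c₂ D) M)
    (hpos : ∀ e ∈ M, 0 ≤ G.u e) (hV : G.val M ≤ V) {x : ℕ} (hxA : x ∉ A)
    (hDx : D x = 1 ∨ D x = 2)
    (hex₁ : ∀ a ∈ A, G.Exchange c₁ δ x a) (hex₂ : ∀ a ∈ A, G.Exchange c₂ δ x a) :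
    ∃ a ∈ A, D a ≠ 1 ∧ D a ≠ 2 ∧ ∃ M', G.Feas (capD c₁ c₂ (moveD D x a)) M' ∧
      (∀ e ∈ M', 0 ≤ G.u e) ∧ (n₀ : R) * G.val M ≤ n₀ * (G.val M' + δ) + p * V := by
  set c : ℕ → ℤ := fun z => if D x = 1 then c₁ z else c₂ z with hc
  have hex : ∀ a ∈ A, G.Exchange c δ x a := by
    intro a ha
    by_cases h : D x = 1
    · simpa [hc, h] using hex₁ a ha
    · simpa [hc, h] using hex₂ a ha
  set Mx := M.filter fun e => G.src e = x with hMx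
  have hMxf : G.Feas (single x (c x)) Mx := by
    have := hM.filter_src x
    rcases hDx with h | h <;> simpa [hc, h, capD] using this
  choose! S hS hSv using fun a ha => hex a ha Mx hMxf
  set U := (range G.nX).filter fun x => D x = 1 ∨ D x = 2 with hU
  set T := A \ U with hT
  -- At most `K₁ + K₂` of the vertices of `A` are open.
  have hTc : n₀ ≤ T.card := by
    have h1 := le_card_sdiff U A
    have h2 := hD.card_le
    rw [← hU] at h2
    rw [← hT] at h1
    omega
  set M₀ := M.filter fun e => G.src e ≠ x with hM₀
  set ov : ℕ → R := fun a => ∑ e ∈ M₀.filter (fun e => G.dst e ∈ (S a).image G.dst), G.u e with hov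
  have hpos₀ : ∀ e ∈ M₀, 0 ≤ G.u e := fun e he => hpos e (mem_filter.1 he).1
  have hov0 : ∀ a, 0 ≤ ov a := fun a => sum_nonneg fun e he => hpos₀ e (mem_filter.1 he).1
  have hsum : ∑ a ∈ T, ov a ≤ p * G.val M₀ :=
    sum_overlap_le hdeg (fun a ha => hS a (mem_sdiff.1 ha).1) hpos₀
  have hM₀M : G.val M₀ ≤ G.val M := sum_le_sum_of_subset_of_nonneg (filter_subset _ _)
    fun e he _ => hpos e he
  obtain ⟨a, haT, hmin⟩ := exists_min_image T ov (card_pos.1 (by omega))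
  have hovV : (n₀ : R) * ov a ≤ p * V := by
    have h1 : T.card • ov a ≤ ∑ a ∈ T, ov a := card_nsmul_le_sum _ _ _ hmin
    rw [nsmul_eq_mul] at h1
    have h2 : (n₀ : R) * ov a ≤ T.card * ov a :=
      mul_le_mul_of_nonneg_right (by exact_mod_cast hTc) (hov0 a)
    have h3 : (p : R) * G.val M₀ ≤ p * V :=
      mul_le_mul_of_nonneg_left (hM₀M.trans hV) (Nat.cast_nonneg _)
    linarith
  have haA : a ∈ A := (mem_sdiff.1 haT).1
  have haU : D a ≠ 1 ∧ D a ≠ 2 := by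
    have h1 := (mem_sdiff.1 haT).2
    have h2 := hA haA
    simp only [hU, mem_filter, h2, true_and, not_or] at h1
    exact h1
  obtain ⟨M', hM', hval⟩ := hM.exists_move (ne_of_mem_of_not_mem haA hxA) hDx haU (hS a haA)
  -- Edges of negative weight are discarded so that the result satisfies `hpos` again and can enter
  -- the next exchange.
  refine ⟨a, haA, haU.1, haU.2, M'.filter fun e => 0 ≤ G.u e, hM'.subset (filter_subset _ _),
    fun e he => (mem_filter.1 he).2, ?_⟩
  have h1 := G.val_le_val_filter_nonneg M'
  have h2 := hSv a haA
  have h3 : G.val M ≤ G.val (M'.filter fun e => 0 ≤ G.u e) + δ + ov a := by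
    simp only [hov]
    linarith
  have h4 := mul_le_mul_of_nonneg_left h3 (Nat.cast_nonneg (α := R) n₀)
  linarith

/-- Any admissible solution can be moved into `A` with a small loss. -/
theorem exists_supported {c₁ c₂ : ℕ → ℤ} {K₁ K₂ p n₀ : ℕ} {δ V : R} {A : Finset ℕ}
    (hA : A ⊆ range G.nX) (hn₀ : 1 ≤ n₀) (hAc : K₁ + K₂ + n₀ ≤ A.card ∨ A = range G.nX)
    (hdeg : ∀ y, ((range G.nE).filter fun e => G.dst e = y).card ≤ p)
    (hV : ∀ D M, Adm G.nX K₁ K₂ D → G.Feas (capD c₁ c₂ D) M → G.val M ≤ V)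
    (hex₁ : ∀ x < G.nX, x ∉ A → ∀ a ∈ A, G.Exchange c₁ δ x a)
    (hex₂ : ∀ x < G.nX, x ∉ A → ∀ a ∈ A, G.Exchange c₂ δ x a) (m : ℕ) :
    ∀ (D : ℕ → ℕ) (M : Finset ℕ), Adm G.nX K₁ K₂ D → G.Feas (capD c₁ c₂ D) M →
      (∀ e ∈ M, 0 ≤ G.u e) →
      (((range G.nX).filter fun x => D x = 1 ∨ D x = 2) \ A).card = m →
      ∃ D' M', Adm G.nX K₁ K₂ D' ∧ SuppIn G.nX A D' ∧ G.Feas (capD c₁ c₂ D') M' ∧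
        (n₀ : R) * G.val M ≤ n₀ * G.val M' + m * (n₀ * δ + p * V) := by
  induction m with
  | zero =>
    intro D M hD hM _ hm
    refine ⟨D, M, hD, fun x hx hxA => ?_, hM, by simp⟩
    rw [card_eq_zero, sdiff_eq_empty_iff_subset] at hm
    rw [← not_or]
    exact fun h => hxA (hm (by simp [hx, h]))
  | succ m ih =>
    intro D M hD hM hpos hm
    obtain ⟨x, hx⟩ := card_pos.1 (lt_of_lt_of_eq (Nat.succ_pos m) hm.symm)
    simp only [mem_sdiff, mem_filter, mem_range] at hx
    obtain ⟨⟨hxX, hDx⟩, hxA⟩ := hx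
    have hAc' : K₁ + K₂ + n₀ ≤ A.card := hAc.resolve_right fun h => hxA (by simp [h, hxX])
    obtain ⟨a, haA, ha1, ha2, M', hM', hpos', hle⟩ := exists_replace hA hn₀ hAc' hdeg hD hM hpos
      (hV D M hD hM) hxA hDx (hex₁ x hxX hxA) (hex₂ x hxX hxA)
    -- The exchange lowers the number of open vertices outside `A` by exactly one, since `a` lies in
    -- `A`.
    have hset : ((range G.nX).filter fun z => moveD D x a z = 1 ∨ moveD D x a z = 2) \ A =
        (((range G.nX).filter fun z => D z = 1 ∨ D z = 2) \ A).erase x := by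
      ext z
      simp only [mem_sdiff, mem_filter, mem_range, mem_erase]
      simp only [moveD]
      by_cases hza : z = a
      · subst hza; simp [haA]
      · by_cases hzx : z = x
        · subst hzx
          simp [hza]
        · simp [hza, hzx]
    obtain ⟨D'', M'', h1, h2, h3, h4⟩ := ih (moveD D x a) M' (hD.moveD hxX) hM' hpos' (by
      rw [hset, card_erase_of_mem (by simp [hxX, hDx, hxA]), hm]; simp)
    refine ⟨D'', M'', h1, h2, h3, ?_⟩
    push_cast
    linarith

theorem capD_nonneg {c₁ c₂ : ℕ → ℤ} {n : ℕ} (h₁ : ∀ x < n, 0 ≤ c₁ x) (h₂ : ∀ x < n, 0 ≤ c₂ x)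
    (D : ℕ → ℕ) : ∀ x < n, 0 ≤ capD c₁ c₂ D x := by
  intro x hx
  unfold capD
  split_ifs
  exacts [h₁ x hx, h₂ x hx, le_rfl]

/-- A value that is nearly optimal among the solutions in `A` is nearly optimal. -/
theorem approx_of_supported {c₁ c₂ : ℕ → ℤ} {K₁ K₂ p n₀ q : ℕ} {δ b : R} {A : Finset ℕ}
    (h₁ : ∀ x < G.nX, 0 ≤ c₁ x) (h₂ : ∀ x < G.nX, 0 ≤ c₂ x) (hδ : 0 ≤ δ)
    (hq : 1 ≤ q) (hA : A ⊆ range G.nX) (hn₀ : n₀ = 1 + 2 * q * (K₁ + K₂) * p)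
    (hAc : K₁ + K₂ + n₀ ≤ A.card ∨ A = range G.nX)
    (hdeg : ∀ y, ((range G.nE).filter fun e => G.dst e = y).card ≤ p)
    (hex₁ : ∀ x < G.nX, x ∉ A → ∀ a ∈ A, G.Exchange c₁ δ x a)
    (hex₂ : ∀ x < G.nX, x ∉ A → ∀ a ∈ A, G.Exchange c₂ δ x a)
    (hb : ∀ D M, Adm G.nX K₁ K₂ D → SuppIn G.nX A D → G.Feas (capD c₁ c₂ D) M → G.val M ≤ b + δ)
    (hopt : ∃ D M, Adm G.nX K₁ K₂ D ∧ G.Feas (capD c₁ c₂ D) M ∧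
      2 * q * (K₁ + K₂ + 1) * δ ≤ G.val M)
    {D : ℕ → ℕ} {M : Finset ℕ} (hD : Adm G.nX K₁ K₂ D) (hM : G.Feas (capD c₁ c₂ D) M) :
    ((q : R) - 1) * G.val M ≤ q * b := by
  classical
  -- There are only finitely many sets of edges, so an optimal admissible solution exists; `V`
  -- denotes its value.
  set P := ((range G.nE).powerset).filter fun M =>
    ∃ D, Adm G.nX K₁ K₂ D ∧ G.Feas (capD c₁ c₂ D) M with hP
  have memP : ∀ D M, Adm G.nX K₁ K₂ D → G.Feas (capD c₁ c₂ D) M → M ∈ P := fun D M hD hM => by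
    simp only [hP, mem_filter, mem_powerset]
    exact ⟨fun e he => by simpa using hM.lt e he, D, hD, hM⟩
  obtain ⟨O, hO, hmax⟩ := exists_max_image P G.val ⟨M, memP D M hD hM⟩
  obtain ⟨DO, hDO, hOf⟩ := (mem_filter.1 hO).2
  set V := G.val O with hV
  have hVmax : ∀ D M, Adm G.nX K₁ K₂ D → G.Feas (capD c₁ c₂ D) M → G.val M ≤ V :=
    fun D M hD hM => hmax M (memP D M hD hM)
  have hO0 : (0 : R) ≤ V := by
    have := hVmax D ∅ hD (feas_empty (capD_nonneg h₁ h₂ D))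
    simpa [val] using this
  obtain ⟨D', M', hD', hs', hM', hle⟩ := exists_supported hA (by omega) hAc hdeg hVmax hex₁ hex₂ _
    DO (O.filter fun e => 0 ≤ G.u e) hDO (hOf.subset (filter_subset _ _))
    (fun e he => (mem_filter.1 he).2) rfl
  have hOO := G.val_le_val_filter_nonneg O
  have hm : (((range G.nX).filter fun x => DO x = 1 ∨ DO x = 2) \ A).card ≤ K₁ + K₂ :=
    (card_le_card sdiff_subset).trans hDO.card_le
  obtain ⟨D₀, M₀, hD₀, hM₀, hv⟩ := hopt
  have hv' := hv.trans (hVmax D₀ M₀ hD₀ hM₀)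
  have hb' := hb D' M' hD' hs' hM'
  have hMV := hVmax D M hD hM
  generalize (((range G.nX).filter fun x => DO x = 1 ∨ DO x = 2) \ A).card = m at *
  set k : R := (K₁ : R) + K₂ with hk
  have hmk : (m : R) ≤ k := by rw [hk]; exact_mod_cast hm
  have hn₀R : (n₀ : R) = 1 + 2 * q * k * p := by rw [hn₀]; push_cast; ring
  have hn₀pos : (0 : R) < n₀ := by exact_mod_cast (by omega : 0 < n₀)
  have hq1 : (1 : R) ≤ q := by exact_mod_cast hq
  have hp0 : (0 : R) ≤ p := Nat.cast_nonneg _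
  -- At most `k` exchanges, each costing `δ + p * V / n₀`, followed by the error `δ` of the best
  -- value found inside `A`.
  have e1 : (n₀ : R) * V ≤ n₀ * (b + δ) + k * (n₀ * δ + p * V) := by
    have a1 := mul_le_mul_of_nonneg_left hOO hn₀pos.le
    have a2 := mul_le_mul_of_nonneg_left hb' hn₀pos.le
    have a3 : (m : R) * (n₀ * δ + p * V) ≤ k * (n₀ * δ + p * V) :=
      mul_le_mul_of_nonneg_right hmk (by positivity)
    linarith
  -- The choice of `n₀` makes the total conflict loss `k * p * V / n₀` at most `V / (2 * q)`.
  have e2 : 2 * (q : R) * (k * (p * V)) ≤ n₀ * V := by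
    rw [hn₀R]; nlinarith
  have e3 : (n₀ : R) * (2 * q * V) ≤ n₀ * (2 * q * b + 2 * q * (k + 1) * δ + V) := by
    have := mul_le_mul_of_nonneg_left e1 (by linarith : (0 : R) ≤ 2 * q)
    linarith
  -- After cancelling `n₀` this reads `2qV ≤ 2qb + 2q(k+1)δ + V`, and `hv'` bounds the middle term
  -- by another `V`.
  have e4 := le_of_mul_le_mul_left e3 hn₀pos
  have e5 : ((q : R) - 1) * V ≤ q * b := by linarith
  have e6 : ((q : R) - 1) * G.val M ≤ (q - 1) * V :=
    mul_le_mul_of_nonneg_left hMV (by linarith)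
  linarith

end BGraph

/-! # The auction algorithm as a program -/

open Finset FProg

/-- Mark the ends of the assigned edges as busy. -/
def busyProg : FProg := block [
  forTo .vy .nY (setI .busy (.sc .vy) (.const 0)),
  forTo .ve .nE (ite (.ile (.const 1) (.get .asg (.sc .ve)))
    (setI .busy (.get .dst (.sc .ve)) (.const 1)) skip)]

/-- The index of the price of slot `vs` of the source of `ve`. -/
def priceIx (e s : IName) : IX := .add (.get .base (.get .src (.sc e))) (.sc s)

/-- The net value of slot `vs` of the source of `ve`. -/
def netX : WX := .sub (.get .u (.sc .ve)) (.get .price (priceIx .ve .vs))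

/-- Update the best free edge and slot. -/
def scanBody : FProg :=
  ite (.and (.and (.ile (.add (.sc .vs) (.const 1)) (.get .kap (.get .src (.sc .ve))))
      (.ile (.get .busy (.get .dst (.sc .ve))) (.const 0))) (.not (.wle netX (.sc .net))))
    (block [assign .be (.sc .ve), assign .bs (.sc .vs), assignW .net netX]) skip

/-- Find a free edge and a slot of largest positive net value. -/
def scanProg : FProg := block [
  assign .be (.const (-1)), assignW .net .zero,
  forTo .ve .nE (forTo .vs .nY scanBody)]

/-- Assign the chosen edge to the chosen slot and raise its price. -/
def bidProg : FProg :=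
  ite (.ile (.const 0) (.sc .be)) (block [
    forTo .ve .nE (ite (.and
        (.and (.ile (.get .src (.sc .ve)) (.get .src (.sc .be)))
          (.ile (.get .src (.sc .be)) (.get .src (.sc .ve))))
        (.and (.ile (.get .asg (.sc .ve)) (.add (.sc .bs) (.const 1)))
          (.ile (.add (.sc .bs) (.const 1)) (.get .asg (.sc .ve)))))
      (setI .asg (.sc .ve) (.const 0)) skip),
    setI .asg (.sc .be) (.add (.sc .bs) (.const 1)),
    setW .price (priceIx .be .bs) (.add (.get .price (priceIx .be .bs)) (.sc .eps))]) skip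

/-- One round of the auction. -/
def roundProg : FProg := block [busyProg, scanProg, bidProg]

/-- Compute a nearly optimal matching for the capacities `kap`, and its value. -/
def evalProg : FProg := block [
  forTo .ve .nE (setI .asg (.sc .ve) (.const 0)),
  forTo .va .nX (forTo .vb .nY
    (setW .price (.add (.get .base (.sc .va)) (.sc .vb)) .zero)),
  forTo .va .nX (forTo .vb .nY (forTo .vc .L roundProg)),
  assignW .val .zero,
  forTo .ve .nE (ite (.ile (.const 1) (.get .asg (.sc .ve)))
    (assignW .val (.add (.sc .val) (.get .u (.sc .ve)))) skip)]

/-! ### Correctness of the auction program -/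

section

variable {R : Type} [CommRing R] [LinearOrder R] {G : BGraph R} {ε : R} {L : ℕ}
  {κ : ℕ → ℤ} {s : St R}

/-- The state `s` holds the graph `G`, the increment `ε` and the number `L`. -/
structure Env (G : BGraph R) (ε : R) (L : ℕ) (s : St R) : Prop where
  nX : s.i .nX 0 = G.nX
  nY : s.i .nY 0 = G.nY
  nE : s.i .nE 0 = G.nE
  src : ∀ e < G.nE, s.i .src (e : ℕ) = G.src e
  dst : ∀ e < G.nE, s.i .dst (e : ℕ) = G.dst e
  base : ∀ x < G.nX, s.i .base (x : ℕ) = x * G.nY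
  u : ∀ e < G.nE, s.w .u (e : ℕ) = G.u e
  eps : s.w .eps 0 = ε
  L : s.i .L 0 = L

omit [CommRing R] [LinearOrder R] in
theorem Env.agree {s' : St R} {A : List IName} {V : List WName} (h : Env G ε L s)
    (ha : Agree A V s s')
    (hA : ∀ a ∈ [IName.nX, .nY, .nE, .src, .dst, .base, .L], a ∉ A)
    (hV : ∀ b ∈ [WName.u, .eps], b ∉ V) : Env G ε L s' := by
  simp only [List.mem_cons, List.not_mem_nil, or_false, forall_eq_or_imp, forall_eq] at hA hV
  obtain ⟨a1, a2, a3, a4, a5, a6, a7⟩ := hA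
  constructor
  · rw [ha.i _ a1, h.nX]
  · rw [ha.i _ a2, h.nY]
  · rw [ha.i _ a3, h.nE]
  · rw [ha.i _ a4]; exact h.src
  · rw [ha.i _ a5]; exact h.dst
  · rw [ha.i _ a6]; exact h.base
  · rw [ha.w _ hV.1]; exact h.u
  · rw [ha.w _ hV.2]; exact h.eps
  · rw [ha.i _ a7, h.L]

/-- The integer array `a` holds `f` in its first `n` cells. -/
def Holds (s : St R) (a : IName) (n : ℕ) (f : ℕ → ℤ) : Prop := ∀ j < n, s.i a (j : ℕ) = f j

omit [CommRing R] [LinearOrder R] in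
theorem Holds.agree {s' : St R} {A : List IName} {V : List WName} {a : IName} {n : ℕ} {f : ℕ → ℤ}
    (h : Holds s a n f) (ha : Agree A V s s') (hA : a ∉ A) : Holds s' a n f := by
  intro j hj
  rw [ha.i a hA, h j hj]

/-- The prices are the multiples `k` of `ε`. -/
def Prices (G : BGraph R) (ε : R) (k : ℕ → ℕ → ℕ) (s : St R) : Prop :=
  ∀ x < G.nX, ∀ t < G.nY, s.w .price (x * G.nY + t) = k x t * ε

omit [LinearOrder R] in
theorem Prices.agree {s' : St R} {A : List IName} {V : List WName} {k : ℕ → ℕ → ℕ}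
    (h : Prices G ε k s) (ha : Agree A V s s') (hV : WName.price ∉ V) : Prices G ε k s' := by
  intro x hx t ht
  rw [ha.w _ hV, h x hx t ht]

theorem run_busyProg {asg : ℕ → ℕ} (hE : Env G ε L s)
    (hA : Holds s .asg G.nE fun e => asg e) :
    ∀ y < G.nY, (busyProg.run s).i .busy (y : ℕ) ≤ 0 ↔ G.Free asg y := by
  set P₁ := forTo .vy .nY (setI .busy (.sc .vy) (.const 0)) with hP₁
  have h1 : ∀ y < G.nY, (P₁.run s).i .busy (y : ℕ) = 0 := by
    refine (run_forTo_map hE.nY (by decide) (fun _ => 0) fun k s' hk ha hv _ => ?_).1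
    simp [run, IX.eval, hv]
  have ha₁ := P₁.agree_run s
  have hE₁ := hE.agree ha₁ (by decide) (by decide)
  have hA₁ := hA.agree ha₁ (by decide)
  simp only [busyProg, block, ← hP₁]
  rw [run]
  refine run_forTo_inv hE₁.nE (fun n s' => ∀ y < G.nY, s'.i .busy (y : ℕ) ≤ 0 ↔
    ∀ e < n, G.dst e = y → asg e = 0) (fun n s' z h => by simpa using h)
    (fun y hy => by simp [h1 y hy]) fun n s' hn ha hv h y hy => ?_
  have hE' := hE₁.agree ha (by decide) (by decide)
  have hA' := hA₁.agree ha (by decide) n hn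
  simp only [run, BX.Holds, IX.eval, hv, hA', hE'.dst n hn]
  have hstep : (∀ e < n + 1, G.dst e = y → asg e = 0) ↔
      (∀ e < n, G.dst e = y → asg e = 0) ∧ (G.dst n = y → asg n = 0) := by
    constructor
    · exact fun h => ⟨fun e he => h e (by omega), h n (by omega)⟩
    · rintro ⟨h1, h2⟩ e he
      rcases Nat.lt_succ_iff_lt_or_eq.1 he with he | rfl
      exacts [h1 e he, h2]
  rw [hstep]
  split_ifs with hc
  · by_cases hy' : (y : ℤ) = G.dst n
    · simp only [St.setI_i_self, hy', Function.update_self]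
      have : G.dst n = y := by omega
      refine ⟨fun h => by omega, fun h => ?_⟩
      have := h.2 this
      omega
    · rw [St.setI_i_self, Function.update_of_ne hy', h y hy]
      have : ¬ G.dst n = y := by omega
      simp [this]
  · rw [h y hy]
    have : asg n = 0 := by omega
    simp [this]

/-- The candidate `(e, t)` for a bid. -/
def Cand (G : BGraph R) (κ : ℕ → ℤ) (asg : ℕ → ℕ) (e t : ℕ) : Prop :=
  e < G.nE ∧ t < G.nY ∧ (t : ℤ) < κ (G.src e) ∧ G.Free asg (G.dst e)

/-- The scalars `be`, `bs` and `net` hold a best candidate among those that satisfy `Q`. -/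
def ScanInv (G : BGraph R) (ε : R) (κ : ℕ → ℤ) (asg : ℕ → ℕ) (k : ℕ → ℕ → ℕ)
    (Q : ℕ → ℕ → Prop) (s : St R) : Prop :=
  (∀ e t, Q e t → Cand G κ asg e t → G.u e - k (G.src e) t * ε ≤ s.w .net 0) ∧
  ((s.i .be 0 = -1 ∧ s.w .net 0 = 0) ∨ ∃ e t : ℕ, s.i .be 0 = e ∧ s.i .bs 0 = t ∧
    Cand G κ asg e t ∧ s.w .net 0 = G.u e - k (G.src e) t * ε ∧ 0 < s.w .net 0)

/-- The predicate `Q` marks the pairs inspected so far; leaving it arbitrary lets one statement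
serve both nested loops. A pair replaces the current best only if it is strictly better, which keeps
the recorded net value positive. -/
theorem run_scanBody {asg : ℕ → ℕ} {k : ℕ → ℕ → ℕ} {Q : ℕ → ℕ → Prop} {e t : ℕ}
    (hE : Env G ε L s) (hκ : Holds s .kap G.nX κ)
    (hB : ∀ y < G.nY, s.i .busy (y : ℕ) ≤ 0 ↔ G.Free asg y) (hp : Prices G ε k s)
    (he : e < G.nE) (ht : t < G.nY) (hve : s.i .ve 0 = e) (hvs : s.i .vs 0 = t)
    (h : ScanInv G ε κ asg k Q s) :
    ScanInv G ε κ asg k (fun e' t' => Q e' t' ∨ (e' = e ∧ t' = t)) (scanBody.run s) := by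
  have hsrc := G.src_lt e he
  have hdst := G.dst_lt e he
  have hnet : netX.eval s = G.u e - k (G.src e) t * ε := by
    simp only [netX, priceIx, WX.eval, IX.eval, hve, hvs, hE.u e he, hE.src e he,
      hE.base _ hsrc, hp _ hsrc t ht]
  have hcond : (BX.and (.ile (.add (.sc .vs) (.const 1)) (.get .kap (.get .src (.sc .ve))))
      (.ile (.get .busy (.get .dst (.sc .ve))) (.const 0))).Holds s ↔ Cand G κ asg e t := by
    simp only [BX.Holds, IX.eval, hve, hvs, hE.src e he, hE.dst e he, hκ _ hsrc, hB _ hdst, Cand,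
      he, ht, true_and, Int.add_one_le_iff]
  have hrun : scanBody.run s = open Classical in
      if Cand G κ asg e t ∧ ¬ G.u e - k (G.src e) t * ε ≤ s.w .net 0 then
        ((s.setI .be 0 e).setI .bs 0 t).setW .net 0 (G.u e - k (G.src e) t * ε) else s := by
    rw [← hcond, ← hnet]
    simp only [scanBody, run, BX.Holds, block, IX.eval, WX.eval, hve]
    congr 1
    simp [netX, priceIx, WX.eval, IX.eval, hvs]
  rw [hrun]
  split_ifs with hc
  · have hpos : 0 < G.u e - k (G.src e) t * ε := by
      refine lt_of_le_of_lt ?_ (not_le.1 hc.2)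
      rcases h.2 with h' | ⟨_, _, _, _, _, _, h'⟩
      · exact h'.2.ge
      · exact h'.le
    refine ⟨fun e' t' hQ hcand => ?_, .inr ⟨e, t, by simp, by simp, hc.1, by simp, by simpa⟩⟩
    rcases hQ with hQ | ⟨rfl, rfl⟩
    · simpa using (h.1 e' t' hQ hcand).trans (not_le.1 hc.2).le
    · simp
  · refine ⟨fun e' t' hQ hcand => ?_, h.2⟩
    rcases hQ with hQ | ⟨rfl, rfl⟩
    · exact h.1 e' t' hQ hcand
    · by_contra hlt
      exact hc ⟨hcand, hlt⟩

omit [LinearOrder R] in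
theorem ScanInv.congr [LinearOrder R] {asg : ℕ → ℕ} {k : ℕ → ℕ → ℕ} {Q Q' : ℕ → ℕ → Prop}
    (h : ScanInv G ε κ asg k Q s) (hQ : ∀ e t, Cand G κ asg e t → Q' e t → Q e t) :
    ScanInv G ε κ asg k Q' s :=
  ⟨fun e t h1 h2 => h.1 e t (hQ e t h2 h1) h2, h.2⟩

theorem run_scanProg {asg : ℕ → ℕ} {k : ℕ → ℕ → ℕ}
    (hE : Env G ε L s) (hκ : Holds s .kap G.nX κ)
    (hB : ∀ y < G.nY, s.i .busy (y : ℕ) ≤ 0 ↔ G.Free asg y) (hp : Prices G ε k s) :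
    ScanInv G ε κ asg k (fun _ _ => True) (scanProg.run s) := by
  -- The value `-1` of `be` means that no candidate was found. The net value starts at `0`, so only
  -- candidates of positive net value are recorded.
  set s₁ := (s.setI .be 0 (-1)).setW .net 0 0 with hs₁
  have ha₁ : Agree [.be] [.net] s s₁ := ((agree_setI s .be 0 (-1)).mono (by simp) (by simp)).trans
    ((agree_setW _ .net 0 0).mono (by simp) (by simp))
  have hrun : scanProg.run s = (forTo .ve .nE (forTo .vs .nY scanBody)).run s₁ := rfl
  rw [hrun]
  refine (run_forTo_inv (hE.agree ha₁ (by decide) (by decide)).nE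
    (fun n => ScanInv G ε κ asg k fun e _ => e < n) (fun n s' z h => by simpa [ScanInv] using h)
    ⟨by simp, .inl (by simp [hs₁])⟩ fun n s' hn ha hv h => ?_).congr (fun e t hc _ => hc.1)
  have ha' := (ha₁.mono (by decide) (by decide)).trans ha
  have hE' := hE.agree ha' (by decide) (by decide)
  refine (run_forTo_inv hE'.nY
    (fun m => ScanInv G ε κ asg k fun e t => e < n ∨ (e = n ∧ t < m))
    (fun n s' z h => by simpa [ScanInv] using h) (h.congr (by simp))
    fun m s'' hm hb hv' h' => ?_).congr (fun e t hc h1 => ?_)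
  · have ha'' := ha'.trans (hb.mono (by decide) (by decide))
    refine (run_scanBody (hE.agree ha'' (by decide) (by decide)) (hκ.agree ha'' (by decide))
      (fun y hy => by rw [ha''.i _ (by decide)]; exact hB y hy) (hp.agree ha'' (by decide)) hn hm
      (by rw [hb.i _ (by decide)]; exact hv) hv' h').congr fun e t hc h1 => ?_
    omega
  · have := hc.2.1
    omega

/-- The price table is stored row by row with `nY` cells for each vertex, so vertex and slot are
recovered by division with remainder. -/
theorem price_index_inj {n : ℕ} {x x' t t' : ℕ} (ht : t < n) (ht' : t' < n)
    (h : (x * n + t : ℤ) = x' * n + t') : x = x' ∧ t = t' := by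
  norm_cast at h
  have key : ∀ y r : ℕ, r < n → (y * n + r) / n = y := fun y r hr => by
    rw [mul_comm, Nat.mul_add_div (by omega), Nat.div_eq_of_lt hr, add_zero]
  have h1 := congrArg (· / n) h
  simp only [key _ _ ht, key _ _ ht'] at h1
  subst h1
  exact ⟨rfl, by omega⟩

variable [IsStrictOrderedRing R]

/-- The invariant of the auction after `n` rounds. -/
def RoundInv (G : BGraph R) (ε : R) (L : ℕ) (κ : ℕ → ℤ) (n : ℕ) (s : St R) : Prop :=
  ∃ asg k, (Holds s .asg G.nE fun e => asg e) ∧ Prices G ε k s ∧ G.AucInv κ ε L asg k ∧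
    (G.Stable κ ε asg k ∨ n ≤ ∑ x ∈ range G.nX, ∑ t ∈ range G.nY, k x t)

/-- If the scan found no positive net value, the assignment is stable and the round changes nothing.
Otherwise a bid is made and the sum of the counters grows by one. -/
theorem run_bidProg {asg : ℕ → ℕ} {k : ℕ → ℕ → ℕ} {n : ℕ} (hε : 0 ≤ ε)
    (hu : ∀ e < G.nE, 1 ≤ κ (G.src e) → G.u e ≤ L * ε) (hE : Env G ε L s)
    (hA : Holds s .asg G.nE fun e => asg e) (hp : Prices G ε k s) (hinv : G.AucInv κ ε L asg k)
    (hn : G.Stable κ ε asg k ∨ n ≤ ∑ x ∈ range G.nX, ∑ t ∈ range G.nY, k x t)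
    (hscan : ScanInv G ε κ asg k (fun _ _ => True) s) :
    RoundInv G ε L κ (n + 1) (bidProg.run s) := by
  obtain ⟨hmax, ⟨hbe, hnet⟩ | ⟨e, t, hbe, hbs, hc, hnet, hpos⟩⟩ := hscan
  · have : bidProg.run s = s := by
      simp [bidProg, run, BX.Holds, IX.eval, hbe]
    rw [this]
    refine ⟨asg, k, hA, hp, hinv, .inl fun e he hf t ht htκ => ?_⟩
    have := hmax e t trivial ⟨he, ht, htκ, hf⟩
    rw [hnet] at this
    linarith
  · obtain ⟨he, ht, htκ, hf⟩ := hc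
    have hsrc := G.src_lt e he
    rw [hnet] at hpos hmax
    have hinv' := hinv.bid hε he hf ht htκ
      (fun e' he' hf' t' ht' htκ' => hmax e' t' trivial ⟨he', ht', htκ', hf'⟩) hpos
      (hu e he (by omega))
    set P₁ := forTo .ve .nE (ite (.and
        (.and (.ile (.get .src (.sc .ve)) (.get .src (.sc .be)))
          (.ile (.get .src (.sc .be)) (.get .src (.sc .ve))))
        (.and (.ile (.get .asg (.sc .ve)) (.add (.sc .bs) (.const 1)))
          (.ile (.add (.sc .bs) (.const 1)) (.get .asg (.sc .ve)))))
      (setI .asg (.sc .ve) (.const 0)) skip) with hP₁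
    have ha₁ : Agree [.ve, .asg] [] s (P₁.run s) := P₁.agree_run s
    have h₁ : ∀ e' < G.nE, (P₁.run s).i .asg (e' : ℕ) =
        ((if G.src e' = G.src e ∧ asg e' = t + 1 then 0 else asg e' : ℕ) : ℤ) := by
      refine (run_forTo_map hE.nE (by decide) (fun e' =>
        ((if G.src e' = G.src e ∧ asg e' = t + 1 then 0 else asg e' : ℕ) : ℤ))
        fun e' s' he' ha hv hsame => ?_).1
      have hE' := hE.agree ha (by decide) (by decide)
      replace hsame : s'.i .asg e' = asg e' := hsame.trans (hA e' he')
      simp only [run, BX.Holds, IX.eval, hv, ha.i .be (by decide), ha.i .bs (by decide), hbe, hbs,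
        hE'.src e' he', hE'.src e he, hsame]
      have hiff : (((G.src e' : ℤ) ≤ G.src e ∧ (G.src e : ℤ) ≤ G.src e') ∧
          (asg e' : ℤ) ≤ t + 1 ∧ (t : ℤ) + 1 ≤ asg e') ↔
          (G.src e' = G.src e ∧ asg e' = t + 1) := by omega
      simp only [hiff]
      split_ifs with hc
      · simp
      · rw [← hsame]
        exact (Function.update_eq_self _ _).symm
    have hE₁ := hE.agree ha₁ (by decide) (by decide)
    have hix : (priceIx .be .bs).eval (P₁.run s) = G.src e * G.nY + t := by
      simp only [priceIx, IX.eval, ha₁.i .be (by decide), ha₁.i .bs (by decide), hbe, hbs,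
        hE₁.src e he, hE₁.base _ hsrc]
    have hrun : bidProg.run s = ((P₁.run s).setI .asg e (t + 1)).setW .price
        (G.src e * G.nY + t) (k (G.src e) t * ε + ε) := by
      have hc : (BX.ile (.const 0) (.sc .be)).Holds s := by simp [BX.Holds, IX.eval, hbe]
      rw [bidProg, run, if_pos hc]
      simp only [block]
      rw [run, ← hP₁, run, run, run]
      have h1 : ∀ z, (priceIx .be .bs).eval ((P₁.run s).setI .asg e z) =
          (priceIx .be .bs).eval (P₁.run s) := fun z => by simp [priceIx, IX.eval]
      have h2 : (IX.sc .be).eval (P₁.run s) = e := by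
        simp only [IX.eval, ha₁.i .be (by decide), hbe]
      have h3 : (IX.add (.sc .bs) (.const 1)).eval (P₁.run s) = t + 1 := by
        simp only [IX.eval, ha₁.i .bs (by decide), hbs]
      rw [h2, h3]
      simp only [WX.eval, h1, hix, IX.eval, St.setI_w, ha₁.w .price (by decide),
        hp _ hsrc t ht, hE₁.eps]
    rw [hrun]
    refine ⟨_, _, fun e' he' => ?_, fun x hx t' ht' => ?_, hinv', .inr ?_⟩
    · by_cases hee : e' = e
      · subst hee
        simp [BGraph.bidAsg]
      · rw [St.setW_i, St.setI_i_self, Function.update_of_ne (by omega), h₁ e' he']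
        simp [BGraph.bidAsg, hee]
    · rw [St.setW_w_self]
      by_cases hxt : x = G.src e ∧ t' = t
      · obtain ⟨rfl, rfl⟩ := hxt
        simp [BGraph.bidPrice]
        ring
      · rw [Function.update_of_ne, St.setI_w, ha₁.w .price (by decide), hp x hx t' ht']
        · simp only [BGraph.bidPrice, if_neg hxt]
        · exact fun h => hxt (price_index_inj ht' ht h)
    · rw [G.sum_bidPrice k he ht]
      -- A stable assignment admits no candidate of positive net value, so the first case
      -- contradicts `hpos`.
      rcases hn with hn | hn
      · have := hn e he hf t ht htκ
        linarith
      · omega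

theorem run_roundProg {n : ℕ} (hε : 0 ≤ ε)
    (hu : ∀ e < G.nE, 1 ≤ κ (G.src e) → G.u e ≤ L * ε) (hE : Env G ε L s)
    (hκ : Holds s .kap G.nX κ) (h : RoundInv G ε L κ n s) :
    RoundInv G ε L κ (n + 1) (roundProg.run s) := by
  obtain ⟨asg, k, hA, hp, hinv, hn⟩ := h
  have hb := run_busyProg hE hA
  have ha₁ := busyProg.agree_run s
  have ha₂ := scanProg.agree_run (busyProg.run s)
  have hE₁ := hE.agree ha₁ (by decide) (by decide)
  have hscan := run_scanProg hE₁ (hκ.agree ha₁ (by decide)) hb (hp.agree ha₁ (by decide))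
  exact run_bidProg hε hu (hE₁.agree ha₂ (by decide) (by decide))
    ((hA.agree ha₁ (by decide)).agree ha₂ (by decide))
    ((hp.agree ha₁ (by decide)).agree ha₂ (by decide)) hinv hn hscan

/-- The specification of `evalProg`. -/
theorem run_evalProg (hε : 0 ≤ ε) (hκ0 : ∀ x < G.nX, 0 ≤ κ x)
    (hu : ∀ e < G.nE, 1 ≤ κ (G.src e) → G.u e ≤ L * ε) (hE : Env G ε L s)
    (hκ : Holds s .kap G.nX κ) :
    ∃ M, G.Feas κ M ∧ (∀ M', G.Feas κ M' → G.val M' ≤ G.val M + G.nY * ε) ∧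
      (evalProg.run s).w .val 0 = G.val M ∧
      ∀ e < G.nE, 1 ≤ (evalProg.run s).i .asg (e : ℕ) ↔ e ∈ M := by
  set P₁ := forTo .ve .nE (setI .asg (.sc .ve) (.const 0)) with hP₁
  set P₂ := forTo .va .nX (forTo .vb .nY
    (setW .price (.add (.get .base (.sc .va)) (.sc .vb)) .zero)) with hP₂
  set P₃ := forTo .va .nX (forTo .vb .nY (forTo .vc .L roundProg)) with hP₃
  set P₅ := forTo .ve .nE (ite (.ile (.const 1) (.get .asg (.sc .ve)))
    (assignW .val (.add (.sc .val) (.get .u (.sc .ve)))) skip) with hP₅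
  set s₁ := P₁.run s with hs₁
  set s₂ := P₂.run s₁ with hs₂
  set s₃ := P₃.run s₂ with hs₃
  set s₄ := s₃.setW .val 0 0 with hs₄
  have hrun : evalProg.run s = P₅.run s₄ := rfl
  have ha₁ : Agree _ _ s s₁ := P₁.agree_run s
  have ha₂ : Agree _ _ s₁ s₂ := P₂.agree_run s₁
  have ha₃ : Agree _ _ s₂ s₃ := P₃.agree_run s₂
  have ha₄ : Agree _ _ s₃ s₄ := agree_setW s₃ .val 0 0
  have hE₁ := hE.agree ha₁ (by decide) (by decide)
  have hE₂ := hE₁.agree ha₂ (by decide) (by decide)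
  have hE₄ := (hE₂.agree ha₃ (by decide) (by decide)).agree ha₄ (by decide) (by decide)
  have h₁ : Holds s₁ .asg G.nE fun _ => 0 :=
    (run_forTo_map hE.nE (by decide) (fun _ => 0) fun k s' hk ha hv _ => by
      simp [run, IX.eval, hv]).1
  have h₂ : Prices G ε (fun _ _ => 0) s₂ := by
    suffices ∀ x < G.nX, ∀ t < G.nY, s₂.w .price (x * G.nY + t) = 0 from
      fun x hx t ht => by simp [this x hx t ht]
    refine run_forTo_inv hE₁.nX (fun n s' => ∀ x < n, ∀ t < G.nY, s'.w .price (x * G.nY + t) = 0)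
      (fun n s' z h => h) (by simp) fun n s' hn ha hv h x hx t ht => ?_
    have hE' := hE₁.agree ha (by decide) (by decide)
    -- The inner invariant keeps the cleared rows below `n` together with the cleared initial piece
    -- of the current row.
    suffices h3 : ∀ x < n + 1, ∀ t < G.nY, x < n ∨ t < G.nY →
        ((forTo .vb .nY (setW .price (.add (.get .base (.sc .va)) (.sc .vb)) .zero)).run s').w
          .price (x * G.nY + t) = 0 from h3 x hx t ht (.inr ht)
    refine run_forTo_inv hE'.nY (fun m s' => ∀ x < n + 1, ∀ t < G.nY, x < n ∨ t < m →
      s'.w .price (x * G.nY + t) = 0) (fun n s' z h => h) (fun x _ t ht h' => ?_)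
      fun m s'' hm ha' hv' h' x hx t ht hlt => ?_
    · exact h x (by omega) t ht
    · have hva : s''.i .va 0 = n := by rw [ha'.i _ (by decide), hv]
      simp only [run, IX.eval, WX.eval, hva, hv', ha'.i .base (by decide), hE'.base n hn,
        St.setW_w_self]
      by_cases hc : x = n ∧ t = m
      · obtain ⟨rfl, rfl⟩ := hc
        simp
      · rw [Function.update_of_ne fun h => hc (price_index_inj ht hm h)]
        exact h' x hx t ht (by omega)
  -- The number of rounds equals the largest possible sum of the price counters, so afterwards both
  -- alternatives of the invariant give stability.
  have h₃ : RoundInv G ε L κ (G.nX * (G.nY * L)) s₃ := by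
    have hκ₂ := (hκ.agree ha₁ (by decide)).agree ha₂ (by decide)
    have hset : ∀ (v : IName), v ≠ .asg → ∀ k (s' : St R) z, RoundInv G ε L κ k s' →
        RoundInv G ε L κ k (s'.setI v 0 z) := by
      rintro v hv k s' z ⟨asg, k', hA, hp, h⟩
      exact ⟨asg, k', hA.agree (agree_setI s' v 0 z) (by simpa using hv.symm),
        hp.agree (agree_setI s' v 0 z) (by decide), h⟩
    have := run_forTo_iter hE₂.nX (v := .va) (RoundInv G ε L κ) (hset _ (by decide)) 0 (G.nY * L)
      ⟨_, _, h₁.agree ha₂ (by decide), h₂, G.aucInv_zero κ ε L, .inr (by simp)⟩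
      (P := forTo .vb .nY (forTo .vc .L roundProg)) fun t s' ha h => by
        have hE' := hE₂.agree ha (by decide) (by decide)
        refine run_forTo_iter hE'.nY (RoundInv G ε L κ) (hset _ (by decide)) t L h
          fun t s'' hb h => ?_
        have hE'' := hE'.agree hb (by decide) (by decide)
        have := run_forTo_iter hE''.L (v := .vc) (RoundInv G ε L κ) (hset _ (by decide)) t 1 h
          (P := roundProg) fun t s''' hc h => by
            refine run_roundProg hε hu (hE''.agree hc (by decide) (by decide)) ?_ h
            exact ((hκ₂.agree ha (by decide)).agree hb (by decide)).agree hc (by decide)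
        simpa using this
    simpa using this
  obtain ⟨asg, k, hA, hp, hinv, hst⟩ := h₃
  have hst' : G.Stable κ ε asg k := by
    rcases hst with h | h
    · exact h
    · exact hinv.stable_of_sum_le hu (by rwa [mul_assoc])
  refine ⟨G.asgSet asg, hinv.feas hκ0, fun M' hM' => hinv.val_le hst' hε hκ0 hM', ?_, ?_⟩
  · rw [hrun, run_forTo_addW hE₄.nE 0 (fun e => if asg e ≠ 0 then G.u e else 0)]
    · simp [hs₄, BGraph.val, BGraph.asgSet, sum_filter]
    · intro e s' he ha hv
      have hE' := hE₄.agree ha (by decide) (by decide)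
      have hA' := (hA.agree ha₄ (by decide)).agree ha (by decide) e he
      simp only [run, BX.Holds, IX.eval, WX.eval, hv, hA', hE'.u e he]
      split_ifs <;> first | omega | simp
  · intro e he
    have ha₅ : Agree _ _ s₄ (P₅.run s₄) := P₅.agree_run s₄
    rw [hrun, (hA.agree ha₄ (by decide)).agree ha₅ (by decide) e he]
    simp only [BGraph.asgSet, mem_filter, mem_range, he, true_and]
    omega

end

/-! # Ranking and enumeration -/

section Rank

variable {R : Type} [LinearOrder R] (F : ℕ → R) (n : ℕ)

/-- `j` precedes `x`: it has a larger value, or the same value and a smaller index. -/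
def Before (j x : ℕ) : Prop := F x < F j ∨ (F x ≤ F j ∧ j < x)

open Classical in
/-- The number of elements below `n` that precede `x`. -/
noncomputable def rk (x : ℕ) : ℕ := ((range n).filter fun j => Before F j x).card

/-- The first `N` elements below `n`. -/
noncomputable def topSet (N : ℕ) : Finset ℕ := (range n).filter fun x => rk F n x < N

variable {F n}

theorem Before.trans {i j x : ℕ} (h : Before F i j) (h' : Before F j x) : Before F i x := by
  rcases h with h | h <;> rcases h' with h' | h'
  · exact .inl (h'.trans h)
  · exact .inl (h'.1.trans_lt h)
  · exact .inl (h'.trans_le h.1)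
  · exact .inr ⟨h'.1.trans h.1, h.2.trans h'.2⟩

theorem not_before_self (x : ℕ) : ¬ Before F x x := by simp [Before]

theorem before_or_before {i j : ℕ} (h : i ≠ j) : Before F i j ∨ Before F j i := by
  unfold Before
  rcases lt_trichotomy (F i) (F j) with h' | h' | h'
  · exact .inr (.inl h')
  · rcases Nat.lt_or_gt_of_ne h with h'' | h''
    · exact .inl (.inr ⟨h'.ge, h''⟩)
    · exact .inr (.inr ⟨h'.le, h''⟩)
  · exact .inl (.inl h')

theorem rk_lt_rk {j x : ℕ} (hj : j < n) (h : Before F j x) : rk F n j < rk F n x := by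
  classical
  refine card_lt_card (Finset.ssubset_iff_subset_ne.2 ⟨fun i hi => ?_, fun heq => ?_⟩)
  · simp only [mem_filter] at hi ⊢
    exact ⟨hi.1, hi.2.trans h⟩
  · have : j ∈ (range n).filter fun i => Before F i x := by simp [hj, h]
    rw [← heq] at this
    exact not_before_self j (mem_filter.1 this).2

theorem rk_lt {x : ℕ} (hx : x < n) : rk F n x < n := by
  classical
  have h : (range n).filter (fun j => Before F j x) ⊂ range n :=
    Finset.ssubset_iff_subset_ne.2 ⟨filter_subset _ _, fun heq => by
      have : x ∈ (range n).filter fun j => Before F j x := by rw [heq]; simpa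
      exact not_before_self x (mem_filter.1 this).2⟩
  simpa [rk] using card_lt_card h

theorem rk_injOn : Set.InjOn (rk F n) (range n) := by
  intro x hx y hy h
  by_contra hne
  simp only [coe_range, Set.mem_Iio] at hx hy
  rcases before_or_before (F := F) hne with h' | h'
  · exact (rk_lt_rk hx h').ne h
  · exact (rk_lt_rk hy h').ne h.symm

/-- Ties are broken by the index, so the ranks are distinct and below `n`, and hence exhaust the
numbers below `n`. -/
theorem exists_rk_eq {i : ℕ} (hi : i < n) : ∃ x < n, rk F n x = i := by
  have h : (range n).image (rk F n) = range n := by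
    refine eq_of_subset_of_card_le (fun i hi => ?_) ?_
    · obtain ⟨x, hx, rfl⟩ := mem_image.1 hi
      simpa using rk_lt (by simpa using hx)
    · rw [card_image_of_injOn rk_injOn]
  have : i ∈ (range n).image (rk F n) := by rw [h]; simpa
  simpa using this

/-- If fewer than `N` vertices exist, the top set is everything and no exchange is ever needed;
hence the alternative, in the form used by `exists_supported`. -/
theorem card_topSet {N : ℕ} : N ≤ (topSet F n N).card ∨ topSet F n N = range n := by
  by_cases hN : N ≤ n
  · left
    calc N = (range N).card := (card_range N).symm
      _ ≤ ((topSet F n N).image (rk F n)).card := by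
        refine card_le_card fun i hi => ?_
        have hi' := mem_range.1 hi
        obtain ⟨x, hx, h⟩ := exists_rk_eq (F := F) (hi'.trans_le hN)
        exact mem_image.2 ⟨x, by simp [topSet, hx, h, hi'], h⟩
      _ ≤ _ := card_image_le
  · right
    exact filter_true_of_mem fun x hx => (rk_lt (mem_range.1 hx)).trans (by omega)

/-- A strictly larger value would give `x` a smaller rank than `a`, and then `x` would be in the top
set too. -/
theorem le_of_mem_topSet {N x a : ℕ} (hx : x < n) (hxA : x ∉ topSet F n N)
    (ha : a ∈ topSet F n N) : F x ≤ F a := by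
  by_contra h
  simp only [topSet, mem_filter, mem_range, hx, true_and, not_lt] at hxA ha
  have := rk_lt_rk (F := F) hx (.inl (not_le.1 h) : Before F x a)
  omega

end Rank

/-! ### Counting in base three -/

/-- The `i`-th ternary digit. -/
def ternary (t i : ℕ) : ℕ := t / 3 ^ i % 3

/-- Every pattern of digits occurs below `3 ^ N`, so a counter that runs through this range meets
every choice of types. -/
theorem exists_ternary (N : ℕ) : ∀ d : ℕ → ℕ, (∀ i, d i < 3) →
    ∃ t < 3 ^ N, ∀ i < N, ternary t i = d i := by
  induction N with
  | zero => exact fun d _ => ⟨0, by simp, by simp⟩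
  | succ N ih =>
    intro d hd
    obtain ⟨t, ht, h⟩ := ih (fun i => d (i + 1)) fun i => hd _
    have h0 := hd 0
    refine ⟨d 0 + 3 * t, by rw [pow_succ']; omega, fun i hi => ?_⟩
    rcases i with _ | i
    · simp only [ternary, pow_zero, Nat.div_one]
      omega
    · have h1 : (d 0 + 3 * t) / 3 = t := by omega
      rw [← h i (by omega), ternary, ternary, pow_succ', ← Nat.div_div_eq_div_mul, h1]

/-- Divisibility of `t + 1` by `3 ^ n` says that the lowest `n` digits of `t` are all `2`, that is,
adding one carries into position `n`. The two cases are whether this carry stops there or moves on.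
-/
theorem ternary_succ_of_dvd {t n : ℕ} (h : 3 ^ n ∣ t + 1) :
    (ternary t n ≤ 1 → ternary (t + 1) n = ternary t n + 1 ∧ ¬ 3 ^ (n + 1) ∣ t + 1) ∧
      (¬ ternary t n ≤ 1 → ternary (t + 1) n = 0 ∧ 3 ^ (n + 1) ∣ t + 1) := by
  have h1 : (t + 1) / 3 ^ n = t / 3 ^ n + 1 := by rw [Nat.succ_div, if_pos h]
  have h2 : 3 ^ (n + 1) ∣ t + 1 ↔ 3 ∣ t / 3 ^ n + 1 := by
    rw [← h1, pow_succ]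
    exact (Nat.dvd_div_iff_mul_dvd h).symm
  rw [h2]
  simp only [ternary, h1]
  omega

theorem ternary_succ_of_not_dvd {t n : ℕ} (h : ¬ 3 ^ n ∣ t + 1) :
    ternary (t + 1) n = ternary t n ∧ ¬ 3 ^ (n + 1) ∣ t + 1 := by
  refine ⟨by rw [ternary, ternary, Nat.succ_div, if_neg h, add_zero], fun h' => h ?_⟩
  exact (pow_dvd_pow 3 (Nat.le_succ n)).trans h'

/-- The types that the digits `dig` give to the elements of rank below `N`. -/
def typOf (rank : ℕ → ℕ) (N t : ℕ) : ℕ → ℕ := fun x =>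
  if rank x < N then ternary t (rank x) else 0

/-- Ranks are injective, so each digit is read by at most one vertex and can be prescribed freely.
Only the types `1` and `2` have to match, since any other value of `D` means a closed vertex. -/
theorem exists_typOf {R : Type} [LinearOrder R] {F : ℕ → R} {n N : ℕ} {D : ℕ → ℕ}
    (hD : SuppIn n (topSet F n N) D) :
    ∃ t < 3 ^ N, ∀ x < n, (typOf (rk F n) N t x = 1 ↔ D x = 1) ∧
      (typOf (rk F n) N t x = 2 ↔ D x = 2) := by
  classical
  set d : ℕ → ℕ := fun i => if ∃ x < n, rk F n x = i ∧ D x = 1 then 1 else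
    if ∃ x < n, rk F n x = i ∧ D x = 2 then 2 else 0 with hd
  obtain ⟨t, ht, h⟩ := exists_ternary N d fun i => by simp only [hd]; split_ifs <;> omega
  refine ⟨t, ht, fun x hx => ?_⟩
  have huniq : ∀ v, (∃ y < n, rk F n y = rk F n x ∧ D y = v) ↔ D x = v := by
    refine fun v => ⟨?_, fun h => ⟨x, hx, rfl, h⟩⟩
    rintro ⟨y, hy, h1, h2⟩
    rwa [← rk_injOn (by simpa using hy) (by simpa using hx) h1]
  by_cases hr : rk F n x < N
  · simp only [typOf, if_pos hr, h _ hr, hd, huniq]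
    by_cases h1 : D x = 1
    · simp [h1]
    · by_cases h2 : D x = 2 <;> simp [h1, h2]
  · have := hD x hx (by simp [topSet, hr])
    simp [typOf, hr, this]

theorem Adm.congr {nX K₁ K₂ : ℕ} {D D' : ℕ → ℕ} (h : Adm nX K₁ K₂ D)
    (hD : ∀ x < nX, (D' x = 1 ↔ D x = 1) ∧ (D' x = 2 ↔ D x = 2)) : Adm nX K₁ K₂ D' := by
  refine ⟨?_, ?_⟩
  · rw [filter_congr fun x hx => (hD x (mem_range.1 hx)).1]
    exact h.one
  · rw [filter_congr fun x hx => (hD x (mem_range.1 hx)).2]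
    exact h.two

/-! # The approximation algorithm as a program -/

/-- Compute the numbers `L` and `N` and the offsets of the price table. -/
def paramProg (q : ℕ) : FProg := block [
  assign .L (.const 1),
  forTo .va .nY (block [assign .L (.add (.sc .L) (.const (2 * q))),
    forTo .vb .K (assign .L (.add (.sc .L) (.const (2 * q))))]),
  assign .N (.add (.const 1) (.sc .K)),
  forTo .va .p (forTo .vb .K (assign .N (.add (.sc .N) (.const (2 * q))))),
  setI .base (.const 0) (.const 0),
  forTo .va .nX (setI .base (.add (.sc .va) (.const 1)) (.add (.get .base (.sc .va)) (.sc .nY)))]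

/-- Compute the number of choices of types. -/
def powProg : FProg := block [
  assign .pow (.const 1),
  forTo .va .N (assign .pow (.add (.sc .pow) (.add (.sc .pow) (.sc .pow))))]

/-- Compute the increment of the prices and the scaled weights. -/
def weightProg : FProg := block [
  assignW .eps .zero,
  forTo .ve .nE (ite (.and (.ile (.const 1) (.get .cap2 (.get .src (.sc .ve))))
      (.wle (.sc .eps) (.get .w (.sc .ve))))
    (assignW .eps (.get .w (.sc .ve))) skip),
  forTo .ve .nE (block [setW .u (.sc .ve) .zero,
    forTo .va .L (setW .u (.sc .ve) (.add (.get .u (.sc .ve)) (.get .w (.sc .ve))))])]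

/-- Evaluate every vertex on its own. -/
def valueProg : FProg :=
  forTo .vx .nX (block [
    forTo .vj .nX (setI .kap (.sc .vj) (.const 0)),
    setI .kap (.sc .vx) (.get .cap2 (.sc .vx)),
    evalProg,
    setW .F (.sc .vx) (.sc .val)])

/-- The test whether `vj` precedes `vx`. -/
def beforeTest : BX :=
  .not (.and (.wle (.get .F (.sc .vj)) (.get .F (.sc .vx)))
    (.not (.and (.wle (.get .F (.sc .vx)) (.get .F (.sc .vj))) (.not (.ile (.sc .vx) (.sc .vj))))))

/-- Rank the vertices by value. -/
def rankProg : FProg :=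
  forTo .vx .nX (block [
    assign .r (.const 0),
    forTo .vj .nX (ite beforeTest (assign .r (.add (.sc .r) (.const 1))) skip),
    setI .rank (.sc .vx) (.sc .r)])

/-- Read the types off the digits. -/
def typProg : FProg :=
  forTo .vx .nX (ite (.ile (.sc .N) (.get .rank (.sc .vx))) (setI .typ (.sc .vx) (.const 0))
    (setI .typ (.sc .vx) (.get .dig (.get .rank (.sc .vx)))))

/-- Set the capacities according to the types. -/
def kapProg : FProg :=
  forTo .vx .nX (ite (.ile (.get .typ (.sc .vx)) (.const 0)) (setI .kap (.sc .vx) (.const 0))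
    (ite (.ile (.get .typ (.sc .vx)) (.const 1)) (setI .kap (.sc .vx) (.get .cap1 (.sc .vx)))
      (setI .kap (.sc .vx) (.get .cap2 (.sc .vx)))))

/-- Count in `a` the vertices whose type in the array `b` is `z`. -/
def countProg (b a : IName) (z : ℤ) : FProg := block [
  assign a (.const 0),
  forTo .vx .nX (ite (.and (.ile (.get b (.sc .vx)) (.const z)) (.ile (.const z) (.get b (.sc .vx))))
    (assign a (.add (.sc a) (.const 1))) skip)]

/-- Keep the matching if it is admissible and better than the best one so far. -/
def storeProg : FProg :=
  ite (.and (.and (.ile (.sc .c1) (.sc .K1)) (.ile (.sc .c2) (.sc .K2)))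
      (.not (.wle (.sc .val) (.sc .bestVal))))
    (block [
      assignW .bestVal (.sc .val),
      forTo .ve .nE (ite (.ile (.const 1) (.get .asg (.sc .ve)))
        (setI .best (.sc .ve) (.const 1)) (setI .best (.sc .ve) (.const 0))),
      forTo .vx .nX (setI .bestD (.sc .vx) (.get .typ (.sc .vx)))]) skip

/-- Pass on to the next ternary number. -/
def incrProg : FProg := block [
  assign .r (.const 1),
  forTo .va .N (ite (.ile (.const 1) (.sc .r))
    (ite (.ile (.get .dig (.sc .va)) (.const 1))
      (block [setI .dig (.sc .va) (.add (.get .dig (.sc .va)) (.const 1)), assign .r (.const 0)])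
      (setI .dig (.sc .va) (.const 0))) skip)]

/-- Evaluate one choice of types. -/
def tryProg : FProg := block [typProg, kapProg, countProg .typ .c1 1, countProg .typ .c2 2,
  evalProg, storeProg, incrProg]

/-- Evaluate all choices of types. -/
def enumProg : FProg := block [
  assignW .bestVal .zero,
  forTo .va .N (setI .dig (.sc .va) (.const 0)),
  forTo .vt .pow tryProg]

def mainProg : FProg := block [weightProg, valueProg, rankProg, enumProg]

/-- The graph with all weights multiplied by `L`. -/
def BGraph.scale {R : Type} [CommRing R] (G : BGraph R) (L : ℕ) : BGraph R :=
  { G with u := fun e => L * G.u e }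

/-! ### Parameters, price increment and scaled weights -/

section

variable {R : Type} [CommRing R] [LinearOrder R] {G : BGraph R} {ε : R} {L : ℕ} {s : St R}

/-- The state `s` holds the input of the algorithm. -/
structure CoreEnv (G : BGraph R) (K₁ K₂ p : ℕ) (c₁ c₂ : ℕ → ℤ) (s : St R) : Prop where
  nX : s.i .nX 0 = G.nX
  nY : s.i .nY 0 = G.nY
  nE : s.i .nE 0 = G.nE
  K : s.i .K 0 = (K₁ + K₂ : ℕ)
  K1 : s.i .K1 0 = K₁
  K2 : s.i .K2 0 = K₂
  p : s.i .p 0 = p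
  src : ∀ e < G.nE, s.i .src (e : ℕ) = G.src e
  dst : ∀ e < G.nE, s.i .dst (e : ℕ) = G.dst e
  cap1 : ∀ x < G.nX, s.i .cap1 (x : ℕ) = c₁ x
  cap2 : ∀ x < G.nX, s.i .cap2 (x : ℕ) = c₂ x
  w : ∀ e < G.nE, s.w .w (e : ℕ) = G.u e

variable {K₁ K₂ p : ℕ} {c₁ c₂ : ℕ → ℤ}

omit [CommRing R] [LinearOrder R] in
theorem CoreEnv.agree {s' : St R} {A : List IName} {V : List WName}
    (h : CoreEnv G K₁ K₂ p c₁ c₂ s) (ha : Agree A V s s')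
    (hA : ∀ a ∈ [IName.nX, .nY, .nE, .K, .K1, .K2, .p, .src, .dst, .cap1, .cap2], a ∉ A)
    (hV : WName.w ∉ V) : CoreEnv G K₁ K₂ p c₁ c₂ s' := by
  simp only [List.mem_cons, List.not_mem_nil, or_false, forall_eq_or_imp, forall_eq] at hA
  obtain ⟨a1, a2, a3, a4, a5, a6, a7, a8, a9, a10, a11⟩ := hA
  constructor
  · rw [ha.i _ a1, h.nX]
  · rw [ha.i _ a2, h.nY]
  · rw [ha.i _ a3, h.nE]
  · rw [ha.i _ a4, h.K]
  · rw [ha.i _ a5, h.K1]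
  · rw [ha.i _ a6, h.K2]
  · rw [ha.i _ a7, h.p]
  · rw [ha.i _ a8]; exact h.src
  · rw [ha.i _ a9]; exact h.dst
  · rw [ha.i _ a10]; exact h.cap1
  · rw [ha.i _ a11]; exact h.cap2
  · rw [ha.w _ hV]; exact h.w

/-- The value of `L`. -/
def Lval (q k n : ℕ) : ℕ := 1 + n * (2 * q * (k + 1))

/-- The value of `N`. -/
def Nval (q k p : ℕ) : ℕ := 1 + k + p * (k * (2 * q))

/-- The machine does not multiply, so the products in `L` and `N` and the row offsets of the price
table are accumulated by repeated addition. -/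
theorem run_paramProg (q : ℕ) (h : CoreEnv G K₁ K₂ p c₁ c₂ s) :
    ((paramProg q).run s).i .L 0 = Lval q (K₁ + K₂) G.nY ∧
    ((paramProg q).run s).i .N 0 = Nval q (K₁ + K₂) p ∧
    ∀ x < G.nX, ((paramProg q).run s).i .base (x : ℕ) = x * G.nY := by
  set P₁ := forTo .va .nY (block [assign .L (.add (.sc .L) (.const (2 * q))),
    forTo .vb .K (assign .L (.add (.sc .L) (.const (2 * q))))]) with hP₁
  set P₂ := forTo .va .p (forTo .vb .K (assign .N (.add (.sc .N) (.const (2 * q))))) with hP₂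
  set P₃ := forTo .va .nX (setI .base (.add (.sc .va) (.const 1))
    (.add (.get .base (.sc .va)) (.sc .nY))) with hP₃
  set s₀ := s.setI .L 0 1 with hs₀
  have ha₀ : Agree _ _ s s₀ := agree_setI s .L 0 1
  have h₀ := h.agree ha₀ (by decide) (by decide)
  set s₁ := P₁.run s₀ with hs₁
  have ha₁ : Agree [.va, .L, .vb, .L] [] s₀ s₁ := P₁.agree_run s₀
  have h₁ := h₀.agree ha₁ (by decide) (by decide)
  set s₂ := s₁.setI .N 0 (1 + s₁.i .K 0) with hs₂
  have ha₂ : Agree _ _ s₁ s₂ := agree_setI s₁ .N 0 _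
  have h₂ := h₁.agree ha₂ (by decide) (by decide)
  set s₃ := P₂.run s₂ with hs₃
  have ha₃ : Agree [.va, .vb, .N] [] s₂ s₃ := P₂.agree_run s₂
  have h₃ := h₂.agree ha₃ (by decide) (by decide)
  set s₄ := s₃.setI .base 0 0 with hs₄
  have ha₄ : Agree _ _ s₃ s₄ := agree_setI s₃ .base 0 0
  have h₄ := h₃.agree ha₄ (by decide) (by decide)
  have ha₅ : Agree _ _ s₄ (P₃.run s₄) := P₃.agree_run s₄
  have hrun : (paramProg q).run s = P₃.run s₄ := rfl
  have hL : s₁.i .L 0 = Lval q (K₁ + K₂) G.nY := by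
    have := run_forTo_add (P := block [assign .L (.add (.sc .L) (.const (2 * q))),
      forTo .vb .K (assign .L (.add (.sc .L) (.const (2 * q))))]) (v := .va) h₀.nY (a := .L)
      (by decide) (fun _ => 2 * q + ((K₁ + K₂ : ℕ) : ℤ) * (2 * q)) fun k s' _ ha hv => by
        replace ha : Agree [.va, .L, .vb, .L] [] s₀ s' := ha
        have h' := h₀.agree ha (by decide) (by decide)
        have ha' := agree_setI s' .L 0 (s'.i .L 0 + 2 * q)
        have := run_forTo_add (P := assign .L (.add (.sc .L) (.const (2 * q)))) (v := .vb)
          (h'.agree ha' (by decide) (by decide)).K (a := .L) (by decide) (fun _ => 2 * q)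
          fun k s' _ ha hv => by simp [run, IX.eval]
        simp only [block]
        rw [run]
        refine this.trans ?_
        simp
        ring
    rw [hs₁, hP₁, this]
    simp only [hs₀, St.setI_i_self, Function.update_self, sum_const, card_range, nsmul_eq_mul, Lval]
    push_cast
    ring
  have hN : s₃.i .N 0 = Nval q (K₁ + K₂) p := by
    have := run_forTo_add (P := forTo .vb .K (assign .N (.add (.sc .N) (.const (2 * q)))))
      (v := .va) h₂.p (a := .N) (by decide) (fun _ => ((K₁ + K₂ : ℕ) : ℤ) * (2 * q))
      fun k s' _ ha hv => by
        replace ha : Agree [.va, .vb, .N] [] s₂ s' := ha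
        have h' := h₂.agree ha (by decide) (by decide)
        have := run_forTo_add (P := assign .N (.add (.sc .N) (.const (2 * q)))) (v := .vb)
          h'.K (a := .N) (by decide) (fun _ => 2 * q) fun k s' _ ha hv => by simp [run, IX.eval]
        refine this.trans ?_
        simp
    rw [hs₃, hP₂, this]
    simp [hs₂, Nval, h₁.K]
  refine ⟨?_, ?_, ?_⟩
  · rw [hrun, ha₅.i .L (by decide), ha₄.i .L (by decide), ha₃.i .L (by decide),
      ha₂.i .L (by decide), hL]
  · rw [hrun, ha₅.i .N (by decide), ha₄.i .N (by decide), hN]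
  · rw [hrun]
    suffices ∀ x < G.nX + 1, (P₃.run s₄).i .base (x : ℕ) = x * G.nY from
      fun x hx => this x (by omega)
    refine run_forTo_inv h₄.nX (fun n s' => ∀ x < n + 1, s'.i .base (x : ℕ) = x * G.nY)
      (fun n s' z h => by simpa using h) (fun x hx => ?_) fun n s' hn ha hv h' x hx => ?_
    · obtain rfl : x = 0 := by omega
      simp [hs₄]
    · have hE := h₄.agree ha (by decide) (by decide)
      simp only [run, IX.eval, hv, hE.nY, h' n (by omega), St.setI_i_self]
      rcases Nat.lt_succ_iff_lt_or_eq.1 hx with hx | rfl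
      · rw [Function.update_of_ne (by omega), h' x hx]
      · push_cast
        rw [Function.update_self]
        ring

theorem run_powProg {N : ℕ} (hN : s.i .N 0 = N) : (powProg.run s).i .pow 0 = (3 ^ N : ℕ) := by
  have ha : Agree _ _ s (s.setI .pow 0 1) := agree_setI s .pow 0 1
  refine run_forTo_inv (s := s.setI .pow 0 1) (v := .va) (n := .N)
    (P := assign .pow (.add (.sc .pow) (.add (.sc .pow) (.sc .pow))))
    (m := N) (by rw [ha.i .N (by decide), hN])
    (fun n s' => s'.i .pow 0 = (3 ^ n : ℕ)) (fun n s' z h => by simpa using h) (by simp)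
    fun n s' hn ha hv h => ?_
  simp only [run, IX.eval, h, St.setI_i_self, Function.update_self]
  push_cast
  ring

/-- The increment is the largest nonnegative weight among the edges with a positive capacity, or `0`
if there is none. Edges at vertices of capacity zero must not count, because the optimum is later
compared with `ε`. Scaling the weights up by `L` takes the place of dividing `ε` by `L`. -/
theorem run_weightProg (h : CoreEnv G K₁ K₂ p c₁ c₂ s) (hL : s.i .L 0 = L)
    (hbase : ∀ x < G.nX, s.i .base (x : ℕ) = x * G.nY) :
    ∃ ε, Env (G.scale L) ε L (weightProg.run s) ∧ 0 ≤ ε ∧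
      (∀ e < G.nE, 1 ≤ c₂ (G.src e) → G.u e ≤ ε) ∧
      (ε = 0 ∨ ∃ e < G.nE, 1 ≤ c₂ (G.src e) ∧ ε = G.u e) := by
  set P₁ := forTo .ve .nE (ite (.and (.ile (.const 1) (.get .cap2 (.get .src (.sc .ve))))
      (.wle (.sc .eps) (.get .w (.sc .ve))))
    (assignW .eps (.get .w (.sc .ve))) skip) with hP₁
  set P₂ := forTo .ve .nE (block [setW .u (.sc .ve) .zero,
    forTo .va .L (setW .u (.sc .ve) (.add (.get .u (.sc .ve)) (.get .w (.sc .ve))))]) with hP₂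
  set s₀ := s.setW .eps 0 0 with hs₀
  have ha₀ : Agree _ _ s s₀ := agree_setW s .eps 0 0
  have h₀ := h.agree ha₀ (by decide) (by decide)
  set s₁ := P₁.run s₀ with hs₁
  have ha₁ : Agree _ _ s₀ s₁ := P₁.agree_run s₀
  have h₁ := h₀.agree ha₁ (by decide) (by decide)
  have ha₂ : Agree _ _ s₁ (P₂.run s₁) := P₂.agree_run s₁
  have h₂ := h₁.agree ha₂ (by decide) (by decide)
  have hrun : weightProg.run s = P₂.run s₁ := rfl
  have hL₁ : s₁.i .L 0 = L := by rw [ha₁.i .L (by decide), ha₀.i .L (by decide), hL]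
  have hε : 0 ≤ s₁.w .eps 0 ∧ (∀ e < G.nE, 1 ≤ c₂ (G.src e) → G.u e ≤ s₁.w .eps 0) ∧
      (s₁.w .eps 0 = 0 ∨ ∃ e < G.nE, 1 ≤ c₂ (G.src e) ∧ s₁.w .eps 0 = G.u e) := by
    refine run_forTo_inv h₀.nE (fun n s' => 0 ≤ s'.w .eps 0 ∧
      (∀ e < n, 1 ≤ c₂ (G.src e) → G.u e ≤ s'.w .eps 0) ∧
      (s'.w .eps 0 = 0 ∨ ∃ e < G.nE, 1 ≤ c₂ (G.src e) ∧ s'.w .eps 0 = G.u e))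
      (fun n s' z h => h) (by simp [hs₀]) fun n s' hn ha hv h' => ?_
    have hE := h₀.agree ha (by decide) (by decide)
    simp only [run, BX.Holds, IX.eval, WX.eval, hv, hE.src n hn, hE.cap2 _ (G.src_lt n hn),
      hE.w n hn]
    obtain ⟨i1, i2, i3⟩ := h'
    split_ifs with hc
    · simp only [St.setW_w_self, Function.update_self]
      refine ⟨i1.trans hc.2, fun e he h1 => ?_, .inr ⟨n, hn, hc.1, rfl⟩⟩
      rcases Nat.lt_succ_iff_lt_or_eq.1 he with he | rfl
      · exact (i2 e he h1).trans hc.2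
      · exact le_rfl
    · refine ⟨i1, fun e he h1 => ?_, i3⟩
      rcases Nat.lt_succ_iff_lt_or_eq.1 he with he | rfl
      · exact i2 e he h1
      · exact (not_le.1 fun h2 => hc ⟨h1, h2⟩).le
  have hu : ∀ e < G.nE, (P₂.run s₁).w .u (e : ℕ) = L * G.u e := by
    refine run_forTo_mapW h₁.nE (fun e => L * G.u e) fun e s' he ha hv => ?_
    have hE := h₁.agree ha (by decide) (by decide)
    have hb := agree_setW s' .u e (0 : R)
    simp only [block]
    rw [run]
    have hs : (setW .u (.sc .ve) .zero).run s' = s'.setW .u e 0 := by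
      simp [run, IX.eval, WX.eval, hv]
    rw [hs]
    refine run_forTo_inv (s := s'.setW .u e 0) (m := L)
      (by rw [hb.i .L (by decide), ha.i .L (by decide), hL₁])
      (fun n s'' => s''.w .u = Function.update (s'.w .u) e (n * G.u e)) (fun n s' z h => h)
      (by simp) fun n s'' hn hc hv' h' => ?_
    have hve : s''.i .ve 0 = e := by rw [hc.i .ve (by decide), hb.i .ve (by decide), hv]
    have hE'' := (hE.agree hb (by decide) (by decide)).agree hc (by decide) (by decide)
    simp only [run, IX.eval, WX.eval, hve, hE''.w e he, h', St.setW_w_self, Function.update_self,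
      Function.update_idem]
    push_cast
    rw [add_mul, one_mul]
  have hεeq : (P₂.run s₁).w .eps 0 = s₁.w .eps 0 := by rw [ha₂.w .eps (by decide)]
  refine ⟨s₁.w .eps 0, ?_, hε⟩
  rw [hrun]
  refine ⟨h₂.nX, h₂.nY, h₂.nE, h₂.src, h₂.dst, ?_, hu, hεeq, ?_⟩
  · rw [ha₂.i .base (by decide), ha₁.i .base (by decide), ha₀.i .base (by decide)]
    exact hbase
  · rw [ha₂.i .L (by decide), hL₁]

end

/-! ### Valuation, ranking and enumeration -/

section

variable {R : Type} [CommRing R] [LinearOrder R] {G : BGraph R} {ε : R} {L : ℕ} {s : St R}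
  {K₁ K₂ N : ℕ} {c₁ c₂ : ℕ → ℤ}

theorem run_rankProg {F : ℕ → R} (hE : Env G ε L s) (hF : ∀ x < G.nX, s.w .F (x : ℕ) = F x) :
    Holds (rankProg.run s) .rank G.nX fun x => rk F G.nX x := by
  classical
  refine (run_forTo_map hE.nX (by decide) (fun x => (rk F G.nX x : ℤ)) fun x s' hx ha hv _ => ?_).1
  have hE' := hE.agree ha (by decide) (by decide)
  have ha₁ : Agree _ _ s' (s'.setI .r 0 0) := agree_setI s' .r 0 0
  set P := forTo .vj .nX (ite beforeTest (assign .r (.add (.sc .r) (.const 1))) skip) with hP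
  have hcount : (P.run (s'.setI .r 0 0)).i .r 0 = rk F G.nX x := by
    have := run_forTo_add (v := .vj) (n := .nX)
      (P := ite beforeTest (assign .r (.add (.sc .r) (.const 1))) skip)
      (hE'.agree ha₁ (by decide) (by decide)).nX (a := .r) (by decide)
      (fun j => if Before F j x then 1 else 0) fun j s'' hj hb hv' => by
        have hvx : s''.i .vx 0 = x := by
          rw [hb.i .vx (by decide), ha₁.i .vx (by decide), hv]
        have hFw : ∀ y < G.nX, s''.w .F (y : ℕ) = F y := by
          rw [hb.w .F (by decide), ha₁.w .F (by decide), ha.w .F (by decide)]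
          exact hF
        have hiff : beforeTest.Holds s'' ↔ Before F j x := by
          simp only [beforeTest, BX.Holds, IX.eval, WX.eval, hvx, hv', hFw x hx, hFw j hj, Before]
          have : ((x : ℤ) ≤ j) ↔ ¬ j < x := by omega
          rw [this, ← not_le (a := F j) (b := F x)]
          tauto
        simp only [run, hiff]
        split_ifs <;> simp [IX.eval]
    rw [hP, this]
    simp [rk]
  have ha₂ : Agree _ _ (s'.setI .r 0 0) (P.run (s'.setI .r 0 0)) := P.agree_run _
  have hvx : (P.run (s'.setI .r 0 0)).i .vx 0 = x := by
    rw [ha₂.i .vx (by decide), ha₁.i .vx (by decide), hv]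
  have hrun : (block [assign .r (.const 0), P, setI .rank (.sc .vx) (.sc .r)]).run s' =
      (P.run (s'.setI .r 0 0)).setI .rank x (rk F G.nX x) := by
    simp only [block, run, IX.eval, hvx, hcount]
  rw [hrun, St.setI_i_self, ha₂.i .rank (by decide), ha₁.i .rank (by decide)]

theorem ternary_le (t i : ℕ) : ternary t i ≤ 2 := by unfold ternary; omega

theorem typOf_le (rank : ℕ → ℕ) (N t x : ℕ) : typOf rank N t x ≤ 2 := by
  unfold typOf
  split_ifs
  exacts [ternary_le _ _, by omega]

theorem run_typProg {rank : ℕ → ℕ} {t : ℕ} (hE : Env G ε L s) (hN : s.i .N 0 = N)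
    (hr : Holds s .rank G.nX fun x => rank x) (hd : Holds s .dig N fun i => ternary t i) :
    Holds (typProg.run s) .typ G.nX fun x => typOf rank N t x := by
  refine (run_forTo_map hE.nX (by decide) (fun x => (typOf rank N t x : ℤ))
    fun x s' hx ha hv _ => ?_).1
  have hr' := hr.agree ha (by decide) x hx
  simp only [run, BX.Holds, IX.eval, hv, hr', ha.i .N (by decide), hN, typOf]
  split_ifs with h1 h2 h3
  · omega
  · simp
  · simp [hd.agree ha (by decide) _ h3]
  · omega

theorem run_kapProg {D : ℕ → ℕ} (hE : Env G ε L s) (h₁ : Holds s .cap1 G.nX c₁)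
    (h₂ : Holds s .cap2 G.nX c₂) (hD : Holds s .typ G.nX fun x => D x) (hD2 : ∀ x, D x ≤ 2) :
    Holds (kapProg.run s) .kap G.nX (capD c₁ c₂ D) := by
  refine (run_forTo_map hE.nX (by decide) (capD c₁ c₂ D) fun x s' hx ha hv _ => ?_).1
  simp only [run, BX.Holds, IX.eval, hv, hD.agree ha (by decide) x hx, h₁.agree ha (by decide) x hx,
    h₂.agree ha (by decide) x hx, capD]
  have := hD2 x
  split_ifs <;> first | omega | simp

theorem run_countProg {D : ℕ → ℕ} {b a : IName} (z : ℕ) (hn : s.i .nX 0 = (G.nX : ℤ))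
    (ha : a ≠ .vx) (hb : b ≠ a) (hb' : b ≠ .vx) (ha' : .nX ≠ a)
    (hD : Holds s b G.nX fun x => D x) :
    ((countProg b a z).run s).i a 0 = ((range G.nX).filter fun x => D x = z).card := by
  have ha₁ : Agree [a] [] s (s.setI a 0 0) := agree_setI s a 0 0
  simp only [countProg, block]
  rw [run]
  have := run_forTo_add (s := s.setI a 0 0) (v := .vx) (n := .nX) (m := G.nX)
    (P := ite (.and (.ile (.get b (.sc .vx)) (.const z)) (.ile (.const z) (.get b (.sc .vx))))
      (assign a (.add (.sc a) (.const 1))) skip) (by rw [ha₁.i .nX (by simpa using ha'), hn])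
    (a := a) ha (fun x => if D x = z then 1 else 0) fun x s' hx hc hv => by
      replace hc : Agree [.vx, a] [] (s.setI a 0 0) s' := hc
      have h1 := (hD.agree ha₁ (by simpa using hb)).agree hc (by simp [hb, hb']) x hx
      simp only [run, BX.Holds, IX.eval, hv, h1]
      have : ((D x : ℤ) ≤ z ∧ (z : ℤ) ≤ D x) ↔ D x = z := by omega
      simp only [this]
      split_ifs <;> simp
  refine this.trans ?_
  simp

theorem run_incrProg {t : ℕ} (hN : s.i .N 0 = N) (hd : Holds s .dig N fun i => ternary t i) :
    Holds (incrProg.run s) .dig N fun i => ternary (t + 1) i := by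
  have ha₁ : Agree _ _ s (s.setI .r 0 1) := agree_setI s .r 0 1
  -- The scalar `r` is the carry: it is `1` before position `n` exactly if `3 ^ n` divides `t + 1`.
  -- Positions already passed show the digits of `t + 1`, the others still those of `t`.
  have key : (∀ i < N, (incrProg.run s).i .dig (i : ℕ) =
      if i < N then (ternary (t + 1) i : ℤ) else ternary t i) ∧
      (incrProg.run s).i .r 0 = if 3 ^ N ∣ t + 1 then 1 else 0 := by
    refine run_forTo_inv (s := s.setI .r 0 1) (v := .va) (n := .N) (m := N)
      (P := ite (.ile (.const 1) (.sc .r))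
        (ite (.ile (.get .dig (.sc .va)) (.const 1))
          (block [setI .dig (.sc .va) (.add (.get .dig (.sc .va)) (.const 1)),
            assign .r (.const 0)])
          (setI .dig (.sc .va) (.const 0))) skip)
      (by rw [ha₁.i .N (by decide), hN])
      (fun n s' => (∀ i < N, s'.i .dig (i : ℕ) =
        if i < n then (ternary (t + 1) i : ℤ) else ternary t i) ∧
        s'.i .r 0 = if 3 ^ n ∣ t + 1 then 1 else 0) (fun n s' z h => by simpa using h)
      ⟨fun i hi => by simpa using hd i hi, by simp⟩ fun n s' hn ha hv h => ?_
    obtain ⟨h1, h2⟩ := h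
    have hdig := h1 n hn
    rw [if_neg (lt_irrefl n)] at hdig
    have hupd : ∀ z : ℤ, z = ternary (t + 1) n → ∀ i < N, Function.update (s'.i .dig) n z (i : ℕ) =
        if i < n + 1 then (ternary (t + 1) i : ℤ) else ternary t i := by
      rintro z rfl i hi
      by_cases hin : i = n
      · subst hin; simp
      · rw [Function.update_of_ne (by omega), h1 i hi]
        have : i < n + 1 ↔ i < n := by omega
        simp only [this]
    by_cases hdvd : 3 ^ n ∣ t + 1
    · rw [if_pos hdvd] at h2
      obtain ⟨k1, k2⟩ := ternary_succ_of_dvd hdvd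
      by_cases hle : ternary t n ≤ 1
      · obtain ⟨k3, k4⟩ := k1 hle
        have hle' : (ternary t n : ℤ) ≤ 1 := by exact_mod_cast hle
        simp only [run, BX.Holds, IX.eval, h2, hv, hdig, le_refl, if_true, hle', block]
        refine ⟨fun i hi => ?_, by simp [k4]⟩
        rw [St.setI_i_of_ne _ (by decide), St.setI_i_self]
        exact hupd _ (by rw [k3]; push_cast; ring) i hi
      · obtain ⟨k3, k4⟩ := k2 hle
        have hle' : ¬ (ternary t n : ℤ) ≤ 1 := by exact_mod_cast hle
        simp only [run, BX.Holds, IX.eval, h2, hv, hdig, le_refl, if_true, hle', if_false]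
        refine ⟨fun i hi => ?_, by simp [k4, h2]⟩
        rw [St.setI_i_self]
        exact hupd _ (by rw [k3]; rfl) i hi
    · rw [if_neg hdvd] at h2
      obtain ⟨k3, k4⟩ := ternary_succ_of_not_dvd hdvd
      have : ¬ (1 : ℤ) ≤ 0 := by decide
      simp only [run, BX.Holds, IX.eval, h2, this, if_false]
      refine ⟨fun i hi => ?_, by simp [k4]⟩
      rw [← hupd (s'.i .dig n) (by rw [hdig, k3]) i hi, Function.update_eq_self]
  intro i hi
  rw [key.1 i hi, if_pos hi]

variable [IsStrictOrderedRing R]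

/-- `z` is the value of a nearly optimal matching at `x`. -/
def ValueAt (G : BGraph R) (c : ℕ → ℤ) (δ : R) (x : ℕ) (z : R) : Prop :=
  (∃ M, G.Feas (single x (c x)) M ∧ z = G.val M) ∧
    ∀ M', G.Feas (single x (c x)) M' → G.val M' ≤ z + δ

/-- No matching at `x` exceeds `z + δ`, while `z'` is actually attained at `a`; so comparing
approximate values is enough, at the price of `δ`. -/
theorem ValueAt.exchange {c : ℕ → ℤ} {δ : R} {x a : ℕ} {z z' : R} (hx : ValueAt G c δ x z)
    (ha : ValueAt G c δ a z') (h : z ≤ z') : G.Exchange c δ x a := by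
  intro M hM
  obtain ⟨S, hS, rfl⟩ := ha.1
  exact ⟨S, hS, (hx.2 M hM).trans (by linarith)⟩

/-- The vertices are valued with the larger capacity only. A single ranking must serve both types,
so the exchange property for `c₁` has to be deduced from that for `c₂`. -/
theorem run_valueProg (hε : 0 ≤ ε) (hc : ∀ x < G.nX, 0 ≤ c₂ x)
    (hu : ∀ e < G.nE, 1 ≤ c₂ (G.src e) → G.u e ≤ L * ε) (hE : Env G ε L s)
    (h₂ : Holds s .cap2 G.nX c₂) :
    ∀ x < G.nX, ValueAt G c₂ (G.nY * ε) x ((valueProg.run s).w .F (x : ℕ)) := by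
  refine run_forTo_inv hE.nX (fun n s' => ∀ x < n, ValueAt G c₂ (G.nY * ε) x (s'.w .F (x : ℕ)))
    (fun n s' z h => h) (by simp) fun n s' hn ha hv h => ?_
  set P := forTo .vj .nX (setI .kap (.sc .vj) (.const 0)) with hP
  set s₁ := P.run s' with hs₁
  set s₂ := s₁.setI .kap n (c₂ n) with hs₂
  have ha₁ : Agree _ _ s' s₁ := P.agree_run s'
  have ha₂ : Agree _ _ s₁ s₂ := agree_setI s₁ .kap n (c₂ n)
  have ha₃ : Agree _ _ s₂ (evalProg.run s₂) := evalProg.agree_run s₂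
  have hE' := hE.agree ha (by decide) (by decide)
  have hE₂ := (hE'.agree ha₁ (by decide) (by decide)).agree ha₂ (by decide) (by decide)
  have hk₁ : Holds s₁ .kap G.nX fun _ => 0 :=
    (run_forTo_map hE'.nX (by decide) (fun _ => 0) fun k s' hk ha hv _ => by
      simp [run, IX.eval, hv]).1
  have hvx₁ : s₁.i .vx 0 = n := by rw [ha₁.i .vx (by decide), hv]
  have hvx₃ : (evalProg.run s₂).i .vx 0 = n := by
    rw [ha₃.i .vx (by decide), ha₂.i .vx (by decide), hvx₁]
  have hcap₁ : s₁.i .cap2 n = c₂ n := by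
    rw [ha₁.i .cap2 (by decide), ha.i .cap2 (by decide), h₂ n hn]
  have hrun : (block [P, setI .kap (.sc .vx) (.get .cap2 (.sc .vx)), evalProg,
      setW .F (.sc .vx) (.sc .val)]).run s' =
      (evalProg.run s₂).setW .F n ((evalProg.run s₂).w .val 0) := by
    have : (setI .kap (.sc .vx) (.get .cap2 (.sc .vx))).run s₁ = s₂ := by
      simp only [run, IX.eval, hvx₁, hcap₁, hs₂]
    simp only [block]
    rw [run, run, ← hs₁, this, run]
    simp only [run, IX.eval, WX.eval, hvx₃]
  have hk₂ : Holds s₂ .kap G.nX (single n (c₂ n)) := by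
    intro x hx
    by_cases hxn : x = n
    · subst hxn; simp [hs₂, single]
    · rw [hs₂, St.setI_i_self, Function.update_of_ne (by omega), hk₁ x hx]
      simp [single, hxn]
  obtain ⟨M, hM, hopt, hval, _⟩ := run_evalProg (κ := single n (c₂ n)) hε
    (fun x hx => by unfold single; split_ifs; exacts [hc n hn, le_rfl])
    (fun e he h1 => hu e he (by
      unfold single at h1
      split_ifs at h1 with h2
      · rwa [h2]
      · omega)) hE₂ hk₂
  rw [hrun, hval]
  intro x hx
  rw [St.setW_w_self]
  rcases Nat.lt_succ_iff_lt_or_eq.1 hx with hx | rfl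
  · rw [Function.update_of_ne (by omega), ha₃.w .F (by decide), ha₂.w .F (by decide),
      ha₁.w .F (by decide)]
    exact h x hx
  · rw [Function.update_self]
    exact ⟨⟨M, hM, rfl⟩, hopt⟩

/-- The state holds an admissible matching and its value. -/
def BestInv (G : BGraph R) (K₁ K₂ : ℕ) (c₁ c₂ : ℕ → ℤ) (s : St R) : Prop :=
  ∃ D M, Adm G.nX K₁ K₂ D ∧ (∀ x, D x ≤ 2) ∧ G.Feas (capD c₁ c₂ D) M ∧ s.w .bestVal 0 = G.val M ∧
    0 ≤ s.w .bestVal 0 ∧ (Holds s .best G.nE fun e => if e ∈ M then 1 else 0) ∧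
    Holds s .bestD G.nX fun x => D x

omit [LinearOrder R] [IsStrictOrderedRing R] in
theorem BestInv.agree [LinearOrder R] {s' : St R} {A : List IName} {V : List WName}
    (h : BestInv G K₁ K₂ c₁ c₂ s) (ha : Agree A V s s') (h1 : .best ∉ A) (h2 : .bestD ∉ A)
    (h3 : .bestVal ∉ V) : BestInv G K₁ K₂ c₁ c₂ s' := by
  obtain ⟨D, M, a1, a2, a3, a4, a5, a6, a7⟩ := h
  refine ⟨D, M, a1, a2, a3, ?_, ?_, a6.agree ha h1, a7.agree ha h2⟩
  · rw [ha.w _ h3, a4]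
  · rwa [ha.w _ h3]

-- The counts `c1` and `c2` reject the choices of types that exceed `K₁` or `K₂`, so the enumeration
-- may run through all ternary patterns.
omit [IsStrictOrderedRing R] in
theorem run_storeProg {D : ℕ → ℕ} {M : Finset ℕ} (hE : Env G ε L s)
    (h1 : s.i .K1 0 = K₁) (h2 : s.i .K2 0 = K₂)
    (hc1 : s.i .c1 0 = ((range G.nX).filter fun x => D x = 1).card)
    (hc2 : s.i .c2 0 = ((range G.nX).filter fun x => D x = 2).card)
    (hD : Holds s .typ G.nX fun x => D x) (hD2 : ∀ x, D x ≤ 2) (hM : G.Feas (capD c₁ c₂ D) M)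
    (hval : s.w .val 0 = G.val M) (hasg : ∀ e < G.nE, 1 ≤ s.i .asg (e : ℕ) ↔ e ∈ M)
    (hb : BestInv G K₁ K₂ c₁ c₂ s) :
    BestInv G K₁ K₂ c₁ c₂ (storeProg.run s) ∧ s.w .bestVal 0 ≤ (storeProg.run s).w .bestVal 0 ∧
      (Adm G.nX K₁ K₂ D → G.val M ≤ (storeProg.run s).w .bestVal 0) := by
  have hb0 : 0 ≤ s.w .bestVal 0 := by
    obtain ⟨_, _, _, _, _, _, h, _⟩ := hb
    exact h
  by_cases hc : (BX.and (.and (.ile (.sc .c1) (.sc .K1)) (.ile (.sc .c2) (.sc .K2)))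
      (.not (.wle (.sc .val) (.sc .bestVal)))).Holds s
  · have hc' := hc
    simp only [BX.Holds, IX.eval, WX.eval, h1, h2, hc1, hc2, hval, not_le, Nat.cast_le] at hc'
    set P₁ := forTo .ve .nE (ite (.ile (.const 1) (.get .asg (.sc .ve)))
        (setI .best (.sc .ve) (.const 1)) (setI .best (.sc .ve) (.const 0))) with hP₁
    set P₂ := forTo .vx .nX (setI .bestD (.sc .vx) (.get .typ (.sc .vx))) with hP₂
    set s₁ := s.setW .bestVal 0 (G.val M) with hs₁
    have ha₁ : Agree _ _ s s₁ := agree_setW s .bestVal 0 _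
    have ha₂ : Agree _ _ s₁ (P₁.run s₁) := P₁.agree_run s₁
    have ha₃ : Agree _ _ (P₁.run s₁) (P₂.run (P₁.run s₁)) := P₂.agree_run _
    have hE₁ := hE.agree ha₁ (by decide) (by decide)
    have hE₂ := hE₁.agree ha₂ (by decide) (by decide)
    have hrun : storeProg.run s = P₂.run (P₁.run s₁) := by
      rw [storeProg, run, if_pos hc, hs₁, ← hval]
      rfl
    have hbv : (P₂.run (P₁.run s₁)).w .bestVal 0 = G.val M := by
      rw [ha₃.w .bestVal (by decide), ha₂.w .bestVal (by decide)]
      simp [hs₁]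
    have hbest : Holds (P₁.run s₁) .best G.nE fun e => if e ∈ M then 1 else 0 := by
      refine (run_forTo_map hE₁.nE (by decide) (fun e => if e ∈ M then 1 else 0)
        fun e s' he ha hv _ => ?_).1
      have := hasg e he
      rw [← ha₁.i .asg (by decide), ← ha.i .asg (by decide)] at this
      simp only [run, BX.Holds, IX.eval, hv, this]
      split_ifs <;> simp
    have hbD : Holds (P₂.run (P₁.run s₁)) .bestD G.nX fun x => D x := by
      refine (run_forTo_map hE₂.nX (by decide) (fun x => (D x : ℤ)) fun x s' hx ha hv _ => ?_).1
      have := ((hD.agree ha₁ (by decide)).agree ha₂ (by decide)).agree ha (by decide) x hx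
      simp [run, IX.eval, hv, this]
    rw [hrun]
    refine ⟨⟨D, M, ⟨hc'.1.1, hc'.1.2⟩, hD2, hM, hbv, ?_, hbest.agree ha₃ (by decide), hbD⟩, ?_,
      fun _ => hbv.ge⟩
    · rw [hbv]; exact hb0.trans hc'.2.le
    · rw [hbv]; exact hc'.2.le
  · have hrun : storeProg.run s = s := by
      rw [storeProg, run, if_neg hc]
      rfl
    rw [hrun]
    refine ⟨hb, le_rfl, fun hadm => ?_⟩
    by_contra hlt
    refine hc ?_
    simp only [BX.Holds, IX.eval, WX.eval, h1, h2, hc1, hc2, hval, Nat.cast_le]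
    exact ⟨⟨hadm.one, hadm.two⟩, hlt⟩

/-- The state holds the data that are fixed during the enumeration. -/
structure EnumEnv (G : BGraph R) (ε : R) (L N K₁ K₂ : ℕ) (c₁ c₂ : ℕ → ℤ) (rank : ℕ → ℕ) (s : St R) :
    Prop where
  env : Env G ε L s
  N : s.i .N 0 = N
  K1 : s.i .K1 0 = K₁
  K2 : s.i .K2 0 = K₂
  cap1 : Holds s .cap1 G.nX c₁
  cap2 : Holds s .cap2 G.nX c₂
  rank : Holds s .rank G.nX fun x => rank x

omit [CommRing R] [LinearOrder R] [IsStrictOrderedRing R] in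
theorem EnumEnv.agree {s' : St R} {A : List IName} {V : List WName} {rank : ℕ → ℕ}
    (h : EnumEnv G ε L N K₁ K₂ c₁ c₂ rank s) (ha : Agree A V s s')
    (hA : ∀ a ∈ [IName.nX, .nY, .nE, .src, .dst, .base, .L], a ∉ A)
    (hA' : ∀ a ∈ [IName.N, .K1, .K2, .cap1, .cap2, .rank], a ∉ A)
    (hV : ∀ b ∈ [WName.u, .eps], b ∉ V) : EnumEnv G ε L N K₁ K₂ c₁ c₂ rank s' := by
  simp only [List.mem_cons, List.not_mem_nil, or_false, forall_eq_or_imp, forall_eq] at hA'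
  obtain ⟨a1, a2, a3, a4, a5, a6⟩ := hA'
  refine ⟨h.env.agree ha hA hV, ?_, ?_, ?_, h.cap1.agree ha a4, h.cap2.agree ha a5,
    h.rank.agree ha a6⟩
  · rw [ha.i _ a1, h.N]
  · rw [ha.i _ a2, h.K1]
  · rw [ha.i _ a3, h.K2]

/-- The invariant of the enumeration after `t` choices. -/
def EnumInv (G : BGraph R) (ε : R) (N K₁ K₂ : ℕ) (c₁ c₂ : ℕ → ℤ) (rank : ℕ → ℕ) (t : ℕ)
    (s : St R) : Prop :=
  (Holds s .dig N fun i => ternary t i) ∧ BestInv G K₁ K₂ c₁ c₂ s ∧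
    ∀ t' < t, Adm G.nX K₁ K₂ (typOf rank N t') →
      ∀ M, G.Feas (capD c₁ c₂ (typOf rank N t')) M → G.val M ≤ s.w .bestVal 0 + G.nY * ε

theorem run_tryProg {rank : ℕ → ℕ} {t : ℕ} (hε : 0 ≤ ε) (h1 : ∀ x < G.nX, 0 ≤ c₁ x)
    (h12 : ∀ x < G.nX, c₁ x ≤ c₂ x) (hu : ∀ e < G.nE, 1 ≤ c₂ (G.src e) → G.u e ≤ L * ε)
    (hE : EnumEnv G ε L N K₁ K₂ c₁ c₂ rank s) (h : EnumInv G ε N K₁ K₂ c₁ c₂ rank t s) :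
    EnumInv G ε N K₁ K₂ c₁ c₂ rank (t + 1) (tryProg.run s) := by
  obtain ⟨hdig, hbest, hall⟩ := h
  set D := typOf rank N t with hDdef
  have hD2 : ∀ x, D x ≤ 2 := typOf_le rank N t
  set s₁ := typProg.run s with hs₁
  set s₂ := kapProg.run s₁ with hs₂
  set s₃ := (countProg .typ .c1 1).run s₂ with hs₃
  set s₄ := (countProg .typ .c2 2).run s₃ with hs₄
  set s₅ := evalProg.run s₄ with hs₅
  set s₆ := storeProg.run s₅ with hs₆
  have hrun : tryProg.run s = incrProg.run s₆ := rfl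
  have a1 : Agree _ _ s s₁ := typProg.agree_run s
  have a2 : Agree _ _ s₁ s₂ := kapProg.agree_run s₁
  have a3 : Agree _ _ s₂ s₃ := (countProg .typ .c1 1).agree_run s₂
  have a4 : Agree _ _ s₃ s₄ := (countProg .typ .c2 2).agree_run s₃
  have a5 : Agree _ _ s₄ s₅ := evalProg.agree_run s₄
  have a6 : Agree _ _ s₅ s₆ := storeProg.agree_run s₅
  have a7 : Agree _ _ s₆ (incrProg.run s₆) := incrProg.agree_run s₆
  have E1 := hE.agree a1 (by decide) (by decide) (by decide)
  have E2 := E1.agree a2 (by decide) (by decide) (by decide)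
  have E3 := E2.agree a3 (by decide) (by decide) (by decide)
  have E4 := E3.agree a4 (by decide) (by decide) (by decide)
  have E5 := E4.agree a5 (by decide) (by decide) (by decide)
  have E6 := E5.agree a6 (by decide) (by decide) (by decide)
  have t1 : Holds s₁ .typ G.nX fun x => D x := run_typProg hE.env hE.N hE.rank hdig
  have k2 : Holds s₂ .kap G.nX (capD c₁ c₂ D) := run_kapProg E1.env E1.cap1 E1.cap2 t1 hD2
  have t2 := t1.agree a2 (by decide)
  have n3 : s₃.i .c1 0 = _ := run_countProg 1 E2.env.nX (by decide) (by decide) (by decide)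
    (by decide) t2
  have t3 := t2.agree a3 (by decide)
  have n4 : s₄.i .c2 0 = _ := run_countProg 2 E3.env.nX (by decide) (by decide) (by decide)
    (by decide) t3
  have t5 := (t3.agree a4 (by decide)).agree a5 (by decide)
  have k4 := (k2.agree a3 (by decide)).agree a4 (by decide)
  have h2 : ∀ x < G.nX, 0 ≤ c₂ x := fun x hx => (h1 x hx).trans (h12 x hx)
  -- A positive capacity under any choice of types forces `1 ≤ c₂`, since `c₁ ≤ c₂`; hence the bound
  -- `L * ε` covers every edge that the auction can use.
  obtain ⟨M, hM, hopt, hval, hasg⟩ := run_evalProg hε (BGraph.capD_nonneg h1 h2 D)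
    (fun e he h3 => hu e he (h3.trans (by
      have := h12 _ (G.src_lt e he)
      have := h2 _ (G.src_lt e he)
      unfold capD
      split_ifs <;> omega))) E4.env k4
  have b5 : BestInv G K₁ K₂ c₁ c₂ s₅ := ((((hbest.agree a1 (by decide) (by decide)
    (by decide)).agree a2 (by decide) (by decide) (by decide)).agree a3 (by decide) (by decide)
    (by decide)).agree a4 (by decide) (by decide) (by decide)).agree a5 (by decide) (by decide)
    (by decide)
  have bv : s₅.w .bestVal 0 = s.w .bestVal 0 := by
    rw [a5.w .bestVal (by decide), a4.w .bestVal (by decide), a3.w .bestVal (by decide),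
      a2.w .bestVal (by decide), a1.w .bestVal (by decide)]
  obtain ⟨b6, m1, m2⟩ := run_storeProg E5.env E5.K1 E5.K2
    (by rw [a5.i .c1 (by decide), a4.i .c1 (by decide), n3])
    (by rw [a5.i .c2 (by decide), n4]) t5 hD2 hM hval hasg b5
  have d6 := (((((hdig.agree a1 (by decide)).agree a2 (by decide)).agree a3 (by decide)).agree a4
    (by decide)).agree a5 (by decide)).agree a6 (by decide)
  rw [hrun]
  refine ⟨run_incrProg E6.N d6, b6.agree a7 (by decide) (by decide) (by decide),
    fun t' ht' hadm M' hM' => ?_⟩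
  rw [a7.w .bestVal (by decide)]
  rcases Nat.lt_succ_iff_lt_or_eq.1 ht' with ht' | rfl
  · have := hall t' ht' hadm M' hM'
    rw [← bv] at this
    linarith
  · have := hopt M' hM'
    have := m2 hadm
    linarith

theorem run_enumProg {rank : ℕ → ℕ} (hε : 0 ≤ ε) (h1 : ∀ x < G.nX, 0 ≤ c₁ x)
    (h12 : ∀ x < G.nX, c₁ x ≤ c₂ x) (hu : ∀ e < G.nE, 1 ≤ c₂ (G.src e) → G.u e ≤ L * ε)
    (hE : EnumEnv G ε L N K₁ K₂ c₁ c₂ rank s) (hpow : s.i .pow 0 = (3 ^ N : ℕ))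
    (hbest : Holds s .best G.nE fun _ => 0) (hbestD : Holds s .bestD G.nX fun _ => 0) :
    EnumInv G ε N K₁ K₂ c₁ c₂ rank (3 ^ N) (enumProg.run s) := by
  set s₁ := s.setW .bestVal 0 0 with hs₁
  set P := forTo .va .N (setI .dig (.sc .va) (.const 0)) with hP
  set s₂ := P.run s₁ with hs₂
  have hrun : enumProg.run s = (forTo .vt .pow tryProg).run s₂ := rfl
  have a1 : Agree _ _ s s₁ := agree_setW s .bestVal 0 0
  have a2 : Agree _ _ s₁ s₂ := P.agree_run s₁
  have E1 := hE.agree a1 (by decide) (by decide) (by decide)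
  have E2 := E1.agree a2 (by decide) (by decide) (by decide)
  have hdig : Holds s₂ .dig N fun _ => 0 :=
    (run_forTo_map E1.N (by decide) (fun _ => 0) fun k s' hk ha hv _ => by
      simp [run, IX.eval, hv]).1
  have hbv : s₂.w .bestVal 0 = 0 := by
    rw [a2.w .bestVal (by decide)]
    simp [hs₁]
  rw [hrun]
  refine run_forTo_inv (m := 3 ^ N) (by rw [a2.i .pow (by decide), a1.i .pow (by decide), hpow])
    (EnumInv G ε N K₁ K₂ c₁ c₂ rank) (fun t s' z h => ?_) ⟨?_, ?_, by simp⟩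
    fun t s' _ ha hv h => ?_
  · have a := agree_setI s' .vt 0 z
    exact ⟨h.1.agree a (by decide), h.2.1.agree a (by decide) (by decide) (by decide), h.2.2⟩
  · intro i hi
    rw [hdig i hi]
    simp [ternary]
  -- The initial record is the empty matching with all vertices closed; it matches the zero cells of
  -- `best` and `bestD`, which are still untouched.
  · refine ⟨fun _ => 0, ∅, ⟨by simp, by simp⟩, by simp, ?_, ?_, hbv.ge, ?_, ?_⟩
    · exact BGraph.feas_empty fun x _ => by simp [capD]
    · simp [hbv, BGraph.val]
    · simpa using (hbest.agree a1 (by decide)).agree a2 (by decide)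
    · exact (hbestD.agree a1 (by decide)).agree a2 (by decide)
  · exact run_tryProg hε h1 h12 hu (E2.agree ha (by decide) (by decide) (by decide)) h

end

/-! ### Correctness of the approximation algorithm -/

section

variable {R : Type} [CommRing R] {G : BGraph R}

theorem BGraph.feas_scale {L : ℕ} {κ : ℕ → ℤ} {M : Finset ℕ} :
    (G.scale L).Feas κ M ↔ G.Feas κ M :=
  ⟨fun h => ⟨h.lt, h.load, h.inj⟩, fun h => ⟨h.lt, h.load, h.inj⟩⟩

theorem BGraph.val_scale (L : ℕ) (M : Finset ℕ) : (G.scale L).val M = L * G.val M := by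
  simp [BGraph.val, BGraph.scale, mul_sum]

omit [CommRing R] in
theorem BGraph.feas_singleton {κ : ℕ → ℤ} (h0 : ∀ x < G.nX, 0 ≤ κ x) {e : ℕ} (he : e < G.nE)
    (h : 1 ≤ κ (G.src e)) : G.Feas κ {e} where
  lt := by simpa using he
  load x hx := by
    by_cases hxe : G.src e = x
    · subst hxe
      simpa [filter_singleton] using h
    · simpa [filter_singleton, hxe] using h0 x hx
  inj := by simp

variable [LinearOrder R] [IsStrictOrderedRing R] {s : St R} {K₁ K₂ p : ℕ} {c₁ c₂ : ℕ → ℤ}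

/-- The specification of `mainProg`. -/
theorem run_mainProg {q : ℕ} (hq : 1 ≤ q) (h : CoreEnv G K₁ K₂ p c₁ c₂ s)
    (hL : s.i .L 0 = Lval q (K₁ + K₂) G.nY) (hN : s.i .N 0 = Nval q (K₁ + K₂) p)
    (hbase : ∀ x < G.nX, s.i .base (x : ℕ) = x * G.nY)
    (hpow : s.i .pow 0 = (3 ^ Nval q (K₁ + K₂) p : ℕ))
    (hbest : Holds s .best G.nE fun _ => 0) (hbestD : Holds s .bestD G.nX fun _ => 0)
    (hdeg : ∀ y, ((range G.nE).filter fun e => G.dst e = y).card ≤ p)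
    (h1 : ∀ x < G.nX, 0 ≤ c₁ x) (h12 : ∀ x < G.nX, c₁ x ≤ c₂ x)
    (hex : ∀ L x a δ, x < G.nX → a < G.nX → 0 ≤ δ → (G.scale L).Exchange c₂ δ x a →
      (G.scale L).Exchange c₁ δ x a) :
    ∃ D M, Adm G.nX K₁ K₂ D ∧ (∀ x, D x ≤ 2) ∧ G.Feas (capD c₁ c₂ D) M ∧ 0 ≤ G.val M ∧
      (Holds (mainProg.run s) .best G.nE fun e => if e ∈ M then 1 else 0) ∧
      (Holds (mainProg.run s) .bestD G.nX fun x => D x) ∧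
      ((∀ e < G.nE, 1 ≤ c₂ (G.src e) → ∃ D, Adm G.nX K₁ K₂ D ∧ G.Feas (capD c₁ c₂ D) {e}) →
        ∀ D' M', Adm G.nX K₁ K₂ D' → G.Feas (capD c₁ c₂ D') M' →
          ((q : R) - 1) * G.val M' ≤ q * G.val M) := by
  have h2 : ∀ x < G.nX, 0 ≤ c₂ x := fun x hx => (h1 x hx).trans (h12 x hx)
  obtain ⟨ε, hE, hε, hmax, hatt⟩ := run_weightProg h hL hbase
  set L := Lval q (K₁ + K₂) G.nY with hLdef
  set N := Nval q (K₁ + K₂) p with hNdef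
  have hLpos : (0 : R) < L := by exact_mod_cast (by simp [hLdef, Lval] : 0 < L)
  set G' := G.scale L with hG'
  set s₁ := weightProg.run s with hs₁
  set s₂ := valueProg.run s₁ with hs₂
  set s₃ := rankProg.run s₂ with hs₃
  have hrun : mainProg.run s = enumProg.run s₃ := rfl
  have a1 : Agree _ _ s s₁ := weightProg.agree_run s
  have a2 : Agree _ _ s₁ s₂ := valueProg.agree_run s₁
  have a3 : Agree _ _ s₂ s₃ := rankProg.agree_run s₂
  have C1 := h.agree a1 (by decide) (by decide)
  have C2 := C1.agree a2 (by decide) (by decide)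
  have C3 := C2.agree a3 (by decide) (by decide)
  have E2 := hE.agree a2 (by decide) (by decide)
  have E3 := E2.agree a3 (by decide) (by decide)
  have hu : ∀ e < G'.nE, 1 ≤ c₂ (G'.src e) → G'.u e ≤ L * ε := fun e he hc =>
    mul_le_mul_of_nonneg_left (hmax e he hc) hLpos.le
  have hF := run_valueProg (G := G') hε h2 hu hE C1.cap2
  set F : ℕ → R := fun x => s₂.w .F (x : ℕ) with hFdef
  have hrank := run_rankProg (F := F) E2 fun x _ => rfl
  have hN3 : s₃.i .N 0 = N := by
    rw [a3.i .N (by decide), a2.i .N (by decide), a1.i .N (by decide), hN]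
  obtain ⟨-, ⟨D, M, hD, hD2, hM, hbv, hbv0, hbest', hbestD'⟩, hall⟩ := run_enumProg (G := G')
    (K₁ := K₁) (K₂ := K₂) (c₁ := c₁) (c₂ := c₂) (N := N) hε h1 h12 hu
    ⟨E3, hN3, C3.K1, C3.K2, C3.cap1, C3.cap2, hrank⟩
    (by rw [a3.i .pow (by decide), a2.i .pow (by decide), a1.i .pow (by decide), hpow])
    (((hbest.agree a1 (by decide)).agree a2 (by decide)).agree a3 (by decide))
    (((hbestD.agree a1 (by decide)).agree a2 (by decide)).agree a3 (by decide))
  rw [hbv, hG', BGraph.val_scale] at hbv0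
  refine ⟨D, M, hD, hD2, BGraph.feas_scale.1 hM, nonneg_of_mul_nonneg_right hbv0 hLpos,
    hbest', hbestD', fun hne D' M' hD' hM' => ?_⟩
  have hδ : (0 : R) ≤ G'.nY * ε := mul_nonneg (Nat.cast_nonneg _) hε
  -- The ranking compares computed values, each correct up to `nY * ε`, so every vertex of the top
  -- set can stand in for every vertex outside it.
  have hex2 : ∀ x < G'.nX, x ∉ topSet F G'.nX N → ∀ a ∈ topSet F G'.nX N,
      G'.Exchange c₂ (G'.nY * ε) x a := fun x hx hxA a ha =>
    (hF x hx).exchange (hF a (mem_range.1 (mem_filter.1 ha).1)) (le_of_mem_topSet hx hxA ha)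
  have key := BGraph.approx_of_supported (G := G') (K₁ := K₁) (K₂ := K₂) (c₁ := c₁) (c₂ := c₂)
    (δ := G'.nY * ε) (b := G'.val M) (q := q) (p := p) (A := topSet F G'.nX N)
    (n₀ := 1 + 2 * q * (K₁ + K₂) * p) h1 h2 hδ hq (filter_subset _ _) rfl
    (by
      have : K₁ + K₂ + (1 + 2 * q * (K₁ + K₂) * p) = N := by rw [hNdef, Nval]; ring
      rw [this]
      exact card_topSet)
    hdeg
    (fun x hx hxA a ha => hex L x a _ hx (mem_range.1 (mem_filter.1 ha).1) hδ (hex2 x hx hxA a ha))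
    hex2
    (fun D₁ M₁ hD₁ hs₁ hM₁ => by
      obtain ⟨t, ht, hiff⟩ := exists_typOf hs₁
      rw [← hbv]
      refine hall t ht (hD₁.congr hiff) M₁ (hM₁.mono fun x hx => le_of_eq ?_)
      simp only [capD, (hiff x hx).1, (hiff x hx).2])
    (by
      -- `L` exceeds `2 * q * (k + 1) * nY`, so a solution of scaled value `L * ε` dominates all
      -- additive errors.
      have hLε : 2 * (q : R) * (K₁ + K₂ + 1) * (G'.nY * ε) ≤ L * ε := by
        have : (L : R) = 1 + G'.nY * (2 * q * (K₁ + K₂ + 1)) := by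
          rw [hLdef, Lval]; push_cast; rfl
        rw [this]
        linarith
      -- If `ε = 0` there is no additive error and the empty matching will do. Otherwise the single
      -- edge that attains `ε` has scaled value `L * ε`.
      rcases hatt with h0 | ⟨e, he, hc, rfl⟩
      · refine ⟨D, ∅, hD, BGraph.feas_empty (BGraph.capD_nonneg h1 h2 D), hLε.trans ?_⟩
        simp [h0, BGraph.val]
      · obtain ⟨D₁, hD₁, hM₁⟩ := hne e he hc
        refine ⟨D₁, {e}, hD₁, BGraph.feas_scale.2 hM₁, hLε.trans ?_⟩
        rw [hG', BGraph.val_scale]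
        simp [BGraph.val])
    hD' (BGraph.feas_scale.2 hM')
  rw [hG', BGraph.val_scale, BGraph.val_scale] at key
  refine le_of_mul_le_mul_left ?_ hLpos
  linarith

end

/-! # Sequences of programs and their running time -/

section

variable {R : Type} [CommRing R] [LinearOrder R]

/-- The state after a sequence of programs. -/
noncomputable def runAll : List FProg → St R → St R
  | [], s => s
  | P :: l, s => runAll l (P.run s)

/-- All loop bounds are at most `B` when they are used. -/
def BoundedAll (B : ℕ) : List FProg → St R → Prop
  | [], _ => True
  | P :: l, s => (∀ b ∈ P.bnds, s.i b 0 ≤ B) ∧ BoundedAll B l (P.run s)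

/-- No loop changes its own counter and no program of the sequence changes its loop bounds. -/
def okAll (l : List FProg) : Prop := ∀ P ∈ l, P.ok = true ∧ ∀ b ∈ P.bnds, b ∉ P.iw

namespace Backend

variable (β : Backend R)

def compileAll : List FProg → RAMProgram
  | [] => .skip
  | P :: l => .seq (β.compile P) (compileAll l)

/-- No program may write its own loop bounds, yet `L`, `N` and `pow` have to be computed before they
bound loops; hence the split into several programs, each with its bounds checked in the state where
it starts. The constants `c` and `d` depend on the programs alone. -/
theorem exec_compileAll (l : List FProg) (hl : okAll l) : ∃ c d : ℕ, ∀ (B : ℕ) (r : RAMState),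
    BoundedAll B l (β.abs r) → ∃ t r', Exec (β.compileAll l) r t r' ∧
      β.abs r' = runAll l (β.abs r) ∧ t ≤ c * (B + 1) ^ d := by
  induction l with
  | nil => exact ⟨1, 0, fun B r _ => ⟨1, r, .skip r, rfl, by simp⟩⟩
  | cons P l ih =>
    obtain ⟨c, d, h⟩ := ih fun Q hQ => hl Q (List.mem_cons_of_mem _ hQ)
    obtain ⟨hok, hb⟩ := hl P (by simp)
    refine ⟨β.coef P + c, P.depth + d, fun B r hB => ?_⟩
    obtain ⟨t, r', he, hr', ht⟩ := β.exec_compile B P hok r fun b hbP => ⟨hb b hbP, hB.1 b hbP⟩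
    obtain ⟨t', r'', he', hr'', ht'⟩ := h B r' (by rw [hr']; exact hB.2)
    refine ⟨_, r'', .seq he he', by rw [hr'', hr']; rfl, ?_⟩
    have h1 : (B + 1) ^ P.depth ≤ (B + 1) ^ (P.depth + d) :=
      Nat.pow_le_pow_right (by omega) (by omega)
    have h2 : (B + 1) ^ d ≤ (B + 1) ^ (P.depth + d) :=
      Nat.pow_le_pow_right (by omega) (by omega)
    rw [add_mul]
    exact add_le_add (ht.trans (Nat.mul_le_mul_left _ h1)) (ht'.trans (Nat.mul_le_mul_left _ h2))

end Backend

theorem runAll_append (l l' : List FProg) (s : St R) :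
    runAll (l ++ l') s = runAll l' (runAll l s) := by
  induction l generalizing s with
  | nil => rfl
  | cons P l ih => exact ih _

theorem BoundedAll.append {B : ℕ} {l l' : List FProg} {s : St R} (h : BoundedAll B l s)
    (h' : BoundedAll B l' (runAll l s)) : BoundedAll B (l ++ l') s := by
  induction l generalizing s with
  | nil => exact h'
  | cons P l ih => exact ⟨h.1, ih h.2 h'⟩

/-- The programs that solve an instance in the common input format. -/
def corePhases (q : ℕ) : List FProg := [paramProg q, powProg, mainProg]

theorem okAll_corePhases (q : ℕ) : okAll (corePhases q) := by
  intro P hP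
  simp only [corePhases, List.mem_cons, List.not_mem_nil, or_false] at hP
  rcases hP with rfl | rfl | rfl
  · refine ⟨rfl, ?_⟩
    have h1 : (paramProg q).bnds = [.nY, .K, .p, .K, .nX] := rfl
    have h2 : (paramProg q).iw = [.L, .va, .L, .vb, .L, .N, .va, .vb, .N, .base, .va, .base] := rfl
    rw [h1, h2]
    decide
  · decide
  · decide

theorem agree_corePhases (q : ℕ) (s : St R) :
    Agree ([.L, .va, .L, .vb, .L, .N, .va, .vb, .N, .base, .va, .base] ++ powProg.iw ++ mainProg.iw)
      (powProg.ww ++ mainProg.ww) s (runAll (corePhases q) s) := by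
  have h1 : Agree [.L, .va, .L, .vb, .L, .N, .va, .vb, .N, .base, .va, .base] [] s
    ((paramProg q).run s) := (paramProg q).agree_run s
  have h2 := powProg.agree_run ((paramProg q).run s)
  have h3 := mainProg.agree_run (powProg.run ((paramProg q).run s))
  exact ((h1.mono (fun a ha => by simp only [List.mem_append]; tauto) (List.nil_subset _)).trans
    (h2.mono (fun a ha => by simp only [List.mem_append]; tauto) (List.subset_append_left _ _))).trans
    (h3.mono (List.subset_append_right _ _) (List.subset_append_right _ _))

section

variable {G : BGraph R} {K₁ K₂ p : ℕ} {c₁ c₂ : ℕ → ℤ} {s : St R}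

/-- The state before `mainProg`. -/
theorem CoreEnv.prepared (q : ℕ) (h : CoreEnv G K₁ K₂ p c₁ c₂ s) :
    Agree [.L, .va, .vb, .N, .base, .pow] [] s (powProg.run ((paramProg q).run s)) ∧
    (powProg.run ((paramProg q).run s)).i .L 0 = Lval q (K₁ + K₂) G.nY ∧
    (powProg.run ((paramProg q).run s)).i .N 0 = Nval q (K₁ + K₂) p ∧
    (∀ x < G.nX, (powProg.run ((paramProg q).run s)).i .base (x : ℕ) = x * G.nY) ∧
    (powProg.run ((paramProg q).run s)).i .pow 0 = (3 ^ Nval q (K₁ + K₂) p : ℕ) := by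
  have h1 : Agree [.L, .va, .L, .vb, .L, .N, .va, .vb, .N, .base, .va, .base] [] s
    ((paramProg q).run s) := (paramProg q).agree_run s
  have h2 := powProg.agree_run ((paramProg q).run s)
  obtain ⟨e1, e2, e3⟩ := run_paramProg q h
  refine ⟨(h1.mono (by decide) (by decide)).trans (h2.mono (by decide) (by decide)), ?_, ?_, ?_,
    run_powProg e2⟩
  · rw [h2.i .L (by decide), e1]
  · rw [h2.i .N (by decide), e2]
  · rw [h2.i .base (by decide)]
    exact e3

theorem CoreEnv.boundedAll {q B : ℕ} (h : CoreEnv G K₁ K₂ p c₁ c₂ s) (hX : G.nX ≤ B)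
    (hY : G.nY ≤ B) (hE : G.nE ≤ B) (hK : K₁ + K₂ ≤ B) (hp : p ≤ B)
    (hL : Lval q (K₁ + K₂) G.nY ≤ B) (hN : Nval q (K₁ + K₂) p ≤ B)
    (hpow : 3 ^ Nval q (K₁ + K₂) p ≤ B) : BoundedAll B (corePhases q) s := by
  obtain ⟨a, e1, e2, _, e4⟩ := h.prepared q
  have h' := h.agree a (by decide) (by decide)
  have e2' := (run_paramProg q h).2.1
  refine ⟨fun b hb => ?_, fun b hb => ?_, fun b hb => ?_, trivial⟩
  · have h1 : (paramProg q).bnds = [.nY, .K, .p, .K, .nX] := rfl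
    rw [h1] at hb
    simp only [List.mem_cons, List.not_mem_nil, or_false] at hb
    rcases hb with rfl | rfl | rfl | rfl | rfl
    · rw [h.nY]; exact_mod_cast hY
    · rw [h.K]; exact_mod_cast hK
    · rw [h.p]; exact_mod_cast hp
    · rw [h.K]; exact_mod_cast hK
    · rw [h.nX]; exact_mod_cast hX
  · have h1 : powProg.bnds = [.N] := rfl
    rw [h1, List.mem_singleton] at hb
    rw [hb, e2']
    exact_mod_cast hN
  · have h1 : mainProg.bnds ⊆ [.nX, .nY, .nE, .L, .N, .pow] := by decide
    have hb' := h1 hb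
    simp only [List.mem_cons, List.not_mem_nil, or_false] at hb'
    rcases hb' with rfl | rfl | rfl | rfl | rfl | rfl
    · rw [h'.nX]; exact_mod_cast hX
    · rw [h'.nY]; exact_mod_cast hY
    · rw [h'.nE]; exact_mod_cast hE
    · rw [e1]; exact_mod_cast hL
    · rw [e2]; exact_mod_cast hN
    · rw [e4]; exact_mod_cast hpow

/-- The specification of `corePhases`. -/
theorem CoreEnv.runAll_corePhases [IsStrictOrderedRing R] {q : ℕ} (hq : 1 ≤ q)
    (h : CoreEnv G K₁ K₂ p c₁ c₂ s)
    (hbest : Holds s .best G.nE fun _ => 0) (hbestD : Holds s .bestD G.nX fun _ => 0)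
    (hdeg : ∀ y, ((range G.nE).filter fun e => G.dst e = y).card ≤ p)
    (h1 : ∀ x < G.nX, 0 ≤ c₁ x) (h12 : ∀ x < G.nX, c₁ x ≤ c₂ x)
    (hex : ∀ L x a δ, x < G.nX → a < G.nX → 0 ≤ δ → (G.scale L).Exchange c₂ δ x a →
      (G.scale L).Exchange c₁ δ x a) :
    ∃ D M, Adm G.nX K₁ K₂ D ∧ (∀ x, D x ≤ 2) ∧ G.Feas (capD c₁ c₂ D) M ∧ 0 ≤ G.val M ∧
      (Holds (runAll (corePhases q) s) .best G.nE fun e => if e ∈ M then 1 else 0) ∧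
      (Holds (runAll (corePhases q) s) .bestD G.nX fun x => D x) ∧
      ((∀ e < G.nE, 1 ≤ c₂ (G.src e) → ∃ D, Adm G.nX K₁ K₂ D ∧ G.Feas (capD c₁ c₂ D) {e}) →
        ∀ D' M', Adm G.nX K₁ K₂ D' → G.Feas (capD c₁ c₂ D') M' →
          ((q : R) - 1) * G.val M' ≤ q * G.val M) := by
  obtain ⟨a, e1, e2, e3, e4⟩ := h.prepared q
  exact run_mainProg hq (h.agree a (by decide) (by decide)) e1 e2 e3 e4
    (hbest.agree a (by decide)) (hbestD.agree a (by decide)) hdeg h1 h12 hex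

end

/-! ### Computable bounds on the running time -/

/-- A bound on `L / nY`, `N`, `3 ^ N` and the parameters. -/
def paramBound (q k p : ℕ) : ℕ := 3 ^ Nval q k p + (1 + 2 * q * (k + 1)) + k + p

theorem primrec_pow : Primrec₂ ((· ^ ·) : ℕ → ℕ → ℕ) := by
  refine ((Primrec.nat_rec (Primrec.const 1)
    (Primrec.nat_mul.comp (Primrec.snd.comp Primrec.snd) Primrec.fst).to₂ :
    Primrec₂ fun (m n : ℕ) => Nat.rec 1 (fun _ z => z * m) n)).of_eq fun m n => ?_
  induction n with
  | zero => simp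
  | succ n ih => rw [pow_succ, ← ih]

theorem primrec_paramBound (q : ℕ) : Primrec₂ (paramBound q) := by
  have hk : Primrec fun x : ℕ × ℕ => x.1 := Primrec.fst
  have hp : Primrec fun x : ℕ × ℕ => x.2 := Primrec.snd
  have hN : Primrec fun x : ℕ × ℕ => Nval q x.1 x.2 :=
    Primrec.nat_add.comp (Primrec.nat_add.comp (Primrec.const 1) hk)
      (Primrec.nat_mul.comp hp (Primrec.nat_mul.comp hk (Primrec.const (2 * q))))
  exact Primrec.nat_add.comp (Primrec.nat_add.comp (Primrec.nat_add.comp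
    (primrec_pow.comp (Primrec.const 3) hN)
    (Primrec.nat_add.comp (Primrec.const 1) (Primrec.nat_mul.comp (Primrec.const (2 * q))
      (Primrec.nat_add.comp hk (Primrec.const 1))))) hk) hp

/-- Among the computed loop bounds only `L` depends on the size of the graph, and it is linear in
`nY`; the others are functions of the parameters. -/
theorem paramBound_spec (q k p : ℕ) : k ≤ paramBound q k p ∧ p ≤ paramBound q k p ∧
    Nval q k p ≤ paramBound q k p ∧ 3 ^ Nval q k p ≤ paramBound q k p ∧
    ∀ n m, n ≤ m → 1 ≤ m → Lval q k n ≤ paramBound q k p * m := by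
  have h : Nval q k p < 3 ^ Nval q k p := Nat.lt_pow_self (by omega)
  unfold paramBound
  refine ⟨by omega, by omega, by omega, by omega, fun n m hn hm => ?_⟩
  have h1 : n * (2 * q * (k + 1)) ≤ m * (2 * q * (k + 1)) := Nat.mul_le_mul_right _ hn
  have h2 : 0 ≤ (3 ^ Nval q k p + k + p) * m := Nat.zero_le _
  unfold Lval
  nlinarith

/-- A run within a polynomial in `g (parameter) * size` is an FPT run. -/
theorem runsInFPTTime_of_bound {Q : ParamMaxProblem} {P : RAMProgram} {g : ℕ × ℕ → ℕ} {c d : ℕ}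
    (hg : Primrec g) (hsize : ∀ I, 1 ≤ Q.size I)
    (h : ∀ I : Q.Inst, ∃ (t : ℕ) (s : RAMState), Exec P (Q.input I) t s ∧
      t ≤ c * (g (Q.param I) * Q.size I + 1) ^ d) : RunsInFPTTime Q P := by
  refine ⟨fun x => c * (g x + 1) ^ d, d, ?_, fun I => ?_⟩
  · exact (Primrec.nat_mul.comp (Primrec.const c) (primrec_pow.comp
      (Primrec.nat_add.comp hg (Primrec.const 1)) (Primrec.const d))).to_comp
  · obtain ⟨t, s, hs, ht⟩ := h I
    refine ⟨t, s, hs, ht.trans ?_⟩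
    rw [mul_assoc, ← mul_pow]
    refine Nat.mul_le_mul_left _ (Nat.pow_le_pow_left ?_ _)
    rw [add_mul, one_mul]
    exact Nat.add_le_add_left (hsize I) _

end

/-! # Weighted B-matching -/

theorem arrayOf_natCast {R : Type} [Zero R] {n : ℕ} (f : Fin n → R) {e : ℕ} (he : e < n) :
    arrayOf f (e : ℤ) = f ⟨e, he⟩ := by
  simp [arrayOf, he]

/-- A ratio of at least `α < 1`. -/
theorem exists_ratio {α : ℝ} (hα : α < 1) : ∃ q : ℕ, 1 ≤ q ∧ α * q ≤ q - 1 := by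
  obtain ⟨q, hq⟩ := exists_nat_ge (1 / (1 - α))
  have h1 : 0 < 1 - α := by linarith
  rw [div_le_iff₀ h1] at hq
  refine ⟨q + 1, by omega, ?_⟩
  push_cast
  nlinarith

/-- For `v ≥ 0` this is `α ≤ 1 - 1/q`. For negative `v` it relies on `0 ≤ z`, which is why the
algorithm never returns a value below that of the empty matching. -/
theorem ratio_le {α v z : ℝ} {q : ℕ} (hα : 0 < α) (hq : 1 ≤ q) (h : α * q ≤ q - 1) (hz : 0 ≤ z)
    (hv : ((q : ℝ) - 1) * v ≤ q * z) : α * v ≤ z := by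
  rcases le_total v 0 with h0 | h0
  · nlinarith
  · have hq' : (0 : ℝ) < q := by exact_mod_cast hq
    refine le_of_mul_le_mul_left ?_ hq'
    nlinarith

/-- A single vertex of type `d`. -/
theorem adm_single {nX K₁ K₂ d : ℕ} (a : ℕ) (h₁ : d = 1 → 1 ≤ K₁) (h₂ : d = 2 → 1 ≤ K₂) :
    Adm nX K₁ K₂ fun x => if x = a then d else 0 := by
  have key : ∀ d' k, d' ≠ 0 → (d = d' → 1 ≤ k) →
      ((range nX).filter fun x => (if x = a then d else 0) = d').card ≤ k := by
    intro d' k hd h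
    by_cases hdd : d = d'
    · refine le_trans (card_le_card (t := {a}) fun x hx => ?_) (by simpa using h hdd)
      by_contra hne
      rw [mem_singleton] at hne
      have := (mem_filter.1 hx).2
      rw [if_neg hne] at this
      exact hd this.symm
    · rw [filter_false_of_mem]
      · simp
      · intro x _
        split_ifs
        exacts [hdd, hd.symm]
  exact ⟨key 1 K₁ one_ne_zero h₁, key 2 K₂ two_ne_zero h₂⟩

/-- Read the scalars of the input. -/
def bLoad : FProg := block [
  assign .nX (.get .dims (.const 0)), assign .nY (.get .dims (.const 1)),
  assign .nE (.get .dims (.const 2)), assign .K (.get .dims (.const 3)),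
  assign .K1 (.get .dims (.const 3)), assign .K2 (.const 0), assign .p (.get .dims (.const 4))]

/-- Copy the capacities. -/
def bCopy : FProg := forTo .vx .nX (block [
  setI .cap1 (.sc .vx) (.get .cap (.sc .vx)), setI .cap2 (.sc .vx) (.get .cap (.sc .vx))])

/-- The programs that solve weighted B-matching. -/
def bPhases (q : ℕ) : List FProg := [bLoad, bCopy] ++ corePhases q

/-- Lookup in the list of all names is a left inverse, which avoids a case distinction over pairs of
names. -/
theorem ctorIdx_injective : Function.Injective IName.ctorIdx := by
  have : ∀ a : IName, [IName.dims, .src, .dst, .cap, .best, .outW, .outPhi, .typ, .nX, .nY, .nE, .K, .K1,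
      .K2, .p, .L, .N, .pow, .cap1, .cap2, .base, .kap, .asg, .busy, .rank, .dig, .bestD, .rem,
      .vx, .vj, .ve, .vs, .vt, .va, .vb, .vc, .vy, .be, .bs, .r, .c1, .c2, .quo, .sel][a.ctorIdx]?
      = some a := by
    intro a
    cases a <;> rfl
  intro a b h
  have := (this a).symm.trans (h ▸ this b)
  simpa using this

/-- The backend for weighted B-matching. -/
noncomputable def bBackend : Backend ℝ := realBackend IName.ctorIdx ctorIdx_injective

/-! ### B-matching as a matching problem with a single type -/

namespace BMatchingInst

variable (I : BMatchingInst)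

/-- The graph of an instance. -/
def graph : BGraph ℝ where
  nX := I.nX
  nY := I.nY
  nE := I.nE
  src e := if h : e < I.nE then (I.edge ⟨e, h⟩).1 else 0
  dst e := if h : e < I.nE then (I.edge ⟨e, h⟩).2 else 0
  u e := if h : e < I.nE then I.w ⟨e, h⟩ else 0
  src_lt e h := by simp [h]
  dst_lt e h := by simp [h]

@[simp] theorem graph_src (e : Fin I.nE) : I.graph.src e = (I.edge e).1 := by simp [graph]

@[simp] theorem graph_dst (e : Fin I.nE) : I.graph.dst e = (I.edge e).2 := by simp [graph]

@[simp] theorem graph_u (e : Fin I.nE) : I.graph.u e = I.w e := by simp [graph]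

/-- The capacities of an instance. -/
def capN (x : ℕ) : ℤ := if h : x < I.nX then I.c ⟨x, h⟩ else 0

@[simp] theorem capN_coe (x : Fin I.nX) : I.capN x = I.c x := by simp [capN]

theorem capN_nonneg (x : ℕ) : 0 ≤ I.capN x := by
  unfold capN
  split_ifs
  exacts [I.c_nonneg _, le_rfl]

theorem val_map (T : Finset (Fin I.nE)) :
    I.graph.val (T.map Fin.valEmbedding) = ∑ e ∈ T, I.w e := by
  simp [BGraph.val]

theorem card_filter_src (T : Finset (Fin I.nE)) (x : Fin I.nX) :
    ((T.map Fin.valEmbedding).filter fun e => I.graph.src e = x).card =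
      (T.filter fun e => (I.edge e).1 = x).card := by
  rw [filter_map, card_map]
  congr 1
  ext e
  simp [Fin.ext_iff]

/-- Feasible sets are the admissible matchings. -/
theorem feasible_iff (T : Finset (Fin I.nE)) : I.Feasible T ↔ ∃ D, Adm I.nX I.K 0 D ∧
    I.graph.Feas (capD I.capN I.capN D) (T.map Fin.valEmbedding) := by
  have hinj : (∀ e ∈ T.map Fin.valEmbedding, ∀ e' ∈ T.map Fin.valEmbedding,
      I.graph.dst e = I.graph.dst e' → e = e') ↔
      ∀ y : Fin I.nY, (T.filter fun e => (I.edge e).2 = y).card ≤ 1 := by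
    simp only [card_le_one, mem_filter, mem_map, Fin.valEmbedding_apply, forall_exists_index, and_imp,
      forall_apply_eq_imp_iff₂, graph_dst]
    constructor
    · intro h y e he hy e' he' hy'
      exact Fin.ext (h e he e' he' (by rw [hy, hy']))
    · intro h e he e' he' heq
      rw [h _ e he rfl e' he' (Fin.ext heq.symm)]
  constructor
  · rintro ⟨h1, h2, h3⟩
    set U := T.image fun e => (I.edge e).1 with hU
    -- Exactly the vertices used by `T` receive type `1`.
    refine ⟨fun x => if h : x < I.nX then if ⟨x, h⟩ ∈ U then 1 else 0 else 0, ⟨?_, ?_⟩, ?_, ?_,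
      hinj.2 h2⟩
    · refine le_trans (le_of_eq ?_) h3
      rw [← card_map Fin.valEmbedding]
      congr 1
      ext x
      simp only [mem_filter, mem_range, mem_map, Fin.valEmbedding_apply]
      constructor
      · rintro ⟨hx, h⟩
        rw [dif_pos hx] at h
        split_ifs at h with h'
        exact ⟨_, h', rfl⟩
      · rintro ⟨y, hy, rfl⟩
        simp [hy]
    · rw [filter_false_of_mem]
      · simp
      · intro x _
        split_ifs <;> simp
    · intro e he
      obtain ⟨f, _, rfl⟩ := mem_map.1 he
      exact f.2
    · intro x hx
      have hx' : x < I.nX := hx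
      have := I.card_filter_src T ⟨x, hx'⟩
      simp only at this
      rw [this]
      by_cases hxU : (⟨x, hx'⟩ : Fin I.nX) ∈ U
      · simpa [capD, hx', hxU, capN] using h1 ⟨x, hx'⟩
      · rw [filter_false_of_mem]
        · simp [capD, hx', hxU]
        · intro e he heq
          exact hxU (heq ▸ mem_image_of_mem _ he)
  · rintro ⟨D, hD, hT⟩
    refine ⟨fun x => ?_, hinj.1 hT.inj, ?_⟩
    · have := hT.load x x.2
      rw [I.card_filter_src] at this
      refine this.trans ?_
      have := I.c_nonneg x
      simp only [capD, capN_coe]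
      split_ifs <;> omega
    · rw [← card_map Fin.valEmbedding]
      refine le_trans (card_le_card fun x hx => ?_) hD.card_le
      obtain ⟨y, hy, rfl⟩ := mem_map.1 hx
      obtain ⟨e, he, rfl⟩ := mem_image.1 hy
      -- A vertex that lies on an edge has positive capacity, so it has type `1` or `2`;
      -- admissibility bounds the number of such vertices by `K + 0`.
      have := hT.pos_of_mem (mem_map_of_mem Fin.valEmbedding he)
      simp only [Fin.valEmbedding_apply, graph_src, capD] at this
      simp only [mem_filter, mem_range, Fin.valEmbedding_apply, Fin.is_lt, true_and]
      by_contra hne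
      rw [not_or] at hne
      rw [if_neg hne.1, if_neg hne.2] at this
      omega

theorem degree_graph_le (y : ℕ) :
    ((range I.graph.nE).filter fun e => I.graph.dst e = y).card ≤ I.p := by
  by_cases hy : y < I.nY
  · refine le_trans (le_of_eq ?_) (I.degree_le ⟨y, hy⟩)
    rw [← card_map Fin.valEmbedding]
    congr 1
    ext e
    simp only [mem_filter, mem_range, mem_map, mem_univ, true_and, Fin.valEmbedding_apply]
    constructor
    · rintro ⟨he, h⟩
      have he' : e < I.nE := he
      exact ⟨⟨e, he'⟩, Fin.ext (by simpa [graph, he'] using h), rfl⟩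
    · rintro ⟨f, hf, rfl⟩
      exact ⟨f.2, by simp [hf]⟩
  · rw [filter_false_of_mem]
    · simp
    · intro e he h
      have := I.graph.dst_lt e (mem_range.1 he)
      rw [h] at this
      exact hy this

/-- The state after reading the input. -/
theorem coreEnv_input : CoreEnv I.graph I.K 0 I.p I.capN I.capN
      (runAll [bLoad, bCopy] (bBackend.abs I.input)) ∧
    Agree (bLoad.iw ++ bCopy.iw) [] (bBackend.abs I.input)
      (runAll [bLoad, bCopy] (bBackend.abs I.input)) ∧
    (bLoad.run (bBackend.abs I.input)).i .nX 0 = I.nX := by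
  set s := bBackend.abs I.input with hs
  have hdims : s.i .dims = arrayOf ![(I.nX : ℤ), (I.nY : ℤ), (I.nE : ℤ), (I.K : ℤ), (I.p : ℤ)] := rfl
  have hsrc : s.i .src = arrayOf fun e => (((I.edge e).1 : ℕ) : ℤ) := rfl
  have hdst : s.i .dst = arrayOf fun e => (((I.edge e).2 : ℕ) : ℤ) := rfl
  have hcap : s.i .cap = arrayOf I.c := rfl
  have hw : s.w .w = arrayOf I.w := rfl
  have a1 := bLoad.agree_run s
  have a2 := bCopy.agree_run (bLoad.run s)
  have d0 : s.i .dims 0 = I.nX := by rw [hdims]; simp [arrayOf]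
  have d1 : s.i .dims 1 = I.nY := by rw [hdims]; simp [arrayOf]
  have d2 : s.i .dims 2 = I.nE := by rw [hdims]; simp [arrayOf]
  have d3 : s.i .dims 3 = I.K := by rw [hdims]; simp [arrayOf]
  have d4 : s.i .dims 4 = I.p := by rw [hdims]; simp [arrayOf]
  have hX : (bLoad.run s).i .nX 0 = I.nX := by simp [bLoad, block, run, IX.eval, d0]
  have hcapl : ∀ x < I.nX, (bLoad.run s).i .cap (x : ℕ) = I.capN x := by
    intro x hx
    rw [a1.i .cap (by decide), hcap, arrayOf_natCast _ hx]
    simp [capN, hx]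
  refine ⟨⟨?_, ?_, ?_, ?_, ?_, ?_, ?_, ?_, ?_, ?_, ?_, ?_⟩, ?_, hX⟩
  all_goals simp only [runAll]
  · rw [a2.i .nX (by decide), hX]; rfl
  · rw [a2.i .nY (by decide)]; simp [bLoad, block, run, IX.eval, d1]; rfl
  · rw [a2.i .nE (by decide)]; simp [bLoad, block, run, IX.eval, d2]; rfl
  · rw [a2.i .K (by decide)]; simp [bLoad, block, run, IX.eval, d3]
  · rw [a2.i .K1 (by decide)]; simp [bLoad, block, run, IX.eval, d3]
  · rw [a2.i .K2 (by decide)]; simp [bLoad, block, run, IX.eval]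
  · rw [a2.i .p (by decide)]; simp [bLoad, block, run, IX.eval, d4]
  · intro e he
    have he' : e < I.nE := he
    rw [a2.i .src (by decide), a1.i .src (by decide), hsrc, arrayOf_natCast _ he']
    simp [graph, he']
  · intro e he
    have he' : e < I.nE := he
    rw [a2.i .dst (by decide), a1.i .dst (by decide), hdst, arrayOf_natCast _ he']
    simp [graph, he']
  · refine (run_forTo_map hX (by decide) I.capN fun x s' hx ha hv _ => ?_).1
    have := hcapl x hx
    rw [← ha.i .cap (by decide)] at this
    simp [block, run, IX.eval, hv, this]
  · refine (run_forTo_map hX (by decide) I.capN fun x s' hx ha hv _ => ?_).1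
    have := hcapl x hx
    rw [← ha.i .cap (by decide)] at this
    simp [block, run, IX.eval, hv, this]
  · intro e he
    have he' : e < I.nE := he
    rw [a2.w .w (by decide), a1.w .w (by decide), hw, arrayOf_natCast _ he']
    simp [graph, he']
  · exact (a1.mono (by simp) (by decide)).trans (a2.mono (by simp) (by decide))

/-- One number, `paramBound` times the size, dominates all loop bounds, and `c` and `d` are chosen
before the instance. -/
theorem exists_run (q : ℕ) : ∃ c d : ℕ, ∀ I : BMatchingInst, ∃ t r',
    Exec (bBackend.compileAll (bPhases q)) I.input t r' ∧
      bBackend.abs r' = runAll (bPhases q) (bBackend.abs I.input) ∧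
      t ≤ c * (paramBound q I.K I.p * (I.nX + I.nY + I.nE + 1) + 1) ^ d := by
  obtain ⟨c, d, h⟩ := bBackend.exec_compileAll (bPhases q) (by
    intro P hP
    simp only [bPhases, List.cons_append, List.nil_append, List.mem_cons] at hP
    rcases hP with rfl | rfl | hP
    · decide
    · decide
    · exact okAll_corePhases q P hP)
  refine ⟨c, d, fun I => h _ _ ?_⟩
  obtain ⟨hC, _, hX⟩ := I.coreEnv_input
  obtain ⟨p1, p2, p3, p4, p5⟩ := paramBound_spec q I.K I.p
  set B := paramBound q I.K I.p * (I.nX + I.nY + I.nE + 1) with hB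
  have hle : paramBound q I.K I.p ≤ B := Nat.le_mul_of_pos_right _ (by omega)
  have hpos : 1 ≤ paramBound q I.K I.p := le_trans (Nat.one_le_pow _ _ (by omega)) p4
  have hsize : I.nX + I.nY + I.nE + 1 ≤ B := Nat.le_mul_of_pos_left _ (by omega)
  refine BoundedAll.append ⟨by simp [bLoad, block, bnds], fun b hb => ?_, trivial⟩ (hC.boundedAll ?_ ?_ ?_ ?_ ?_ ?_ ?_ ?_)
  · have : bCopy.bnds = [.nX] := rfl
    rw [this, List.mem_singleton] at hb
    rw [hb, hX]
    omega
  · exact (by omega : I.nX ≤ B)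
  · exact (by omega : I.nY ≤ B)
  · exact (by omega : I.nE ≤ B)
  · omega
  · omega
  · exact p5 I.nY _ (by omega) (by omega)
  · simpa using p3.trans hle
  · simpa using p4.trans hle

theorem exists_approx {α : ℝ} {q : ℕ} (hα : 0 < α) (hq : 1 ≤ q) (hαq : α * q ≤ q - 1) {r' : RAMState}
    (habs : bBackend.abs r' = runAll (bPhases q) (bBackend.abs I.input)) :
    ∃ S : Finset (Fin I.nE),
      (∀ e : Fin I.nE, r'.ints 4 ((e : ℕ) : ℤ) = if e ∈ S then 1 else 0) ∧ I.Feasible S ∧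
      ∀ T, I.Feasible T → α * ∑ e ∈ T, I.w e ≤ ∑ e ∈ S, I.w e := by
  obtain ⟨hC, hag, _⟩ := I.coreEnv_input
  rw [bPhases, runAll_append] at habs
  -- The two capacity functions coincide, so the passage from `c₂` to `c₁` in the exchange property
  -- is trivial. The arrays `best` and `bestD` lie outside the input, so they start at zero.
  obtain ⟨D, M, hD, _, hM, hM0, hbest, _, happ⟩ := hC.runAll_corePhases hq
    (fun e _ => by rw [hag.i .best (by decide)]; rfl)
    (fun e _ => by rw [hag.i .bestD (by decide)]; rfl)
    I.degree_graph_le (fun x _ => I.capN_nonneg x) (fun _ _ => le_rfl) (fun _ _ _ _ _ _ _ h => h)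
  have hMlt : ∀ e ∈ M, e < I.nE := hM.lt
  have hSM := map_valEmbedding_attachFin hMlt
  set S := M.attachFin hMlt with hS
  have hSf : I.Feasible S := (I.feasible_iff S).2 ⟨D, hD, by rw [hSM]; exact hM⟩
  have hSv : ∑ e ∈ S, I.w e = I.graph.val M := by rw [← hSM, val_map]
  refine ⟨S, fun e => ?_, hSf, fun T hT => ?_⟩
  · have h1 : (bBackend.abs r').i .best ((e : ℕ) : ℤ) = if (e : ℕ) ∈ M then 1 else 0 := by
      rw [habs]
      exact hbest e e.2
    have h2 : e ∈ S ↔ (e : ℕ) ∈ M := by simp [hS]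
    simp only [h2]
    exact h1
  · rw [hSv]
    obtain ⟨D', hD', hT'⟩ := (I.feasible_iff T).1 hT
    -- For `K = 0` no single edge is admissible and the comparison of the optimum with `ε` fails,
    -- but then only the empty set is feasible.
    by_cases hK : I.K = 0
    · have hT0 : T = ∅ := by
        have := hT.2.2
        rw [hK, Nat.le_zero, card_eq_zero, image_eq_empty] at this
        exact this
      rw [hT0]
      simpa using hM0
    · rw [← val_map]
      refine ratio_le hα hq hαq hM0 (happ (fun e he hc => ?_) D' _ hD' hT')
      refine ⟨_, adm_single (d := 1) (I.graph.src e) (fun _ => by omega) (by simp), ?_⟩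
      refine BGraph.feas_singleton (BGraph.capD_nonneg (fun x _ => I.capN_nonneg x)
        (fun x _ => I.capN_nonneg x) _) he ?_
      simpa [capD] using hc

end BMatchingInst

theorem hasFPTApproxScheme_weightedBMatching : HasFPTApproxScheme weightedBMatching := by
  intro α hα hα1
  obtain ⟨q, hq, hαq⟩ := exists_ratio hα1
  obtain ⟨c, d, hrun⟩ := BMatchingInst.exists_run q
  refine ⟨bBackend.compileAll (bPhases q), fun I => ?_, ?_⟩
  · obtain ⟨t, r', hexec, habs, _⟩ := hrun I
    obtain ⟨S, hS⟩ := BMatchingInst.exists_approx I hα hq hαq habs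
    exact ⟨t, r', S, hexec, hS⟩
  · refine runsInFPTTime_of_bound (g := fun x => paramBound q x.1 x.2) (c := c) (d := d)
      (primrec_paramBound q) (fun I => Nat.le_add_left _ _) fun I => ?_
    obtain ⟨t, r', hexec, _, ht⟩ := hrun I
    exact ⟨t, r', hexec, ht⟩

/-! # Completing a matching to a balanced assignment -/

/-- Give a type to the vertex `vx` if it has none and some type is still available. -/
def padStep : FProg :=
  ite (.ile (.get .bestD (.sc .vx)) (.const 0))
    (ite (.not (.ile (.sc .K1) (.sc .c1)))
      (block [setI .bestD (.sc .vx) (.const 1), assign .c1 (.add (.sc .c1) (.const 1))])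
      (ite (.not (.ile (.sc .K2) (.sc .c2)))
        (block [setI .bestD (.sc .vx) (.const 2), assign .c2 (.add (.sc .c2) (.const 1))])
        skip)) skip

/-- Add vertices until there are `K1` of type `1` and `K2` of type `2`. -/
def padProg : FProg := block [countProg .bestD .c1 1, countProg .bestD .c2 2, forTo .vx .nX padStep]

/-- Output the committee and initialize the remaining capacities. -/
def committeeProg : FProg := forTo .vx .nX
  (ite (.ile (.get .bestD (.sc .vx)) (.const 0))
    (block [setI .outW (.sc .vx) (.const 0), setI .rem (.sc .vx) (.const 0)])
    (ite (.ile (.get .bestD (.sc .vx)) (.const 1))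
      (block [setI .outW (.sc .vx) (.const 1), setI .rem (.sc .vx) (.get .cap1 (.sc .vx))])
      (block [setI .outW (.sc .vx) (.const 1), setI .rem (.sc .vx) (.get .cap2 (.sc .vx))])))

/-- Assign `vy` to `sel`. -/
def placeProg : FProg := block [setI .outPhi (.sc .vy) (.sc .sel), setI .busy (.sc .vy) (.const 1),
  setI .rem (.sc .sel) (.sub (.get .rem (.sc .sel)) (.const 1))]

/-- Assign the matched vertices. -/
def matchedProg : FProg := block [
  forTo .vy .nY (setI .busy (.sc .vy) (.const 0)),
  forTo .ve .nE (ite (.ile (.const 1) (.get .best (.sc .ve)))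
    (block [assign .vy (.get .dst (.sc .ve)), assign .sel (.get .src (.sc .ve)), placeProg]) skip)]

/-- Find a vertex with remaining capacity. -/
def selectProg : FProg := forTo .vx .nX
  (ite (.ile (.const 1) (.get .rem (.sc .vx))) (assign .sel (.sc .vx)) skip)

/-- Assign the other vertices. -/
def restProg : FProg := forTo .vy .nY
  (ite (.ile (.get .busy (.sc .vy)) (.const 0)) (block [selectProg, placeProg]) skip)

/-- Complete the matching. -/
def completeProg : FProg := block [padProg, committeeProg, matchedProg, restProg]

theorem card_filter_update {D : ℕ → ℕ} {n x d : ℕ} (hx : x < n) (h : D x ≠ d) :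
    ((range n).filter fun z => Function.update D x d z = d).card =
      ((range n).filter fun z => D z = d).card + 1 := by
  rw [← card_insert_of_notMem (a := x) (by simp [h])]
  congr 1
  ext z
  by_cases hz : z = x
  · subst hz; simp [hx]
  · simp [hz]

theorem filter_update_of_ne {D : ℕ → ℕ} {n x d d' : ℕ} (h : D x ≠ d) (hd : d' ≠ d) :
    ((range n).filter fun z => Function.update D x d' z = d) = (range n).filter fun z => D z = d := by
  ext z
  by_cases hz : z = x
  · subst hz; simp [h, hd]
  · simp [hz]

/-! ### Correctness of the completion -/

section

variable {R : Type} [CommRing R] [LinearOrder R] {G : BGraph R} {s : St R} {K₁ K₂ p : ℕ}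
  {c₁ c₂ : ℕ → ℤ}

/-- A single greedy pass. Afterwards either both numbers of types are exhausted, or every vertex has
a type; in the second case `K₁ + K₂ ≤ nX` forces both numbers to be exhausted as well. -/
theorem run_padProg {D : ℕ → ℕ} (hE : CoreEnv G K₁ K₂ p c₁ c₂ s) (hK : K₁ + K₂ ≤ G.nX)
    (hA : Adm G.nX K₁ K₂ D) (hD2 : ∀ x, D x ≤ 2) (hD : Holds s .bestD G.nX fun x => D x) :
    ∃ D' : ℕ → ℕ, (∀ x, D x ≠ 0 → D' x = D x) ∧ (∀ x, D' x ≤ 2) ∧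
      (Holds (padProg.run s) .bestD G.nX fun x => D' x) ∧
      ((range G.nX).filter fun x => D' x = 1).card = K₁ ∧
      ((range G.nX).filter fun x => D' x = 2).card = K₂ := by
  set s₁ := (countProg .bestD .c1 1).run s with hs₁
  set s₂ := (countProg .bestD .c2 2).run s₁ with hs₂
  have hrun : padProg.run s = (forTo .vx .nX padStep).run s₂ := rfl
  have a1 : Agree _ _ s s₁ := (countProg .bestD .c1 1).agree_run s
  have a2 : Agree _ _ s₁ s₂ := (countProg .bestD .c2 2).agree_run s₁
  have E1 := hE.agree a1 (by decide) (by decide)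
  have E2 := E1.agree a2 (by decide) (by decide)
  have D1 := hD.agree a1 (by decide)
  have D2 := D1.agree a2 (by decide)
  have n1 : s₁.i .c1 0 = _ := run_countProg 1 hE.nX (by decide) (by decide) (by decide)
    (by decide) hD
  have n2 : s₂.i .c2 0 = _ := run_countProg 2 E1.nX (by decide) (by decide) (by decide)
    (by decide) D1
  rw [← a2.i .c1 (by decide)] at n1
  have key := run_forTo_inv (v := .vx) (n := .nX) (P := padStep) E2.nX (fun j s' =>
    ∃ D' : ℕ → ℕ, (∀ x, D x ≠ 0 → D' x = D x) ∧ (∀ x, D' x ≤ 2) ∧ (Holds s' .bestD G.nX fun x => D' x) ∧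
      s'.i .c1 0 = ((range G.nX).filter fun x => D' x = 1).card ∧
      s'.i .c2 0 = ((range G.nX).filter fun x => D' x = 2).card ∧
      ((range G.nX).filter fun x => D' x = 1).card ≤ K₁ ∧
      ((range G.nX).filter fun x => D' x = 2).card ≤ K₂ ∧
      ((∀ x < j, D' x ≠ 0) ∨ (((range G.nX).filter fun x => D' x = 1).card = K₁ ∧
        ((range G.nX).filter fun x => D' x = 2).card = K₂)))
    (fun j s' z h => by simpa [Holds] using h)
    ⟨D, fun _ _ => rfl, hD2, D2, n1, n2, hA.one, hA.two, .inl (by simp)⟩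
    (by
      rintro j s' hj ha hv ⟨D', i1, i2, i3, i4, i5, i6, i7, i8⟩
      have k1 : s'.i .K1 0 = K₁ := by rw [ha.i .K1 (by decide), E2.K1]
      have k2 : s'.i .K2 0 = K₂ := by rw [ha.i .K2 (by decide), E2.K2]
      have hset : ∀ d : ℕ, ∀ z < G.nX, Function.update (s'.i .bestD) (j : ℤ) (d : ℤ) (z : ℕ) =
          (Function.update D' j d z : ℕ) := by
        intro d z hz
        by_cases hzj : z = j
        · subst hzj; simp
        · rw [Function.update_of_ne (by omega), Function.update_of_ne hzj, i3 z hz]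
      have hnew : ∀ d : ℕ, d ≠ 0 → D' j = 0 → ∀ x < j + 1, (∀ x < j, D' x ≠ 0) →
          Function.update D' j d x ≠ 0 := by
        intro d hd _ x hx h
        by_cases hxj : x = j
        · subst hxj; simpa using hd
        · rw [Function.update_of_ne hxj]; exact h x (by omega)
      simp only [padStep, run, BX.Holds, IX.eval, hv, i3 j hj, k1, k2, i4, i5]
      split_ifs with h1 h2 h3
      · exact ⟨D', i1, i2, i3, i4, i5, i6, i7, .inr ⟨by omega, by omega⟩⟩
      · have h0 : D' j = 0 := by omega
        refine ⟨Function.update D' j 2, fun x hx => ?_, fun x => ?_, fun z hz => ?_, ?_, ?_, ?_, ?_, ?_⟩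
        · rw [Function.update_of_ne, i1 x hx]
          rintro rfl
          exact hx (by rw [← i1 _ hx, h0])
        · by_cases hxj : x = j
          · subst hxj; simp
          · rw [Function.update_of_ne hxj]; exact i2 x
        · simpa [block, run, IX.eval, hv] using hset 2 z hz
        · rw [filter_update_of_ne (by omega) (by omega)]
          simp [block, run, IX.eval, i4]
        · rw [card_filter_update hj (by omega)]
          simp [block, run, IX.eval, i5]
        · rw [filter_update_of_ne (by omega) (by omega)]; exact i6
        · rw [card_filter_update hj (by omega)]; omega
        · rcases i8 with i8 | i8
          · exact .inl fun x hx => hnew 2 two_ne_zero h0 x hx i8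
          · omega
      · have h0 : D' j = 0 := by omega
        refine ⟨Function.update D' j 1, fun x hx => ?_, fun x => ?_, fun z hz => ?_, ?_, ?_, ?_, ?_, ?_⟩
        · rw [Function.update_of_ne, i1 x hx]
          rintro rfl
          exact hx (by rw [← i1 _ hx, h0])
        · by_cases hxj : x = j
          · subst hxj; simp
          · rw [Function.update_of_ne hxj]; exact i2 x
        · simpa [block, run, IX.eval, hv] using hset 1 z hz
        · rw [card_filter_update hj (by omega)]
          simp [block, run, IX.eval, i4]
        · rw [filter_update_of_ne (by omega) (by omega)]
          simp [block, run, IX.eval, i5]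
        · rw [card_filter_update hj (by omega)]; omega
        · rw [filter_update_of_ne (by omega) (by omega)]; exact i7
        · rcases i8 with i8 | i8
          · exact .inl fun x hx => hnew 1 one_ne_zero h0 x hx i8
          · omega
      · refine ⟨D', i1, i2, i3, i4, i5, i6, i7, i8.imp (fun i8 x hx => ?_) id⟩
        rcases Nat.lt_succ_iff_lt_or_eq.1 hx with hx | rfl
        · exact i8 x hx
        · omega)
  rw [← hrun] at key
  obtain ⟨D', i1, i2, i3, -, -, i6, i7, i8⟩ := key
  refine ⟨D', i1, i2, i3, ?_⟩
  rcases i8 with i8 | i8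
  -- All `nX` vertices have type `1` or `2`, so the two class sizes add up to `nX ≥ K₁ + K₂`, and
  -- neither exceeds its bound.
  · have h := card_union_of_disjoint (s := (range G.nX).filter fun x => D' x = 1)
      (t := (range G.nX).filter fun x => D' x = 2) (by
        rw [disjoint_filter]; intro x _ h1 h2; omega)
    rw [← filter_or, filter_true_of_mem, card_range] at h
    · omega
    · intro x hx
      have := i8 x (mem_range.1 hx)
      have := i2 x
      omega
  · exact i8

theorem run_committeeProg {D : ℕ → ℕ} (hE : CoreEnv G K₁ K₂ p c₁ c₂ s)
    (hD2 : ∀ x, D x ≤ 2) (hD : Holds s .bestD G.nX fun x => D x) :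
    (Holds (committeeProg.run s) .outW G.nX fun x => if D x = 0 then 0 else 1) ∧
      Holds (committeeProg.run s) .rem G.nX (capD c₁ c₂ D) := by
  constructor
  · refine (run_forTo_map hE.nX (by decide) _ fun x s' hx ha hv _ => ?_).1
    simp only [run, BX.Holds, IX.eval, hv, hD.agree ha (by decide) x hx]
    have := hD2 x
    split_ifs <;> first | omega | simp [block, run, IX.eval, hv]
  · refine (run_forTo_map hE.nX (by decide) _ fun x s' hx ha hv _ => ?_).1
    have h1 : s'.i .cap1 x = c₁ x := by rw [ha.i .cap1 (by decide), hE.cap1 x hx]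
    have h2 : s'.i .cap2 x = c₂ x := by rw [ha.i .cap2 (by decide), hE.cap2 x hx]
    simp only [run, BX.Holds, IX.eval, hv, hD.agree ha (by decide) x hx, capD]
    have := hD2 x
    split_ifs <;> first | omega | simp [block, run, IX.eval, hv, h1, h2]

/-- The state `s` holds the assignment `Φ` of the vertices in `A` and the remaining capacities. -/
structure Placed (G : BGraph R) (κ : ℕ → ℤ) (A : Finset ℕ) (Φ : ℕ → ℕ) (s : St R) : Prop where
  busy : Holds s .busy G.nY fun y => if y ∈ A then 1 else 0
  phi : ∀ y ∈ A, s.i .outPhi (y : ℕ) = Φ y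
  rem : Holds s .rem G.nX fun x => κ x - (A.filter fun y => Φ y = x).card
  sub : A ⊆ range G.nY
  lt : ∀ y ∈ A, Φ y < G.nX

omit [CommRing R] [LinearOrder R] in
theorem Placed.agree {κ : ℕ → ℤ} {A : Finset ℕ} {Φ : ℕ → ℕ} {s' : St R} {B : List IName}
    {V : List WName} (h : Placed G κ A Φ s) (ha : Agree B V s s')
    (hB : ∀ a ∈ [IName.busy, .outPhi, .rem], a ∉ B) : Placed G κ A Φ s' := by
  simp only [List.mem_cons, List.not_mem_nil, or_false, forall_eq_or_imp, forall_eq] at hB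
  refine ⟨h.busy.agree ha hB.1, ?_, h.rem.agree ha hB.2.2, h.sub, h.lt⟩
  rw [ha.i _ hB.2.1]
  exact h.phi

theorem Placed.place {κ : ℕ → ℤ} {A : Finset ℕ} {Φ : ℕ → ℕ} (h : Placed G κ A Φ s) {x y : ℕ}
    (hx : x < G.nX) (hy : y < G.nY) (hyA : y ∉ A) (hvy : s.i .vy 0 = y) (hsel : s.i .sel 0 = x) :
    Placed G κ (insert y A) (Function.update Φ y x) (placeProg.run s) := by
  have hne : ∀ z ∈ A, z ≠ y := fun z hz e => hyA (e ▸ hz)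
  refine ⟨fun z hz => ?_, fun z hz => ?_, fun z hz => ?_, ?_, ?_⟩
  · have := h.busy z hz
    by_cases hzy : z = y
    · subst hzy; simp [placeProg, block, run, IX.eval, hvy]
    · simp [placeProg, block, run, IX.eval, hzy, hvy, this]
  · by_cases hzy : z = y
    · subst hzy; simp [placeProg, block, run, IX.eval, hvy, hsel]
    · have := h.phi z ((mem_insert.1 hz).resolve_left hzy)
      simp [placeProg, block, run, IX.eval, hvy, hzy, this]
  · have hA : A.filter (fun w => Function.update Φ y x w = z) = A.filter fun w => Φ w = z :=
      filter_congr fun w hw => by rw [Function.update_of_ne (hne w hw)]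
    have := h.rem z hz
    beta_reduce at this ⊢
    by_cases hzx : z = x
    · subst hzx
      rw [filter_insert, if_pos (by simp), card_insert_of_notMem (by simp [hyA]), hA]
      simp [placeProg, block, run, IX.eval, hsel, this]
      ring
    · rw [filter_insert, if_neg (by simpa using Ne.symm hzx), hA]
      simp [placeProg, block, run, IX.eval, hsel, hzx, this]
  · exact insert_subset (mem_range.2 hy) h.sub
  · intro z hz
    by_cases hzy : z = y
    · subst hzy; simpa using hx
    · rw [Function.update_of_ne hzy]
      exact h.lt z ((mem_insert.1 hz).resolve_left hzy)

theorem run_matchedProg {κ : ℕ → ℤ} {M : Finset ℕ} (hE : CoreEnv G K₁ K₂ p c₁ c₂ s)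
    (hM : G.Feas κ M) (hbest : Holds s .best G.nE fun e => if e ∈ M then 1 else 0)
    (hrem : Holds s .rem G.nX κ) :
    ∃ Φ, Placed G κ (M.image G.dst) Φ (matchedProg.run s) ∧ ∀ e ∈ M, Φ (G.dst e) = G.src e := by
  set s₁ := (forTo .vy .nY (setI .busy (.sc .vy) (.const 0))).run s with hs₁
  have a1 : Agree _ _ s s₁ := (forTo .vy .nY (setI .busy (.sc .vy) (.const 0))).agree_run s
  have E1 := hE.agree a1 (by decide) (by decide)
  have hbusy : Holds s₁ .busy G.nY fun _ => 0 :=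
    (run_forTo_map hE.nY (by decide) _ fun x s' hx ha hv _ => by simp [run, IX.eval, hv]).1
  have key := run_forTo_inv (v := .ve) (n := .nE) (P := ite (.ile (.const 1) (.get .best (.sc .ve)))
    (block [assign .vy (.get .dst (.sc .ve)), assign .sel (.get .src (.sc .ve)), placeProg]) skip)
    E1.nE (fun j s' => ∃ Φ, Placed G κ ((M.filter (· < j)).image G.dst) Φ s' ∧
      ∀ e ∈ M, e < j → Φ (G.dst e) = G.src e)
    (fun j s' z ⟨Φ, h1, h2⟩ => ⟨Φ, h1.agree (agree_setI _ _ _ _) (by decide), h2⟩)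
    ⟨fun _ => 0, ⟨by simpa [Holds] using hbusy, by simp, by
      simpa [Holds] using hrem.agree a1 (by decide), by simp, by simp⟩, by simp⟩
    (by
      rintro j s' hj ha hv ⟨Φ, h1, h2⟩
      have b1 := (hbest.agree a1 (by decide)).agree ha (by decide) j hj
      have d1 : s'.i .dst j = G.dst j := by rw [ha.i .dst (by decide), E1.dst j hj]
      have c1 : s'.i .src j = G.src j := by rw [ha.i .src (by decide), E1.src j hj]
      simp only [run, BX.Holds, IX.eval, hv, b1]
      by_cases hjM : j ∈ M
      · have hins : M.filter (· < j + 1) = insert j (M.filter (· < j)) := by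
          ext e
          simp only [mem_filter, mem_insert]
          constructor
          · rintro ⟨he, hlt⟩
            rcases Nat.lt_succ_iff_lt_or_eq.1 hlt with h | h
            · exact .inr ⟨he, h⟩
            · exact .inl h
          · rintro (rfl | ⟨he, hlt⟩)
            · exact ⟨hjM, by omega⟩
            · exact ⟨he, by omega⟩
        -- Distinct edges of a matching have distinct ends, so the end of `j` has not been placed by
        -- an earlier edge.
        have hnot : G.dst j ∉ (M.filter (· < j)).image G.dst := by
          rw [mem_image]
          rintro ⟨e, he, heq⟩
          have := hM.inj e (mem_filter.1 he).1 j hjM heq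
          have := (mem_filter.1 he).2
          omega
        rw [if_pos (by simp [hjM]), hins, image_insert]
        set s₂ := (s'.setI .vy 0 (G.dst j)).setI .sel 0 (G.src j) with hs₂
        have hr : (block [assign .vy (.get .dst (.sc .ve)), assign .sel (.get .src (.sc .ve)),
            placeProg]).run s' = placeProg.run s₂ := by
          simp [block, run, IX.eval, hv, d1, c1, hs₂]
        have h3 : Placed G κ ((M.filter (· < j)).image G.dst) Φ s₂ :=
          (h1.agree (agree_setI _ _ _ _) (by decide)).agree (agree_setI _ _ _ _) (by decide)
        rw [hr]
        refine ⟨_, h3.place (G.src_lt j hj) (G.dst_lt j hj) hnot (by simp [hs₂]) (by simp [hs₂]),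
          fun e he hlt => ?_⟩
        rcases Nat.lt_succ_iff_lt_or_eq.1 hlt with hlt | rfl
        · rw [Function.update_of_ne, h2 e he hlt]
          intro heq
          exact hnot (heq ▸ mem_image_of_mem _ (mem_filter.2 ⟨he, hlt⟩))
        · simp
      · have heq : M.filter (· < j + 1) = M.filter (· < j) := by
          refine filter_congr fun e he => ?_
          have : e ≠ j := fun h => hjM (h ▸ he)
          omega
        rw [if_neg (by simp [hjM]), heq]
        refine ⟨Φ, h1, fun e he hlt => h2 e he ?_⟩
        have : e ≠ j := fun h => hjM (h ▸ he)
        omega)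
  rw [filter_true_of_mem hM.lt] at key
  obtain ⟨Φ, h1, h2⟩ := key
  exact ⟨Φ, h1, fun e he => h2 e he (hM.lt e he)⟩

/-- The loop ends with the last vertex that has capacity left; any such vertex would do. -/
theorem run_selectProg (hn : s.i .nX 0 = G.nX) (h : ∃ x < G.nX, 1 ≤ s.i .rem (x : ℕ)) :
    ∃ x < G.nX, (selectProg.run s).i .sel 0 = x ∧ 1 ≤ s.i .rem (x : ℕ) := by
  have key := run_forTo_inv (v := .vx) (n := .nX)
    (P := ite (.ile (.const 1) (.get .rem (.sc .vx))) (assign .sel (.sc .vx)) skip) hn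
    (fun j s' => (∀ x < j, ¬ 1 ≤ s.i .rem (x : ℕ)) ∨
      ∃ x < G.nX, s'.i .sel 0 = x ∧ 1 ≤ s.i .rem (x : ℕ))
    (fun j s' z h => by simpa using h) (.inl (by simp))
    (by
      intro j s' hj ha hv h
      simp only [run, BX.Holds, IX.eval, hv, ha.i .rem (by decide)]
      split_ifs with h1
      · exact .inr ⟨j, hj, by simp, h1⟩
      · refine h.imp (fun h x hx => ?_) id
        rcases Nat.lt_succ_iff_lt_or_eq.1 hx with hx | rfl
        · exact h x hx
        · exact h1)
  obtain ⟨x, hx, h1⟩ := h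
  exact key.resolve_left fun h => h x hx h1

omit [CommRing R] [LinearOrder R] in
theorem Placed.card_eq {κ : ℕ → ℤ} {A : Finset ℕ} {Φ : ℕ → ℕ} (h : Placed G κ A Φ s) :
    (A.card : ℤ) = ∑ x ∈ range G.nX, ((A.filter fun y => Φ y = x).card : ℤ) := by
  rw [card_eq_sum_card_fiberwise (t := range G.nX) fun y hy => mem_coe.2 (mem_range.2 (h.lt y hy))]
  push_cast
  rfl

/-- The capacities add up to `nY`. As long as some `y` is unplaced, the loads have a smaller sum, so
there is a vertex with room. At the end the loads are bounded by the capacities and have the same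
sum, so they agree everywhere. -/
theorem run_restProg {κ : ℕ → ℤ} {A : Finset ℕ} {Φ : ℕ → ℕ} (hE : CoreEnv G K₁ K₂ p c₁ c₂ s)
    (hsum : ∑ x ∈ range G.nX, κ x = G.nY) (h : Placed G κ A Φ s)
    (hle : ∀ x < G.nX, ((A.filter fun y => Φ y = x).card : ℤ) ≤ κ x) :
    ∃ Φ', Placed G κ (range G.nY) Φ' (restProg.run s) ∧ (∀ y ∈ A, Φ' y = Φ y) ∧
      ∀ x < G.nX, (((range G.nY).filter fun y => Φ' y = x).card : ℤ) = κ x := by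
  have key := run_forTo_inv (v := .vy) (n := .nY)
    (P := ite (.ile (.get .busy (.sc .vy)) (.const 0)) (block [selectProg, placeProg]) skip) hE.nY
    (fun j s' => ∃ A' Φ', Placed G κ A' Φ' s' ∧ A ⊆ A' ∧ range j ⊆ A' ∧ (∀ y ∈ A, Φ' y = Φ y) ∧
      ∀ x < G.nX, ((A'.filter fun y => Φ' y = x).card : ℤ) ≤ κ x)
    (fun j s' z ⟨A', Φ', h1, h2⟩ => ⟨A', Φ', h1.agree (agree_setI _ _ _ _) (by decide), h2⟩)
    ⟨A, Φ, h, Subset.rfl, by simp, fun _ _ => rfl, hle⟩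
    (by
      rintro j s' hj ha hv ⟨A', Φ', h1, h2, h3, h4, h5⟩
      simp only [run, BX.Holds, IX.eval, hv, h1.busy j hj]
      by_cases hjA : j ∈ A'
      · rw [if_neg (by simp [hjA])]
        exact ⟨A', Φ', h1, h2, by rw [range_add_one]; exact insert_subset hjA h3, h4, h5⟩
      · rw [if_pos (by simp [hjA])]
        have hlt : (A'.card : ℤ) < G.nY := by
          have := card_lt_card (Finset.ssubset_iff_subset_ne.2 ⟨h1.sub, fun e => hjA (e ▸ mem_range.2 hj)⟩)
          rw [card_range] at this
          exact_mod_cast this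
        rw [h1.card_eq, ← hsum] at hlt
        -- This vertex only shows that the search succeeds; the search may return a different one.
        obtain ⟨x, hx, hxlt⟩ := exists_lt_of_sum_lt hlt
        obtain ⟨x, hx, hsel, hrem⟩ := run_selectProg (G := G) (s := s')
          (by rw [ha.i .nX (by decide), hE.nX])
          ⟨x, mem_range.1 hx, by rw [h1.rem x (mem_range.1 hx)]; beta_reduce; omega⟩
        have a2 := selectProg.agree_run s'
        have h6 := (h1.agree a2 (by decide)).place hx hj hjA
          (by rw [a2.i .vy (by decide), hv]) hsel
        refine ⟨_, _, h6, h2.trans (subset_insert _ _), ?_, fun y hy => ?_, fun z hz => ?_⟩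
        · rw [range_add_one]; exact insert_subset_insert _ h3
        · rw [Function.update_of_ne (ne_of_mem_of_not_mem (h2 hy) hjA), h4 y hy]
        · rw [h1.rem x hx] at hrem
          have hA : A'.filter (fun w => Function.update Φ' j x w = z) = A'.filter fun w => Φ' w = z :=
            filter_congr fun w hw => by rw [Function.update_of_ne (ne_of_mem_of_not_mem hw hjA)]
          have := h5 z hz
          by_cases hzx : z = x
          · subst hzx
            rw [filter_insert, if_pos (by simp), card_insert_of_notMem (by simp [hjA]), hA]
            push_cast
            linarith
          · rwa [filter_insert, if_neg (by simpa using Ne.symm hzx), hA])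
  obtain ⟨A', Φ', h1, h2, h3, h4, h5⟩ := key
  obtain rfl : A' = range G.nY := Subset.antisymm h1.sub h3
  refine ⟨Φ', h1, h4, fun x hx => ?_⟩
  have hc := h1.card_eq
  rw [card_range, ← hsum] at hc
  exact (sum_eq_sum_iff_of_le fun x hx => h5 x (mem_range.1 hx)).1 hc.symm x (mem_range.2 hx)

/-- The specification of `completeProg`. -/
theorem run_completeProg {D : ℕ → ℕ} {M : Finset ℕ} (hE : CoreEnv G K₁ K₂ p c₁ c₂ s)
    (hK : K₁ + K₂ ≤ G.nX) (hA : Adm G.nX K₁ K₂ D) (hD2 : ∀ x, D x ≤ 2)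
    (hM : G.Feas (capD c₁ c₂ D) M) (h1 : ∀ x < G.nX, 0 ≤ c₁ x) (h2 : ∀ x < G.nX, 0 ≤ c₂ x)
    (hD : Holds s .bestD G.nX fun x => D x)
    (hbest : Holds s .best G.nE fun e => if e ∈ M then 1 else 0)
    (hsum : ∀ D : ℕ → ℕ, ((range G.nX).filter fun x => D x = 1).card = K₁ →
      ((range G.nX).filter fun x => D x = 2).card = K₂ →
      ∑ x ∈ range G.nX, capD c₁ c₂ D x = G.nY) :
    ∃ D' Φ : ℕ → ℕ, (∀ x, D' x ≤ 2) ∧ ((range G.nX).filter fun x => D' x = 1).card = K₁ ∧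
      ((range G.nX).filter fun x => D' x = 2).card = K₂ ∧
      (Holds (completeProg.run s) .outW G.nX fun x => if D' x = 0 then 0 else 1) ∧
      (Holds (completeProg.run s) .outPhi G.nY fun y => Φ y) ∧ (∀ y < G.nY, Φ y < G.nX) ∧
      (∀ e ∈ M, Φ (G.dst e) = G.src e) ∧
      ∀ x < G.nX, (((range G.nY).filter fun y => Φ y = x).card : ℤ) = capD c₁ c₂ D' x := by
  set s₁ := padProg.run s with hs₁
  set s₂ := committeeProg.run s₁ with hs₂
  set s₃ := matchedProg.run s₂ with hs₃
  have hrun : completeProg.run s = restProg.run s₃ := rfl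
  have a1 : Agree _ _ s s₁ := padProg.agree_run s
  have a2 : Agree _ _ s₁ s₂ := committeeProg.agree_run s₁
  have a3 : Agree _ _ s₂ s₃ := matchedProg.agree_run s₂
  have a4 : Agree _ _ s₃ (restProg.run s₃) := restProg.agree_run s₃
  have E1 := hE.agree a1 (by decide) (by decide)
  have E2 := E1.agree a2 (by decide) (by decide)
  have E3 := E2.agree a3 (by decide) (by decide)
  obtain ⟨D', d1, d2, d3, d4, d5⟩ := run_padProg hE hK hA hD2 hD
  obtain ⟨w1, w2⟩ := run_committeeProg E1 d2 d3
  -- Padding changes the types of closed vertices only, so no capacity shrinks and `M` stays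
  -- feasible.
  have hM' : G.Feas (capD c₁ c₂ D') M := hM.mono fun x hx => by
    by_cases h0 : D x = 0
    · have : 0 ≤ capD c₁ c₂ D' x := BGraph.capD_nonneg h1 h2 D' x hx
      simpa [capD, h0] using this
    · simp only [capD, d1 x h0]; rfl
  obtain ⟨Φ, f1, f2⟩ := run_matchedProg E2 hM'
    ((hbest.agree a1 (by decide)).agree a2 (by decide)) w2
  obtain ⟨Φ', g1, g2, g3⟩ := run_restProg E3 (hsum D' d4 d5) f1 fun x hx => by
    refine le_trans ?_ (hM'.load x hx)
    have : ((M.image G.dst).filter fun y => Φ y = x) ⊆ (M.filter fun e => G.src e = x).image G.dst := by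
      intro y hy
      obtain ⟨hy, hyx⟩ := mem_filter.1 hy
      obtain ⟨e, he, rfl⟩ := mem_image.1 hy
      exact mem_image_of_mem _ (mem_filter.2 ⟨he, by rw [← f2 e he, hyx]⟩)
    exact_mod_cast (card_le_card this).trans card_image_le
  rw [hrun]
  refine ⟨D', Φ', d2, d4, d5, (w1.agree a3 (by decide)).agree a4 (by decide),
    fun y hy => g1.phi y (mem_range.2 hy), fun y hy => g1.lt y (mem_range.2 hy), fun e he => ?_, g3⟩
  rw [g2 _ (mem_image_of_mem _ he), f2 e he]

end

/-! # Monroe winner determination -/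

/-- Read the scalars of the input. -/
def mLoad : FProg := block [
  assign .nY (.get .dims (.const 0)), assign .nX (.get .dims (.const 1)),
  assign .p (.get .dims (.const 2)), assign .K (.get .dims (.const 3))]

/-- Add the next edge. -/
def mEdge : FProg := block [setI .dst (.sc .nE) (.sc .va), setW .w (.sc .nE) .unit,
  assign .nE (.add (.sc .nE) (.const 1))]

/-- Build the approval graph. -/
def mBuild : FProg := block [assign .nE (.const 0), forTo .va .nY (forTo .vb .p mEdge)]

/-- Subtract `K` once more. -/
def mDivStep : FProg := ite (.ile (.sc .K) (.sc .r))
  (block [assign .r (.sub (.sc .r) (.sc .K)), assign .quo (.add (.sc .quo) (.const 1))]) skip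

/-- Divide the number of voters by `K`. -/
def mDivide : FProg := block [assign .r (.sc .nY), assign .quo (.const 0), forTo .va .nY mDivStep,
  assign .K2 (.sc .r), assign .K1 (.sub (.sc .K) (.sc .r))]

/-- Set the two capacities of every candidate. -/
def mCaps : FProg := forTo .vx .nX (block [
  setI .cap1 (.sc .vx) (.sc .quo),
  ite (.ile (.const 1) (.sc .r)) (setI .cap2 (.sc .vx) (.add (.sc .quo) (.const 1)))
    (setI .cap2 (.sc .vx) (.sc .quo))])

/-- The programs that prepare an election. -/
def mPrepare : List FProg := [mLoad, mBuild, mDivide, mCaps]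

/-- The programs that determine the winners. -/
def mPhases (q : ℕ) : List FProg := (mPrepare ++ corePhases q) ++ [completeProg]

/-- The places of the integer arrays. -/
def mIdx (a : IName) : ℕ :=
  if a = .dims then 0 else if a = .src then 1 else if a = .outW then 2 else if a = .outPhi then 3
  else a.ctorIdx + 4

theorem mIdx_injective : Function.Injective mIdx := by
  intro a b h
  simp only [mIdx] at h
  split_ifs at h <;> first | omega | exact ctorIdx_injective (by omega) | simp_all

theorem mIdx_lt (a : IName) : mIdx a < 100 := by
  cases a <;> decide

/-- The backend for Monroe winner determination. -/
def mBackend : Backend ℤ := intBackend mIdx mIdx_injective (fun b => b.ctorIdx + 100)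
  (fun _ _ h => RealBackend.ctorIdx_injective (Nat.add_right_cancel h))
  (fun a b => by have := mIdx_lt a; omega)

/-- Edge `i * k + j` stands for the `j`-th approval of voter `i`. With this numbering the ballot
array of the input already is the array of sources, and only the voters and the unit weights have to
be written. -/
theorem run_mBuild {s : St ℤ} {n k : ℕ} (hn : s.i .nY 0 = n) (hk : s.i .p 0 = k)
    (hu : s.unit = 1) :
    (mBuild.run s).i .nE 0 = (n * k : ℕ) ∧ ∀ e < n * k,
      (mBuild.run s).i .dst (e : ℕ) = (e / k : ℕ) ∧ (mBuild.run s).w .w (e : ℕ) = 1 := by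
  set Inv : ℕ → St ℤ → Prop := fun t s => s.i .nE 0 = t ∧ ∀ e < t,
    s.i .dst (e : ℕ) = (e / k : ℕ) ∧ s.w .w (e : ℕ) = 1 with hInv
  have a1 : Agree _ _ s (s.setI .nE 0 0) := agree_setI _ _ _ _
  change Inv (n * k) ((forTo .va .nY (forTo .vb .p mEdge)).run (s.setI .nE 0 0))
  refine run_forTo_inv (by rw [a1.i .nY (by decide), hn]) (fun j s => Inv (j * k) s)
    (fun j s z h => by simpa [hInv] using h) (by simp [hInv]) fun j s' hj ha hv h => ?_
  have := run_forTo_inv (v := .vb) (n := .p) (P := mEdge) (s := s') (m := k)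
    (by rw [ha.i .p (by decide), a1.i .p (by decide), hk]) (fun l s => Inv (j * k + l) s)
    (fun l s z h => by simpa [hInv] using h) h (by
      intro l s'' hl ha' hv' h
      have va : s''.i .va 0 = j := by rw [ha'.i .va (by decide), hv]
      have un : s''.unit = 1 := by rw [ha'.unit, ha.unit, a1.unit, hu]
      refine ⟨by simp [mEdge, block, run, IX.eval, h.1]; ring, fun e he => ?_⟩
      rcases (by omega : e < j * k + l ∨ e = j * k + l) with he | rfl
      · have h1 := h.2 e he
        have hne : (e : ℤ) ≠ j * k + l := by
          have : e ≠ j * k + l := by omega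
          exact_mod_cast this
        simpa [mEdge, block, run, IX.eval, WX.eval, h.1, hne] using h1
      · have hdiv : (j * k + l) / k = j := by
          rw [mul_comm, Nat.mul_add_div (by omega), Nat.div_eq_of_lt hl, add_zero]
        rw [hdiv]
        simp [mEdge, block, run, IX.eval, WX.eval, h.1, va, un])
  rwa [← Nat.succ_mul] at this

/-- Division by repeated subtraction: `K * a + b = n` is kept, and `n` attempts suffice because `1 ≤
K`. -/
theorem run_mDivide {s : St ℤ} {n K : ℕ} (hn : s.i .nY 0 = n) (hK : s.i .K 0 = K) (h1 : 1 ≤ K) :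
    (mDivide.run s).i .quo 0 = (n / K : ℕ) ∧ (mDivide.run s).i .r 0 = (n % K : ℕ) ∧
    (mDivide.run s).i .K1 0 = (K - n % K : ℕ) ∧ (mDivide.run s).i .K2 0 = (n % K : ℕ) := by
  set s₁ := (s.setI .r 0 (s.i .nY 0)).setI .quo 0 0 with hs₁
  set s₂ := (forTo .va .nY mDivStep).run s₁ with hs₂
  have a1 : Agree [.r, .quo] [] s s₁ :=
    ((agree_setI s .r 0 (s.i .nY 0)).mono (by decide) (by decide)).trans
      ((agree_setI _ _ _ _).mono (by decide) (by decide))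
  have a2 : Agree _ _ s₁ s₂ := (forTo .va .nY mDivStep).agree_run s₁
  have k2 : s₂.i .K 0 = K := by rw [a2.i .K (by decide), a1.i .K (by decide), hK]
  obtain ⟨a, b, ha, hb, hab, hor⟩ : ∃ a b : ℕ, s₂.i .quo 0 = a ∧ s₂.i .r 0 = b ∧ K * a + b = n ∧
      (b < K ∨ a = n) := by
    refine run_forTo_inv (by rw [a1.i .nY (by decide), hn]) (fun j s' => ∃ a b : ℕ,
      s'.i .quo 0 = a ∧ s'.i .r 0 = b ∧ K * a + b = n ∧ (b < K ∨ a = j))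
      (fun j s' z h => by simpa using h) ⟨0, n, by simp [hs₁], by simp [hs₁, hn], by simp, .inr rfl⟩ ?_
    rintro j s' hj hag hv ⟨a, b, ha, hb, hab, hor⟩
    have hK' : s'.i .K 0 = K := by rw [hag.i .K (by decide), a1.i .K (by decide), hK]
    simp only [mDivStep, run, BX.Holds, IX.eval, hK', hb]
    split_ifs with h
    · refine ⟨a + 1, b - K, by simp [block, run, IX.eval, ha], ?_, ?_, .inr (by omega)⟩
      · simp only [block, run, IX.eval, hb, hK', St.setI_i_of_ne, ne_eq, reduceCtorEq,
          not_false_eq_true, St.setI_i_self, Function.update_self]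
        omega
      · rw [mul_add, mul_one]
        omega
    · exact ⟨a, b, ha, hb, hab, .inl (by omega)⟩
  -- If all `n` rounds subtracted, then `K * n + b = n`, which leaves `b = 0`.
  have hbK : b < K := by
    rcases hor with h | rfl
    · exact h
    · have := Nat.mul_le_mul_right a h1
      omega
  have hdiv : n / K = a := by
    rw [← hab, Nat.mul_add_div (by omega), Nat.div_eq_of_lt hbK, add_zero]
  have hmod : n % K = b := by
    rw [← hab, Nat.mul_add_mod, Nat.mod_eq_of_lt hbK]
  have hrun : mDivide.run s = (s₂.setI .K2 0 (s₂.i .r 0)).setI .K1 0 (s₂.i .K 0 - s₂.i .r 0) := by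
    simp [mDivide, block, run, IX.eval, hs₂, hs₁]
  rw [hrun, hdiv, hmod]
  refine ⟨by simp [ha], by simp [hb], ?_, by simp [hb]⟩
  simp [k2, hb, Nat.cast_sub hbK.le]

theorem ceilDiv_eq_ite (n : ℕ) {K : ℕ} (h : 1 ≤ K) :
    n ⌈/⌉ K = if 1 ≤ n % K then n / K + 1 else n / K := by
  rw [Nat.ceilDiv_eq_add_pred_div]
  have h1 := Nat.div_add_mod n K
  have h2 := Nat.mod_lt n h
  rw [Nat.div_eq_iff (by omega)]
  rw [mul_comm] at h1
  split_ifs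
  · rw [add_mul, one_mul]; omega
  · omega

/-! ### Elections as matching problems with two quotas -/

namespace MonroeInst

variable (I : MonroeInst)

/-- The approval graph. -/
def graph : BGraph ℤ where
  nX := I.m
  nY := I.n
  nE := I.n * I.k
  src e := if h : e < I.n * I.k then I.ballot (Fin.divNat ⟨e, h⟩) (Fin.modNat ⟨e, h⟩) else 0
  dst e := e / I.k
  u _ := 1
  src_lt e h := by simp [h]
  dst_lt e h := Nat.div_lt_of_lt_mul (by rwa [mul_comm])

@[simp] theorem graph_src (e : Fin (I.n * I.k)) :
    I.graph.src e = I.ballot e.divNat e.modNat := by simp [graph]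

theorem val_graph (M : Finset ℕ) : I.graph.val M = M.card := by simp [BGraph.val, graph]

/-- The smaller capacity of the candidates. -/
def quota₁ (_ : ℕ) : ℤ := (I.n / I.K : ℕ)

/-- The larger capacity of the candidates. -/
def quota₂ (_ : ℕ) : ℤ := (I.n ⌈/⌉ I.K : ℕ)

theorem quota₂_eq (x : ℕ) :
    I.quota₂ x = if 1 ≤ I.n % I.K then I.quota₁ x + 1 else I.quota₁ x := by
  rw [quota₂, quota₁, ceilDiv_eq_ite _ I.one_le_K]
  split_ifs <;> simp

theorem quota₁_nonneg (x : ℕ) : 0 ≤ I.quota₁ x := Nat.cast_nonneg _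

theorem quota₂_nonneg (x : ℕ) : 0 ≤ I.quota₂ x := Nat.cast_nonneg _

theorem quota₁_le (x : ℕ) : I.quota₁ x ≤ I.quota₂ x := by
  rw [quota₂_eq]
  split_ifs <;> omega

theorem mod_add_sub : I.K - I.n % I.K + I.n % I.K = I.K :=
  Nat.sub_add_cancel (Nat.mod_lt _ I.one_le_K).le

/-- With `r = n mod K`, this is `(K - r) * ⌊n/K⌋ + r * (⌊n/K⌋ + 1) = K * ⌊n/K⌋ + r`; for `r = 0` the
second quota does not contribute. -/
theorem mul_quota : ((I.K - I.n % I.K : ℕ) : ℤ) * I.quota₁ 0 + (I.n % I.K : ℕ) * I.quota₂ 0 = I.n := by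
  have h1 : ((I.K * (I.n / I.K) + I.n % I.K : ℕ) : ℤ) = I.n := by rw [Nat.div_add_mod]
  have h2 : ((I.K - I.n % I.K : ℕ) : ℤ) = I.K - (I.n % I.K : ℕ) :=
    Nat.cast_sub (Nat.mod_lt _ I.one_le_K).le
  rw [h2, quota₂_eq]
  push_cast at h1 ⊢
  simp only [quota₁]
  split_ifs with h
  · push_cast; linarith
  · have h0 : I.n % I.K = 0 := by omega
    have h0' : (I.n : ℤ) % I.K = 0 := by exact_mod_cast h0
    rw [h0'] at h1 ⊢
    push_cast
    linarith

/-- If all types are used up, the capacities add up to the number of voters. -/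
theorem sum_capD {D : ℕ → ℕ} (h₁ : ((range I.m).filter fun x => D x = 1).card = I.K - I.n % I.K)
    (h₂ : ((range I.m).filter fun x => D x = 2).card = I.n % I.K) :
    ∑ x ∈ range I.m, capD I.quota₁ I.quota₂ D x = I.n := by
  have : ∀ x ∈ range I.m, capD I.quota₁ I.quota₂ D x =
      (if D x = 1 then I.quota₁ 0 else 0) + if D x = 2 then I.quota₂ 0 else 0 := by
    intro x _
    unfold capD
    split_ifs <;> first | omega | simp [quota₁, quota₂]
  rw [sum_congr rfl this, sum_add_distrib, ← sum_filter, ← sum_filter, sum_const, sum_const, h₁, h₂,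
    nsmul_eq_mul, nsmul_eq_mul]
  exact I.mul_quota

/-- The edges at voter `y` have quotient `y` by `k`, so they are told apart by their residues modulo
`k`. -/
theorem degree_graph_le (y : ℕ) :
    ((range I.graph.nE).filter fun e => I.graph.dst e = y).card ≤ I.k := by
  rw [← card_range I.k]
  refine card_le_card_of_injOn (· % I.k) (fun e he => ?_) fun e he e' he' h => ?_
  · have hlt : e < I.n * I.k := mem_range.1 (mem_filter.1 he).1
    have : 0 < I.k := by
      rcases Nat.eq_zero_or_pos I.k with h | h
      · rw [h, mul_zero] at hlt; omega
      · exact h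
    exact mem_coe.2 (mem_range.2 (Nat.mod_lt _ this))
  · have h1 : e / I.k = y := (mem_filter.1 he).2
    have h2 : e' / I.k = y := (mem_filter.1 he').2
    rw [← Nat.div_add_mod e I.k, ← Nat.div_add_mod e' I.k, h1, h2, show e % I.k = e' % I.k from h]

/-- With uniform weights, smaller capacities are exchanged by discarding edges. -/
theorem exchange_quota₁ {L x a : ℕ} {δ : ℤ} (hx : x < I.m) (ha : a < I.m) (hδ : 0 ≤ δ)
    (h : (I.graph.scale L).Exchange I.quota₂ δ x a) :
    (I.graph.scale L).Exchange I.quota₁ δ x a := by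
  intro M hM
  have hval : ∀ S : Finset ℕ, (I.graph.scale L).val S = L * S.card := fun S => by
    rw [BGraph.val_scale, val_graph]
  have hcard : ∀ S : Finset ℕ, (∀ e ∈ S, (I.graph.scale L).src e = a) → (S.card : ℤ) ≤ I.quota₁ a →
      ∀ z, ((S.filter fun e => (I.graph.scale L).src e = z).card : ℤ) ≤ single a (I.quota₁ a) z := by
    intro S hS hle z
    by_cases hz : z = a
    · subst hz
      rw [filter_true_of_mem hS]
      simpa [single] using hle
    · rw [filter_false_of_mem]
      · simp [single, hz]
      · intro e he h
        exact hz (h.symm.trans (hS e he))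
  obtain ⟨S, hS, hMS⟩ := h M (hM.mono fun z _ => by
    have := I.quota₁_le x
    unfold single
    split_ifs <;> omega)
  have hSa := hS.src_eq_of_single
  by_cases hc : (S.card : ℤ) ≤ I.quota₁ a
  · exact ⟨S, ⟨hS.lt, fun z _ => hcard S hSa hc z, hS.inj⟩, hMS⟩
  -- Here `S` is too large for the smaller quota, whereas `M` obeys it. Any `⌊n/K⌋` edges of `S` are
  -- worth at least as much as `M`, because all weights are equal.
  · have hMc : (M.card : ℤ) ≤ (I.n / I.K : ℕ) := by
      have := hM.load x hx
      rw [filter_true_of_mem hM.src_eq_of_single] at this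
      simpa [single, quota₁] using this
    simp only [quota₁] at hc
    obtain ⟨T, hTS, hT⟩ := exists_subset_card_eq (s := S) (n := I.n / I.K) (by omega)
    refine ⟨T, ⟨fun e he => hS.lt e (hTS he), fun z _ => hcard T (fun e he => hSa e (hTS he)) ?_ z,
      (hS.subset hTS).inj⟩, ?_⟩
    · rw [hT]; rfl
    · rw [hval, hval, hT]
      have := mul_le_mul_of_nonneg_left hMc (Nat.cast_nonneg (α := ℤ) L)
      linarith

/-- If `n mod K` is positive, a seat with the larger quota is available for the source of `e`.
Otherwise the two quotas agree, and one of the `K ≥ 1` seats of type `1` serves. -/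
theorem exists_adm_singleton {e : ℕ} (he : e < I.graph.nE) (hc : 1 ≤ I.quota₂ (I.graph.src e)) :
    ∃ D, Adm I.graph.nX (I.K - I.n % I.K) (I.n % I.K) D ∧
      I.graph.Feas (capD I.quota₁ I.quota₂ D) {e} := by
  have hnn := BGraph.capD_nonneg (n := I.graph.nX) (fun x _ => I.quota₁_nonneg x)
    (fun x _ => I.quota₂_nonneg x)
  by_cases hr : 1 ≤ I.n % I.K
  · exact ⟨_, adm_single (d := 2) (I.graph.src e) (by simp) fun _ => hr,
      BGraph.feas_singleton (hnn _) he (by simpa [capD] using hc)⟩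
  · refine ⟨_, adm_single (d := 1) (I.graph.src e) (fun _ => ?_) (by simp),
      BGraph.feas_singleton (hnn _) he ?_⟩
    · have := I.one_le_K
      omega
    · rw [quota₂_eq, if_neg hr] at hc
      simpa [capD] using hc

/-- The types of the candidates of a feasible committee. -/
theorem exists_adm {W : Finset (Fin I.m)} {Φ : Fin I.n → Fin I.m} (h : I.Feasible W Φ) :
    ∃ D, Adm I.m (I.K - I.n % I.K) (I.n % I.K) D ∧ ∀ x : Fin I.m,
      ((univ.filter fun i => Φ i = x).card : ℤ) ≤ capD I.quota₁ I.quota₂ D x := by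
  obtain ⟨hW, hΦ, hload⟩ := h
  set load : Fin I.m → ℕ := fun a => (univ.filter fun i => Φ i = a).card with hl
  have hsum : ∑ a ∈ W, load a = I.n := by
    have := card_eq_sum_card_fiberwise (s := (univ : Finset (Fin I.n))) (t := W) (f := Φ)
      fun i _ => hΦ i
    rw [card_univ, Fintype.card_fin] at this
    exact this.symm
  -- The members with more than `⌊n/K⌋` voters. Since all members have at least `⌊n/K⌋`, counting
  -- the `n` voters leaves at most `n mod K` members in `T`.
  set T := W.filter fun a => I.n / I.K < load a with hT
  have hTc : T.card ≤ I.n % I.K := by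
    have h1 : ∑ a ∈ W, (I.n / I.K + if I.n / I.K < load a then 1 else 0) ≤ ∑ a ∈ W, load a := by
      refine sum_le_sum fun a ha => ?_
      have := (hload a ha).1
      split_ifs with h
      · exact h
      · exact this
    rw [sum_add_distrib, sum_const, hW, hsum, ← card_filter, smul_eq_mul] at h1
    have := Nat.div_add_mod I.n I.K
    change _ + T.card ≤ _ at h1
    omega
  -- Enlarging `T` to exactly `n mod K` members of `W` leaves exactly `K - n mod K` members for type
  -- `1`.
  obtain ⟨U, hTU, hUW, hU⟩ := exists_subsuperset_card_eq (filter_subset _ _ : T ⊆ W) hTc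
    (by rw [hW]; exact (Nat.mod_lt _ I.one_le_K).le)
  refine ⟨fun x => if h : x < I.m then if ⟨x, h⟩ ∈ U then 2 else if ⟨x, h⟩ ∈ W then 1 else 0 else 0,
    ⟨?_, ?_⟩, fun x => ?_⟩
  · rw [← hU, ← hW, ← card_sdiff_of_subset hUW, ← card_map Fin.valEmbedding]
    refine card_le_card fun x hx => ?_
    obtain ⟨hx, hD⟩ := mem_filter.1 hx
    rw [dif_pos (mem_range.1 hx)] at hD
    refine mem_map.2 ⟨⟨x, mem_range.1 hx⟩, ?_, rfl⟩
    rw [mem_sdiff]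
    split_ifs at hD with h1 h2 <;> first | omega | exact ⟨h2, h1⟩
  · rw [← hU, ← card_map Fin.valEmbedding]
    refine card_le_card fun x hx => ?_
    obtain ⟨hx, hD⟩ := mem_filter.1 hx
    rw [dif_pos (mem_range.1 hx)] at hD
    refine mem_map.2 ⟨⟨x, mem_range.1 hx⟩, ?_, rfl⟩
    split_ifs at hD with h1 h2 <;> first | exact h1 | omega
  · change (load x : ℤ) ≤ _
    by_cases hxU : x ∈ U
    · simpa [capD, hxU, quota₂] using (hload x (hUW hxU)).2
    · by_cases hxW : x ∈ W
      · have : ¬ I.n / I.K < load x := fun h => hxU (hTU (mem_filter.2 ⟨hxW, h⟩))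
        simp only [capD, Fin.is_lt, dite_true, Fin.eta, hxU, hxW, if_false, if_true, quota₁]
        omega
      · have : load x = 0 := by
          rw [hl, card_eq_zero, filter_eq_empty_iff]
          intro i _ h
          exact hxW (h ▸ hΦ i)
        simp [capD, hxU, hxW, this]

/-- The satisfied voters, each with the candidate that represents it, form a matching in the
approval graph whose weight is their number. Only the upper bounds on the loads enter. -/
theorem exists_matching {W : Finset (Fin I.m)} {Φ : Fin I.n → Fin I.m} (h : I.Feasible W Φ) :
    ∃ D M, Adm I.m (I.K - I.n % I.K) (I.n % I.K) D ∧
      I.graph.Feas (capD I.quota₁ I.quota₂ D) M ∧ ∑ i, I.utility i (Φ i) ≤ (I.graph.val M : ℝ) := by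
  obtain ⟨D, hD, hload⟩ := I.exists_adm h
  set N := univ.filter fun e : Fin (I.n * I.k) => I.ballot e.divNat e.modNat = Φ e.divNat with hN
  have hinj : ∀ e ∈ N, ∀ e' ∈ N, e.divNat = e'.divNat → e = e' := by
    intro e he e' he' hdiv
    have h1 := (mem_filter.1 he).2
    have h2 := (mem_filter.1 he').2
    rw [← hdiv] at h2
    have h3 := I.ballot_injective _ (h1.trans h2.symm)
    have h4 : (e : ℕ) / I.k = e' / I.k := congrArg Fin.val hdiv
    have h5 : (e : ℕ) % I.k = e' % I.k := congrArg Fin.val h3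
    refine Fin.ext ?_
    rw [← Nat.div_add_mod (e : ℕ) I.k, ← Nat.div_add_mod (e' : ℕ) I.k, h4, h5]
  refine ⟨D, N.map Fin.valEmbedding, hD, ⟨?_, ?_, ?_⟩, ?_⟩
  · intro e he
    obtain ⟨f, _, rfl⟩ := mem_map.1 he
    exact f.2
  · intro x hx
    refine le_trans ?_ (hload ⟨x, hx⟩)
    rw [filter_map, card_map]
    norm_cast
    refine card_le_card_of_injOn Fin.divNat (fun e he => ?_) fun e he e' he' h => ?_
    · obtain ⟨he, hs⟩ := mem_filter.1 he
      simp only [Function.comp, Fin.valEmbedding_apply, graph_src] at hs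
      refine mem_coe.2 (mem_filter.2 ⟨mem_univ _, ?_⟩)
      rw [← (mem_filter.1 he).2]
      exact Fin.ext hs
    · exact hinj e (mem_filter.1 he).1 e' (mem_filter.1 he').1 h
  · intro e he e' he' h
    obtain ⟨f, hf, rfl⟩ := mem_map.1 he
    obtain ⟨f', hf', rfl⟩ := mem_map.1 he'
    rw [hinj f hf f' hf' (Fin.ext h)]
  · classical
    simp only [utility]
    rw [sum_boole, val_graph, card_map]
    push_cast
    refine Nat.cast_le.2 (le_trans (card_le_card (t := N.image Fin.divNat) fun i hi => ?_) card_image_le)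
    -- A satisfied voter finds its representative at some place `j` of its ballot; the pair `(i, j)`
    -- encodes the corresponding edge.
    obtain ⟨j, hj⟩ := (mem_filter.1 hi).2
    have hsymm := finProdFinEquiv.symm_apply_apply (i, j)
    have h1 : (finProdFinEquiv (i, j)).divNat = i := congrArg Prod.fst hsymm
    have h2 : (finProdFinEquiv (i, j)).modNat = j := congrArg Prod.snd hsymm
    exact mem_image.2 ⟨_, mem_filter.2 ⟨mem_univ _, by rw [h1, h2, hj]⟩, h1⟩

/-- The state after preparing the election. -/
theorem coreEnv_input : CoreEnv I.graph (I.K - I.n % I.K) (I.n % I.K) I.k I.quota₁ I.quota₂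
      (runAll mPrepare (mBackend.abs I.input)) ∧
    Agree (mLoad.iw ++ mBuild.iw ++ mDivide.iw ++ mCaps.iw) [.w] (mBackend.abs I.input)
      (runAll mPrepare (mBackend.abs I.input)) ∧
    ∀ B, I.n ≤ B → I.m ≤ B → I.k ≤ B → BoundedAll B mPrepare (mBackend.abs I.input) := by
  set s := mBackend.abs I.input with hs
  set s₁ := mLoad.run s with hs₁
  set s₂ := mBuild.run s₁ with hs₂
  set s₃ := mDivide.run s₂ with hs₃
  set s₄ := mCaps.run s₃ with hs₄
  have hdims : s.i .dims = arrayOf ![(I.n : ℤ), (I.m : ℤ), (I.k : ℤ), (I.K : ℤ)] := rfl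
  have hsrc : s.i .src = arrayOf fun q : Fin (I.n * I.k) =>
    ((I.ballot q.divNat q.modNat : ℕ) : ℤ) := rfl
  have d0 : s.i .dims 0 = I.n := by rw [hdims]; simp [arrayOf]
  have d1 : s.i .dims 1 = I.m := by rw [hdims]; simp [arrayOf]
  have d2 : s.i .dims 2 = I.k := by rw [hdims]; simp [arrayOf]
  have d3 : s.i .dims 3 = I.K := by rw [hdims]; simp [arrayOf]
  have a1 : Agree _ _ s s₁ := mLoad.agree_run s
  have a2 : Agree _ _ s₁ s₂ := mBuild.agree_run s₁
  have a3 : Agree _ _ s₂ s₃ := mDivide.agree_run s₂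
  have a4 : Agree _ _ s₃ s₄ := mCaps.agree_run s₃
  have n1 : s₁.i .nY 0 = I.n := by simp [hs₁, mLoad, block, run, IX.eval, d0]
  have m1 : s₁.i .nX 0 = I.m := by simp [hs₁, mLoad, block, run, IX.eval, d1]
  have k1 : s₁.i .p 0 = I.k := by simp [hs₁, mLoad, block, run, IX.eval, d2]
  have K1 : s₁.i .K 0 = I.K := by simp [hs₁, mLoad, block, run, IX.eval, d3]
  obtain ⟨b1, b2⟩ := run_mBuild n1 k1 (by rw [a1.unit]; rfl)
  have n2 : s₂.i .nY 0 = I.n := by rw [a2.i .nY (by decide), n1]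
  have K2 : s₂.i .K 0 = I.K := by rw [a2.i .K (by decide), K1]
  obtain ⟨q1, q2, q3, q4⟩ := run_mDivide n2 K2 I.one_le_K
  have m3 : s₃.i .nX 0 = I.m := by rw [a3.i .nX (by decide), a2.i .nX (by decide), m1]
  have hr : runAll mPrepare s = s₄ := rfl
  rw [hr]
  refine ⟨⟨?_, ?_, ?_, ?_, ?_, ?_, ?_, ?_, ?_, ?_, ?_, ?_⟩, ?_, ?_⟩
  · rw [a4.i .nX (by decide), m3]; rfl
  · rw [a4.i .nY (by decide), a3.i .nY (by decide), n2]; rfl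
  · rw [a4.i .nE (by decide), a3.i .nE (by decide), b1]; rfl
  · rw [a4.i .K (by decide), a3.i .K (by decide), K2, I.mod_add_sub]
  · rw [a4.i .K1 (by decide), q3]
  · rw [a4.i .K2 (by decide), q4]
  · rw [a4.i .p (by decide), a3.i .p (by decide), a2.i .p (by decide), k1]
  · intro e he
    have he' : e < I.n * I.k := he
    rw [a4.i .src (by decide), a3.i .src (by decide), a2.i .src (by decide), a1.i .src (by decide),
      hsrc, arrayOf_natCast _ he']
    exact congrArg Nat.cast (I.graph_src ⟨e, he'⟩).symm
  · intro e he
    rw [a4.i .dst (by decide), a3.i .dst (by decide), (b2 e he).1]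
    rfl
  · refine (run_forTo_map m3 (by decide) I.quota₁ fun x s' hx ha hv _ => ?_).1
    have h1 := q1
    rw [← ha.i .quo (by decide)] at h1
    simp only [block, run, BX.Holds, IX.eval, ne_eq, reduceCtorEq, not_false_eq_true,
      St.setI_i_of_ne, hv, h1, quota₁]
    split_ifs <;> simp
  · refine (run_forTo_map m3 (by decide) I.quota₂ fun x s' hx ha hv _ => ?_).1
    have h1 := q1
    have h2 := q2
    rw [← ha.i .quo (by decide)] at h1
    rw [← ha.i .r (by decide)] at h2
    rw [quota₂_eq]
    simp only [block, run, BX.Holds, IX.eval, ne_eq, reduceCtorEq, not_false_eq_true,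
      St.setI_i_of_ne, h2, hv, h1, quota₁]
    norm_cast
    split_ifs <;> simp
  · intro e he
    rw [a4.w .w (by decide), a3.w .w (by decide), (b2 e he).2]
    rfl
  · exact (((a1.mono (by decide) (by decide)).trans (a2.mono (by decide) (by decide))).trans
      (a3.mono (by decide) (by decide))).trans (a4.mono (by decide) (by decide))
  · intro B hn hm hk
    refine ⟨by simp [mLoad, block, bnds], fun b hb => ?_, fun b hb => ?_, fun b hb => ?_, trivial⟩
    · have h1 : mBuild.bnds = [.nY, .p] := rfl
      rw [h1] at hb
      simp only [List.mem_cons, List.not_mem_nil, or_false] at hb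
      rcases hb with rfl | rfl
      · rw [n1]; omega
      · rw [k1]; omega
    · have h1 : mDivide.bnds = [.nY] := rfl
      rw [h1, List.mem_singleton] at hb
      rw [hb, n2]
      omega
    · have h1 : mCaps.bnds = [.nX] := rfl
      rw [h1, List.mem_singleton] at hb
      rw [hb, m3]
      omega

/-- The state after the approximation algorithm. -/
theorem coreEnv_corePhases (q : ℕ) :
    CoreEnv I.graph (I.K - I.n % I.K) (I.n % I.K) I.k I.quota₁ I.quota₂
      (runAll (mPrepare ++ corePhases q) (mBackend.abs I.input)) := by
  rw [runAll_append]
  exact I.coreEnv_input.1.agree (agree_corePhases q _) (by decide) (by decide)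

theorem exists_run (q : ℕ) : ∃ c d : ℕ, ∀ I : MonroeInst, ∃ t r',
    Exec (mBackend.compileAll (mPhases q)) I.input t r' ∧
      mBackend.abs r' = runAll (mPhases q) (mBackend.abs I.input) ∧
      t ≤ c * (paramBound q I.K I.k * (I.n + I.m + I.n * I.k + 1) + 1) ^ d := by
  obtain ⟨c, d, h⟩ := mBackend.exec_compileAll (mPhases q) (by
    intro P hP
    simp only [mPhases, mPrepare, List.mem_append, List.mem_cons, List.not_mem_nil, or_false] at hP
    rcases hP with ((rfl | rfl | rfl | rfl) | hP) | rfl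
    · decide
    · decide
    · decide
    · decide
    · exact okAll_corePhases q P hP
    · decide)
  refine ⟨c, d, fun I => h _ _ ?_⟩
  obtain ⟨hC, _, hb⟩ := I.coreEnv_input
  obtain ⟨p1, p2, p3, p4, p5⟩ := paramBound_spec q I.K I.k
  set B := paramBound q I.K I.k * (I.n + I.m + I.n * I.k + 1) with hB
  have hle : paramBound q I.K I.k ≤ B := Nat.le_mul_of_pos_right _ (by omega)
  have hpos : 1 ≤ paramBound q I.K I.k := le_trans (Nat.one_le_pow _ _ (by omega)) p4
  have hsize : I.n + I.m + I.n * I.k + 1 ≤ B := Nat.le_mul_of_pos_left _ (by omega)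
  refine BoundedAll.append (BoundedAll.append (hb B (by omega) (by omega) (by omega))
    (hC.boundedAll ?_ ?_ ?_ ?_ ?_ ?_ ?_ ?_)) ⟨fun b hb => ?_, trivial⟩
  · exact (by omega : I.m ≤ B)
  · exact (by omega : I.n ≤ B)
  · exact (by omega : I.n * I.k ≤ B)
  · rw [I.mod_add_sub]; omega
  · omega
  · rw [I.mod_add_sub]; exact p5 I.n _ (by omega) (by omega)
  · rw [I.mod_add_sub]; exact p3.trans hle
  · rw [I.mod_add_sub]; exact p4.trans hle
  · have h1 : completeProg.bnds ⊆ [.nX, .nY, .nE] := by decide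
    have hb' := h1 hb
    have hC' := I.coreEnv_corePhases q
    simp only [List.mem_cons, List.not_mem_nil, or_false] at hb'
    rcases hb' with rfl | rfl | rfl
    · rw [hC'.nX]; exact_mod_cast (by omega : I.m ≤ B)
    · rw [hC'.nY]; exact_mod_cast (by omega : I.n ≤ B)
    · rw [hC'.nE]; exact_mod_cast (by omega : I.n * I.k ≤ B)

/-- The completed assignment satisfies every voter covered by `M`, so its utility is at least the
size of `M`. The optimum is compared with `M` through `exists_matching`; the assignments made by the
completion can only add to the utility. -/
theorem exists_approx {α : ℝ} {q : ℕ} (hα : 0 < α) (hq : 1 ≤ q) (hαq : α * q ≤ q - 1)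
    {r' : RAMState} (habs : mBackend.abs r' = runAll (mPhases q) (mBackend.abs I.input)) :
    ∃ S : Finset (Fin I.m) × (Fin I.n → Fin I.m),
      ((∀ a : Fin I.m, r'.ints 2 ((a : ℕ) : ℤ) = if a ∈ S.1 then 1 else 0) ∧
        ∀ i : Fin I.n, r'.ints 3 ((i : ℕ) : ℤ) = ((S.2 i : ℕ) : ℤ)) ∧ I.Feasible S.1 S.2 ∧
      ∀ T : Finset (Fin I.m) × (Fin I.n → Fin I.m), I.Feasible T.1 T.2 →
        α * ∑ i, I.utility i (T.2 i) ≤ ∑ i, I.utility i (S.2 i) := by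
  obtain ⟨hC, hag, _⟩ := I.coreEnv_input
  obtain ⟨D₀, M, hD₀, hD₀2, hM, hM0, hbest, hbestD, happ⟩ := hC.runAll_corePhases hq
    (fun e _ => by rw [hag.i .best (by decide)]; rfl)
    (fun e _ => by rw [hag.i .bestD (by decide)]; rfl)
    I.degree_graph_le (fun x _ => I.quota₁_nonneg x) (fun x _ => I.quota₁_le x)
    (fun _ _ _ _ hx ha hδ h => I.exchange_quota₁ hx ha hδ h)
  rw [← runAll_append] at hbest hbestD
  obtain ⟨D, Φ, hD2, hD₁, hD₂, hW, hΦ, hΦlt, hΦM, hload⟩ := run_completeProg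
    (I.coreEnv_corePhases q) (by rw [I.mod_add_sub]; exact I.K_le_m) hD₀ hD₀2 hM
    (fun x _ => I.quota₁_nonneg x) (fun x _ => I.quota₂_nonneg x) hbestD hbest
    fun D h₁ h₂ => I.sum_capD h₁ h₂
  have hrun : mBackend.abs r' =
      completeProg.run (runAll (mPrepare ++ corePhases q) (mBackend.abs I.input)) := by
    rw [habs, mPhases, runAll_append]
    rfl
  rw [← hrun] at hW hΦ
  set W : Finset (Fin I.m) := univ.filter fun a : Fin I.m => D a ≠ 0 with hWdef
  set Φ' : Fin I.n → Fin I.m := fun i => ⟨Φ i, hΦlt i i.2⟩ with hΦ'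
  have hcount : ∀ a : Fin I.m, ((univ.filter fun i => Φ' i = a).card : ℤ) =
      capD I.quota₁ I.quota₂ D a := by
    intro a
    rw [← hload a a.2, ← card_map Fin.valEmbedding]
    congr 2
    ext y
    simp only [mem_map, mem_filter, mem_univ, true_and, mem_range, Fin.valEmbedding_apply]
    constructor
    · rintro ⟨i, rfl, rfl⟩
      exact ⟨i.2, rfl⟩
    · rintro ⟨hy, h⟩
      exact ⟨⟨y, hy⟩, Fin.ext h, rfl⟩
  have hfeas : I.Feasible W Φ' := by
    refine ⟨?_, fun i => ?_, fun a ha => ?_⟩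
    · rw [← I.mod_add_sub, ← hD₁, ← hD₂, ← card_union_of_disjoint (by
        rw [disjoint_filter]; intro x _ h1 h2; omega), ← filter_or, ← card_map Fin.valEmbedding]
      congr 1
      ext x
      have := hD2 x
      simp only [hWdef, mem_map, mem_filter, mem_univ, true_and, mem_range, Fin.valEmbedding_apply]
      constructor
      · rintro ⟨a, ha, rfl⟩
        exact ⟨a.2, by omega⟩
      · rintro ⟨hx, h⟩
        exact ⟨⟨x, hx⟩, by simp only; omega, rfl⟩
    -- A candidate that represents somebody has positive load, which equals its capacity, so its
    -- type is not `0`.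
    · have hpos : 0 < (univ.filter fun j => Φ' j = Φ' i).card := card_pos.2 ⟨i, by simp⟩
      have := hcount (Φ' i)
      refine mem_filter.2 ⟨mem_univ _, fun h0 => ?_⟩
      rw [capD, if_neg (by omega), if_neg (by omega)] at this
      omega
    · have h0 : D a ≠ 0 := (mem_filter.1 ha).2
      have h2 := hD2 a
      have h3 := hcount a
      have h4 := I.quota₁_le a
      simp only [capD] at h3
      simp only [quota₁, quota₂] at h3 h4
      split_ifs at h3 <;> omega
  have hval : (I.graph.val M : ℝ) ≤ ∑ i, I.utility i (Φ' i) := by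
    classical
    simp only [utility]
    rw [sum_boole, val_graph]
    push_cast
    rw [← card_map Fin.valEmbedding, ← card_image_of_injOn fun e he e' he' => hM.inj e he e' he']
    refine Nat.cast_le.2 (card_le_card fun y hy => ?_)
    obtain ⟨e, he, rfl⟩ := mem_image.1 hy
    have hlt : e < I.n * I.k := hM.lt e he
    refine mem_map.2 ⟨Fin.divNat ⟨e, hlt⟩, mem_filter.2 ⟨mem_univ _, Fin.modNat ⟨e, hlt⟩, ?_⟩, rfl⟩
    refine Fin.ext ?_
    rw [← I.graph_src ⟨e, hlt⟩]
    exact (hΦM e he).symm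
  refine ⟨(W, Φ'), ⟨fun a => ?_, fun i => hΦ i i.2⟩, hfeas, fun T hT => ?_⟩
  · refine (hW a a.2).trans ?_
    by_cases h : D a = 0 <;> simp [hWdef, h]
  · obtain ⟨D', M', hD', hM', hTv⟩ := I.exists_matching hT
    have h1 := happ (fun e he hc => I.exists_adm_singleton he hc) D' M' hD' hM'
    have h2 : ((q : ℝ) - 1) * I.graph.val M' ≤ q * I.graph.val M := by exact_mod_cast h1
    have h3 := ratio_le hα hq hαq (by exact_mod_cast hM0) h2
    exact (mul_le_mul_of_nonneg_left hTv hα.le).trans (h3.trans hval)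

end MonroeInst

theorem hasFPTApproxScheme_monroeApproval : HasFPTApproxScheme monroeApproval := by
  intro α hα hα1
  obtain ⟨q, hq, hαq⟩ := exists_ratio hα1
  obtain ⟨c, d, hrun⟩ := MonroeInst.exists_run q
  refine ⟨mBackend.compileAll (mPhases q), fun I => ?_, ?_⟩
  · obtain ⟨t, r', hexec, habs, _⟩ := hrun I
    obtain ⟨S, hS⟩ := MonroeInst.exists_approx I hα hq hαq habs
    exact ⟨t, r', S, hexec, hS⟩
  -- The parameter is the pair `(k, K)`, and `k` is the bound on the degrees, hence the exchanged
  -- arguments of `paramBound`.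
  · refine runsInFPTTime_of_bound (g := fun x => paramBound q x.2 x.1) (c := c) (d := d)
      ((primrec_paramBound q).comp Primrec.snd Primrec.fst) (fun I => Nat.le_add_left _ _) fun I => ?_
    obtain ⟨t, r', hexec, _, ht⟩ := hrun I
    exact ⟨t, r', hexec, ht⟩

theorem corollary3 :
    HasFPTApproxScheme weightedBMatching ∧ HasFPTApproxScheme monroeApproval :=
  ⟨hasFPTApproxScheme_weightedBMatching, hasFPTApproxScheme_monroeApproval⟩
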